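/- Let $\Delta$ be a reduced crystallographic (finite) root system over $\mathbf C$ with simple roots $\alpha_1,\dots,\alpha_n$, fundamental weights $\omega_1,\dots,\omega_n$, positive roots $\Delta_+$, Weyl group $W$ with length function $l$ (with respect to the simple reflections) and longest element $w_0$; let $\mathfrak h$ be the reflection representation, spanned by the roots, with basis $\omega_1,\dots,\omega_n$. For $\gamma\in\Delta_+$ write $\gamma^\vee=\sum_i m_i\alpha_i^\vee$, so $m_i=\langle\omega_i,\gamma^\vee\rangle$, and put $\mathrm{ht}(\gamma^\vee)=\sum_i m_i$. Let $R=\mathbf C[q^{\alpha_1^\vee},\dots,q^{\alpha_n^\vee}]$, $q^{\gamma^\vee}=\prod_i (q^{\alpha_i^\vee})^{m_i}$, and $\mathrm{Sym}_R(\mathfrak h_R)=R[\omega_1,\dots,\omega_n]$. Let $V=\bigoplus_{\alpha\in\Delta_+}\mathbf C[\alpha]$, with $[-\alpha]=-[\alpha]$, be the Yetter--Drinfeld module over $W$ in which $w[\alpha]=[w\alpha]$ and $[\alpha]$ has degree $s_\alpha$, with braiding $\Psi([\alpha]\otimes y)=s_\alpha y\otimes[\alpha]$. Let $\mathcal B(V)$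 be its Nichols algebra (the quotient of $T(V)$ by the kernel of the duality pairing of braided Hopf algebras, where $V^*\cong V$ via $\langle[\alpha],[\beta]\rangle=\delta_{\alpha\beta}$ for $\alpha,\beta\in\Delta_+$), and put $\mathcal B_R=R\otimes\mathcal B(V)$. For $\alpha\in\Delta_+$ let $\bar D_\alpha$ be the twisted derivation of $\mathcal B(V)$ with $\bar D_\alpha([\beta])=\delta_{\alpha\beta}$ $(\beta\in\Delta_+)$ and $\bar D_\alpha(xy)=\bar D_\alpha(x)y+s_\alpha(x)\bar D_\alpha(y)$. For a reduced decomposition $w=s_{\beta_1}\cdots s_{\beta_l}$ with $\beta_j$ simple, put $\bar D_w=\bar D_{\beta_1}\cdots\bar D_{\beta_l}$ and $\partial_w=\partial_{\beta_1}\cdots\partial_{\beta_l}$, where $\partial_\beta f=(f-s_\beta f)/\beta$. Let $\tilde\Delta_+$ be the set of $\gamma\in\Delta_+$ with $l(s_\gamma)=2\,\mathrm{ht}(\gamma^\vee)-1$. Fix non-zero constants $c_\gamma\in\mathbf C$ $(\gamma\in\Delta)$ with $c_{w\gamma}=c_\gamma$ for $w\in W$. For $\gamma\in\Delta_+$ let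 $\widetilde{[\gamma]}$ be the operator on $\mathcal B_R$ given by $c_\gamma[\gamma]+d_\gamma q^{\gamma^\vee}\bar D_{s_\gamma}$ if $\gamma\in\tilde\Delta_+$, and by $c_\gamma[\gamma]$ otherwise; here $[\gamma]$ acts by left multiplication and $d_\gamma=(c_{\beta_1}\cdots c_{\beta_l})^{-1}$ for a reduced decomposition $s_\gamma=s_{\beta_1}\cdots s_{\beta_l}$. Then there are (unique) $R$-algebra homomorphisms $\mu:\mathrm{Sym}_R(\mathfrak h_R)\to\mathcal B_R$ and $\tilde\mu:\mathrm{Sym}_R(\mathfrak h_R)\to\mathrm{End}_R(\mathcal B_R)$ with $$\mu(\omega_i)=\sum_{\gamma\in\Delta_+}c_\gamma\langle\omega_i,\gamma^\vee\rangle[\gamma],\qquad \tilde\mu(\omega_i)=\sum_{\gamma\in\Delta_+}\langle\omega_i,\gamma^\vee\rangle\widetilde{[\gamma]}\qquad(1\le i\le n),$$ and the following hold. (1) Suppose that $\Delta$ is of type $A_n$, with the standard numbering of the simple roots, and put $x_k=\omega_k-\omega_{k-1}$ for $1\le k\le n+1$ (with $\omega_0=\omega_{n+1}=0$) and $q_i=q^{\alpha_i^\vee}$.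 For $w\in S_{n+1}$ let $\mathfrak S_w$ be the Schubert polynomial in $x_1,\dots,x_{n+1}$, and let $\mathfrak S_w^q$ be the quantum Schubert polynomial. It is obtained by expanding $\mathfrak S_w$ as a linear combination of the products $e_{a_1}(x_1)e_{a_2}(x_1,x_2)\cdots e_{a_n}(x_1,\dots,x_n)$, $0\le a_k\le k$ (such an expansion exists), and replacing each $e_a(x_1,\dots,x_k)$ by the coefficient of $\lambda^a$ in $\det(1+\lambda G_k)$, where $G_k$ is the tridiagonal $k\times k$ matrix with diagonal $x_1,\dots,x_k$, superdiagonal $q_1,\dots,q_{k-1}$ and subdiagonal $-1,\dots,-1$. Then $\tilde\mu(\mathfrak S_w^q)(1)=\mu(\mathfrak S_w)$. (2) In general, for $w\in W$ let $X_w=\partial_{w^{-1}w_0}\bigl(|W|^{-1}\prod_{\gamma\in\Delta_+}\gamma\bigr)$ be the Bernstein--Gelfand--Gelfand polynomial, and let $X_w^q\in\mathrm{Sym}_R(\mathfrak h_R)$ be its quantization, i.e. a polynomial such that substituting for the $\omega_i$ the commuting operators $$Y_i=\omega_i+\sum_{\gamma\in\tilde\Delta_+}\langle\omega_i,\gamma^\vee\rangle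 q^{\gamma^\vee}\partial_{s_\gamma}$$ on $\mathrm{Sym}_R(\mathfrak h_R)$ and applying the result to $1$ gives $X_w$ (such a polynomial exists). Then $\tilde\mu(X_w^q)(1)=\mu(X_w)$. -/

import Mathlib

open MvPolynomial
open scoped TensorProduct

noncomputable section

namespace NicholsSchubert

/-! ### Words in a generating set of a group -/

section Words

variable {I G : Type*} [Group G]

/-- `l` is a word of minimal length in the generators `s` with product `w`. -/
def IsReducedWord (s : I → G) (l : List I) (w : G) : Prop :=
  (l.map s).prod = w ∧ ∀ l' : List I, (l'.map s).prod = w → l.length ≤ l'.length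

/-- A reduced word of `w` (one is chosen; it exists as soon as `s` generates `G` as a monoid). -/
def reducedWord (s : I → G) (w : G) : List I :=
  Classical.epsilon fun l => IsReducedWord s l w

/-- The length of `w` with respect to the generators `s`. -/
def wordLength (s : I → G) (w : G) : ℕ :=
  sInf {k | ∃ l : List I, (l.map s).prod = w ∧ l.length = k}

/-- An element of maximal length (the longest element, when `G` is a finite Coxeter group with
simple reflections `s`). -/
def longestElement (s : I → G) : G :=
  Classical.epsilon fun w₀ => ∀ v : G, wordLength s v ≤ wordLength s w₀

theorem isReducedWord_reducedWord (s : I → G) (w : G) (h : ∃ l : List I, (l.map s).prod = w) :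
    IsReducedWord s (reducedWord s w) w := by
  classical
  apply Classical.epsilon_spec (p := fun l => IsReducedWord s l w)
  have h' : ∃ k, ∃ l : List I, (l.map s).prod = w ∧ l.length = k := by
    obtain ⟨l, hl⟩ := h
    exact ⟨_, l, hl, rfl⟩
  obtain ⟨l, hl, hk⟩ := Nat.find_spec h'
  exact ⟨l, hl, fun l' hl' => hk ▸ Nat.find_min' h' ⟨l', hl', rfl⟩⟩

theorem wordLength_le_longestElement [Finite G] (s : I → G) (v : G) :
    wordLength s v ≤ wordLength s (longestElement s) :=
  Classical.epsilon_spec (p := fun w₀ => ∀ v : G, wordLength s v ≤ wordLength s w₀)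
    (Finite.exists_max (wordLength s)) v

end Words

/-! ### Reflections of a polynomial ring and divided differences -/

section DividedDifference

variable {σ K : Type*} [CommRing K]

/-- The substitution `X_j ↦ X_j - k_j a`.  When `a` is a root, the `X_j` form a basis of the
reflection representation and `k_j = ⟨X_j, a^∨⟩`, this is the action of the reflection in `a`. -/
def polyReflection (a : MvPolynomial σ K) (k : σ → K) : MvPolynomial σ K →ₐ[K] MvPolynomial σ K :=
  aeval fun j => X j - C (k j) * a

theorem exists_mul_eq_sub_polyReflection (a : MvPolynomial σ K) (k : σ → K)
    (f : MvPolynomial σ K) : ∃ g, a * g = f - polyReflection a k f := by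
  induction f using MvPolynomial.induction_on with
  | C c => exact ⟨0, by simp [polyReflection, algebraMap_eq]⟩
  | add p q hp hq =>
    obtain ⟨g, hg⟩ := hp
    obtain ⟨h, hh⟩ := hq
    exact ⟨g + h, by rw [mul_add, hg, hh, map_add]; ring⟩
  | mul_X p j hp =>
    obtain ⟨g, hg⟩ := hp
    refine ⟨g * X j + polyReflection a k p * C (k j), ?_⟩
    have hX : polyReflection a k (X j) = X j - C (k j) * a := by simp [polyReflection]
    rw [map_mul, hX]
    linear_combination X j * hg

/-- The divided difference `f ↦ (f - s f) / a`, where `s = polyReflection a k` (and `0` in the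
degenerate case `a = 0`). -/
def divDiff [IsDomain K] (a : MvPolynomial σ K) (k : σ → K) :
    MvPolynomial σ K →ₗ[K] MvPolynomial σ K :=
  open Classical in
  if ha : a = 0 then 0 else
    { toFun := fun f => (exists_mul_eq_sub_polyReflection a k f).choose
      map_add' := fun f g => mul_left_cancel₀ ha (by
        rw [(exists_mul_eq_sub_polyReflection a k (f + g)).choose_spec, mul_add,
          (exists_mul_eq_sub_polyReflection a k f).choose_spec,
          (exists_mul_eq_sub_polyReflection a k g).choose_spec, map_add]
        ring)
      map_smul' := fun c f => mul_left_cancel₀ ha (by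
        rw [(exists_mul_eq_sub_polyReflection a k (c • f)).choose_spec, RingHom.id_apply,
          mul_smul_comm, (exists_mul_eq_sub_polyReflection a k f).choose_spec, map_smul,
          smul_sub]) }

theorem mul_divDiff [IsDomain K] (a : MvPolynomial σ K) (ha : a ≠ 0) (k : σ → K)
    (f : MvPolynomial σ K) : a * divDiff a k f = f - polyReflection a k f := by
  simp only [divDiff, dif_neg ha]
  exact (exists_mul_eq_sub_polyReflection a k f).choose_spec

end DividedDifference

/-! ### The Nichols algebra of a root system

Throughout, `P` is a root pairing over `ℂ` with a base `b`. -/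

section Nichols

variable {ι M N : Type*} [AddCommGroup M] [Module ℂ M] [AddCommGroup N] [Module ℂ N]
  {P : RootPairing ι ℂ M N} (b : P.Base)

/-- The positive roots (as indices). -/
abbrev PosRoot : Type _ := {α : ι // b.IsPos α}

/-- The tensor algebra `T(V)` of `V = ⨁_{α > 0} ℂ [α]`. -/
abbrev TensorV : Type _ := FreeAlgebra ℂ (PosRoot b)

/-- The element `[γ]` of `V`, for every root `γ`, with `[-γ] = -[γ]`. -/
def bracket (γ : ι) : TensorV b :=
  open Classical in
  if h : b.IsPos γ then FreeAlgebra.ι ℂ ⟨γ, h⟩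
  else -FreeAlgebra.ι ℂ ⟨P.reflectionPerm γ γ, (RootPairing.Base.IsPos.neg_iff_not b γ).2 h⟩

/-- The action of the reflection `s_γ` on `T(V)`: the algebra automorphism with
`s_γ [β] = [s_γ β]`. -/
def reflT (γ : ι) : TensorV b →ₐ[ℂ] TensorV b :=
  FreeAlgebra.lift ℂ fun β : PosRoot b => bracket b (P.reflectionPerm γ β)

/-- Left multiplication by `Δ[β] = [β] ⊗ 1 + 1 ⊗ [β]` in the braided tensor square of `T(V)`.
Since `[β]` has degree `s_β`, the braiding is `Ψ([β] ⊗ x) = s_β x ⊗ [β]`, so that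
`([β] ⊗ 1) (x ⊗ y) = [β] x ⊗ y` and `(1 ⊗ [β]) (x ⊗ y) = s_β x ⊗ [β] y`. -/
def coprodStep (β : PosRoot b) : Module.End ℂ (TensorV b ⊗[ℂ] TensorV b) :=
  TensorProduct.map (LinearMap.mulLeft ℂ (FreeAlgebra.ι ℂ β)) LinearMap.id +
    TensorProduct.map (reflT b β).toLinearMap (LinearMap.mulLeft ℂ (FreeAlgebra.ι ℂ β))

/-- The coproduct of the braided Hopf algebra `T(V)`: it is multiplicative for the braided
product on `T(V) ⊗ T(V)`, and `Δ[β] = [β] ⊗ 1 + 1 ⊗ [β]`. -/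
def coproduct : TensorV b →ₗ[ℂ] TensorV b ⊗[ℂ] TensorV b :=
  LinearMap.applyₗ (1 ⊗ₜ[ℂ] 1) ∘ₗ (FreeAlgebra.lift ℂ (coprodStep b)).toLinearMap

/-- The counit of `T(V)`. -/
def counit : Module.Dual ℂ (TensorV b) := (FreeAlgebra.algebraMapInv (R := ℂ)).toLinearMap

/-- The functional `⟨[α], -⟩` on `T(V)`: the coefficient of `[α]`, which vanishes in all degrees
other than `1` and has `⟨[α], [β]⟩ = δ_{αβ}` (computed in the dual numbers, via `[α] ↦ ε` and
`[β] ↦ 0` for `β ≠ α`). -/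
def genCoeff (α : PosRoot b) : Module.Dual ℂ (TensorV b) :=
  open Classical in
  TrivSqZeroExt.sndHom ℂ ℂ ∘ₗ
    (FreeAlgebra.lift ℂ fun β : PosRoot b =>
      if β = α then (DualNumber.eps : DualNumber ℂ) else 0).toLinearMap

/-- The operation on functionals that sends `⟨η, -⟩` to `⟨[α] η, -⟩`, according to the rule
`⟨[α] η, x⟩ = ⟨[α], x₍₂₎⟩ ⟨η, x₍₁₎⟩`. -/
def pairingStep (α : PosRoot b) : Module.End ℂ (Module.Dual ℂ (TensorV b)) where
  toFun φ := LinearMap.mul' ℂ ℂ ∘ₗ TensorProduct.map φ (genCoeff b α) ∘ₗ coproduct b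
  map_add' φ ψ := by
    rw [TensorProduct.map_add_left, LinearMap.add_comp, LinearMap.comp_add]
  map_smul' c φ := by
    rw [TensorProduct.map_smul_left, LinearMap.smul_comp, LinearMap.comp_smul, RingHom.id_apply]

/-- The duality pairing `⟨ξ, x⟩` between `T(V*)` and `T(V)`, with `V*` identified with `V` by
`⟨[α], [β]⟩ = δ_{αβ}` for positive roots: it is given by `⟨1, x⟩ = ε(x)`,
`⟨[α], [β]⟩ = δ_{αβ}` and `⟨ξ η, x⟩ = ⟨ξ, x₍₂₎⟩ ⟨η, x₍₁₎⟩`. -/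
def dualityPairing : TensorV b →ₗ[ℂ] Module.Dual ℂ (TensorV b) :=
  LinearMap.applyₗ (counit b) ∘ₗ (FreeAlgebra.lift ℂ (pairingStep b)).toLinearMap

/-- Congruence modulo the kernel of the duality pairing. -/
def nicholsRel (x y : TensorV b) : Prop :=
  ∀ ξ : TensorV b, dualityPairing b ξ x = dualityPairing b ξ y

/-- The Nichols algebra `B(V)`: the quotient of `T(V)` by the kernel of the duality pairing.
It is identified with `B(V*)`. -/
abbrev Nichols : Type _ := RingQuot (nicholsRel b)

/-- The projection `T(V) → B(V)`. -/
def toNichols : TensorV b →ₐ[ℂ] Nichols b := RingQuot.mkAlgHom ℂ (nicholsRel b)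

/-! #### Auxiliary facts, needed for the twisted derivations to be well defined on `B(V)` -/

theorem reflectionPerm_neg (γ β : ι) :
    P.reflectionPerm γ (P.reflectionPerm β β) =
      P.reflectionPerm (P.reflectionPerm γ β) (P.reflectionPerm γ β) := by
  apply P.root.injective
  simp [RootPairing.root_reflectionPerm, RootPairing.reflection_reflectionPerm]

theorem bracket_pos (β : PosRoot b) : bracket b β = FreeAlgebra.ι ℂ β := by
  simp [bracket, β.2]

theorem bracket_neg (γ : ι) : bracket b (P.reflectionPerm γ γ) = -bracket b γ := by
  have key := RootPairing.Base.IsPos.neg_iff_not b γ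
  by_cases h : b.IsPos γ
  · have h' : ¬ b.IsPos (P.reflectionPerm γ γ) := fun h' => (key.1 h') h
    have hn : P.reflectionPerm (P.reflectionPerm γ γ) (P.reflectionPerm γ γ) = γ := by
      rw [← reflectionPerm_neg, RootPairing.reflectionPerm_self]
    simp [bracket, h, h', hn]
  · have h' : b.IsPos (P.reflectionPerm γ γ) := key.2 h
    simp [bracket, h, h']

theorem reflT_bracket (γ β : ι) :
    reflT b γ (bracket b β) = bracket b (P.reflectionPerm γ β) := by
  by_cases h : b.IsPos β
  · have := bracket_pos b ⟨β, h⟩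
    simp only at this
    rw [this, reflT, FreeAlgebra.lift_ι_apply]
  · have h' : b.IsPos (P.reflectionPerm β β) := (RootPairing.Base.IsPos.neg_iff_not b β).2 h
    have h1 : bracket b β = -FreeAlgebra.ι ℂ (⟨P.reflectionPerm β β, h'⟩ : PosRoot b) := by
      simp [bracket, h]
    rw [h1, map_neg, reflT, FreeAlgebra.lift_ι_apply, reflectionPerm_neg, bracket_neg, neg_neg]

theorem reflectionPerm_conj (γ β δ : ι) :
    P.reflectionPerm γ (P.reflectionPerm β δ) =
      P.reflectionPerm (P.reflectionPerm γ β) (P.reflectionPerm γ δ) := by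
  apply P.root.injective
  simp [RootPairing.root_reflectionPerm, RootPairing.reflection_reflectionPerm]

/-- The operator `x ↦ x₍₁₎ ⟨[α], x₍₂₎⟩` on `T(V)`. -/
def rightDer (α : PosRoot b) : TensorV b →ₗ[ℂ] TensorV b :=
  (TensorProduct.rid ℂ (TensorV b)).toLinearMap ∘ₗ
    LinearMap.lTensor (TensorV b) (genCoeff b α) ∘ₗ coproduct b

theorem word_induction {p : TensorV b → Prop} (h1 : p 1) (hadd : ∀ x y, p x → p y → p (x + y))
    (hsmul : ∀ (c : ℂ) x, p x → p (c • x)) (hmul : ∀ β x, p x → p (FreeAlgebra.ι ℂ β * x))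
    (x : TensorV b) : p x := by
  have key : ∀ a : TensorV b, ∀ y, p y → p (a * y) := by
    intro a
    induction a using FreeAlgebra.induction with
    | grade0 r => intro y hy; rw [← Algebra.smul_def]; exact hsmul r y hy
    | grade1 β => exact hmul β
    | mul a c ha hc => intro y hy; rw [mul_assoc]; exact ha _ (hc _ hy)
    | add a c ha hc => intro y hy; rw [add_mul]; exact hadd _ _ (ha _ hy) (hc _ hy)
  simpa using key x 1 h1

theorem coproduct_ι_mul (β : PosRoot b) (x : TensorV b) :
    coproduct b (FreeAlgebra.ι ℂ β * x) = coprodStep b β (coproduct b x) := by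
  simp only [coproduct, LinearMap.comp_apply, AlgHom.toLinearMap_apply, map_mul,
    FreeAlgebra.lift_ι_apply]
  rfl

theorem coproduct_one : coproduct b 1 = 1 ⊗ₜ[ℂ] 1 := by
  simp only [coproduct, LinearMap.comp_apply, AlgHom.toLinearMap_apply, map_one]
  rfl

theorem counit_ι_mul (β : PosRoot b) (x : TensorV b) :
    counit b (FreeAlgebra.ι ℂ β * x) = 0 := by
  simp [counit, FreeAlgebra.algebraMapInv]

theorem counit_one : counit b 1 = 1 := by
  simp [counit]

theorem counit_reflT (γ : ι) (x : TensorV b) : counit b (reflT b γ x) = counit b x := by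
  have h : (FreeAlgebra.algebraMapInv (R := ℂ)).comp (reflT b γ) =
      (FreeAlgebra.algebraMapInv (R := ℂ) (X := PosRoot b)) := by
    apply FreeAlgebra.hom_ext
    funext β
    simp only [Function.comp_apply, AlgHom.comp_apply, reflT, FreeAlgebra.lift_ι_apply, bracket]
    split_ifs <;> simp [FreeAlgebra.algebraMapInv]
  exact DFunLike.congr_fun h x

open Classical in
theorem genCoeff_ι_mul (α β : PosRoot b) (y : TensorV b) :
    genCoeff b α (FreeAlgebra.ι ℂ β * y) = if β = α then counit b y else 0 := by
  have hfst : ∀ y : TensorV b, ((FreeAlgebra.lift ℂ fun β : PosRoot b =>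
      if β = α then (DualNumber.eps : DualNumber ℂ) else 0) y).fst = counit b y := by
    intro y
    induction y using word_induction with
    | h1 => simp [counit_one]
    | hadd x y hx hy => simp [hx, hy]
    | hsmul c x hx => simp [hx]
    | hmul β x hx =>
      rw [counit_ι_mul, map_mul, TrivSqZeroExt.fst_mul, FreeAlgebra.lift_ι_apply]
      split_ifs <;> simp
  simp only [genCoeff, LinearMap.comp_apply, AlgHom.toLinearMap_apply, map_mul,
    FreeAlgebra.lift_ι_apply, TrivSqZeroExt.sndHom_apply, TrivSqZeroExt.snd_mul, hfst]
  split_ifs <;> simp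

theorem genCoeff_one (α : PosRoot b) : genCoeff b α 1 = 0 := by
  simp [genCoeff]

theorem counit_right (x : TensorV b) :
    TensorProduct.rid ℂ (TensorV b) (LinearMap.lTensor (TensorV b) (counit b) (coproduct b x)) =
      x := by
  induction x using word_induction with
  | h1 => simp [coproduct_one, counit_one]
  | hadd x y hx hy => simp [hx, hy]
  | hsmul c x hx => simp [hx]
  | hmul β x hx =>
    have key : ∀ t : TensorV b ⊗[ℂ] TensorV b,
        TensorProduct.rid ℂ (TensorV b) (LinearMap.lTensor (TensorV b) (counit b)
          (coprodStep b β t)) = FreeAlgebra.ι ℂ β *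
        TensorProduct.rid ℂ (TensorV b) (LinearMap.lTensor (TensorV b) (counit b) t) := by
      intro t
      induction t with
      | zero => simp
      | add t u ht hu => simp [ht, hu, mul_add]
      | tmul y z => simp [coprodStep, counit_ι_mul]
    rw [coproduct_ι_mul, key, hx]

open Classical in
theorem rightDer_ι_mul (α β : PosRoot b) (x : TensorV b) :
    rightDer b α (FreeAlgebra.ι ℂ β * x) =
      FreeAlgebra.ι ℂ β * rightDer b α x + (if β = α then (1 : ℂ) else 0) • reflT b β x := by
  have key : ∀ t : TensorV b ⊗[ℂ] TensorV b,
      TensorProduct.rid ℂ (TensorV b) (LinearMap.lTensor (TensorV b) (genCoeff b α)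
        (coprodStep b β t)) = FreeAlgebra.ι ℂ β *
      TensorProduct.rid ℂ (TensorV b) (LinearMap.lTensor (TensorV b) (genCoeff b α) t) +
      (if β = α then (1 : ℂ) else 0) • reflT b β
        (TensorProduct.rid ℂ (TensorV b) (LinearMap.lTensor (TensorV b) (counit b) t)) := by
    intro t
    induction t with
    | zero => simp
    | add t u ht hu => simp only [map_add, ht, hu, mul_add, smul_add]; abel
    | tmul y z =>
      simp only [coprodStep, LinearMap.add_apply, TensorProduct.map_tmul, map_add,
        LinearMap.lTensor_tmul, TensorProduct.rid_tmul, LinearMap.mulLeft_apply, genCoeff_ι_mul]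
      split_ifs <;> simp
  simp only [rightDer, LinearMap.comp_apply, LinearEquiv.coe_coe, coproduct_ι_mul, key,
    counit_right]

theorem rightDer_one (α : PosRoot b) : rightDer b α 1 = 0 := by
  simp [rightDer, coproduct_one, genCoeff_one]

theorem dualityPairing_one (x : TensorV b) : dualityPairing b 1 x = counit b x := by
  simp only [dualityPairing, LinearMap.comp_apply, AlgHom.toLinearMap_apply, map_one]
  rfl

theorem dualityPairing_ι_mul (α : PosRoot b) (η x : TensorV b) :
    dualityPairing b (FreeAlgebra.ι ℂ α * η) x = dualityPairing b η (rightDer b α x) := by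
  have key : ∀ φ : Module.Dual ℂ (TensorV b), pairingStep b α φ x = φ (rightDer b α x) := by
    intro φ
    simp only [pairingStep, rightDer, LinearMap.coe_mk, AddHom.coe_mk, LinearMap.comp_apply,
      LinearEquiv.coe_coe]
    generalize coproduct b x = t
    induction t with
    | zero => simp
    | add t u ht hu => simp only [map_add, ht, hu]
    | tmul y z => simp [mul_comm]
  rw [← key]
  simp only [dualityPairing, LinearMap.comp_apply, AlgHom.toLinearMap_apply, map_mul,
    FreeAlgebra.lift_ι_apply]
  rfl

theorem reflT_conj (γ β : ι) (x : TensorV b) :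
    reflT b γ (reflT b β x) = reflT b (P.reflectionPerm γ β) (reflT b γ x) := by
  have h : (reflT b γ).comp (reflT b β) =
      (reflT b (P.reflectionPerm γ β)).comp (reflT b γ) := by
    apply FreeAlgebra.hom_ext
    funext δ
    simp only [Function.comp_apply, AlgHom.comp_apply, ← bracket_pos b δ, reflT_bracket]
    rw [reflectionPerm_conj]
  exact DFunLike.congr_fun h x

theorem reflT_neg (γ : ι) : reflT b (P.reflectionPerm γ γ) = reflT b γ := by
  apply FreeAlgebra.hom_ext
  funext δ
  simp only [Function.comp_apply, ← bracket_pos b δ, reflT_bracket]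
  congr 1
  apply P.root.injective
  simp [RootPairing.root_reflectionPerm, RootPairing.reflection_reflectionPerm]

theorem reflT_reflT (γ : ι) (x : TensorV b) : reflT b γ (reflT b γ x) = x := by
  have h : (reflT b γ).comp (reflT b γ) = AlgHom.id ℂ (TensorV b) := by
    apply FreeAlgebra.hom_ext
    funext δ
    simp only [Function.comp_apply, AlgHom.comp_apply, ← bracket_pos b δ, reflT_bracket,
      RootPairing.reflectionPerm_self, AlgHom.id_apply]
  exact DFunLike.congr_fun h x

open Classical in
theorem rightDer_bracket_mul (α : PosRoot b) (δ : ι) (x : TensorV b) :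
    rightDer b α (bracket b δ * x) =
      bracket b δ * rightDer b α x + genCoeff b α (bracket b δ) • reflT b δ x := by
  have hι (β : PosRoot b) : genCoeff b α (FreeAlgebra.ι ℂ β) = if β = α then (1 : ℂ) else 0 := by
    rw [← mul_one (FreeAlgebra.ι ℂ β), genCoeff_ι_mul, counit_one]
  by_cases h : b.IsPos δ
  · have := bracket_pos b ⟨δ, h⟩
    simp only at this
    rw [this, rightDer_ι_mul, hι]
  · have h' : b.IsPos (P.reflectionPerm δ δ) := (RootPairing.Base.IsPos.neg_iff_not b δ).2 h
    have h1 : bracket b δ = -FreeAlgebra.ι ℂ (⟨P.reflectionPerm δ δ, h'⟩ : PosRoot b) := by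
      simp [bracket, h]
    rw [h1, neg_mul, map_neg, map_neg, rightDer_ι_mul, hι, neg_mul, neg_add, neg_smul, reflT_neg]

theorem exists_rightDer_reflT (γ : ι) (α : PosRoot b) : ∃ (α' : PosRoot b) (e : ℂ),
    ∀ x, rightDer b α (reflT b γ x) = e • reflT b γ (rightDer b α' x) := by
  classical
  have hι (α β : PosRoot b) :
      genCoeff b α (FreeAlgebra.ι ℂ β) = if β = α then (1 : ℂ) else 0 := by
    rw [← mul_one (FreeAlgebra.ι ℂ β), genCoeff_ι_mul, counit_one]
  suffices h : ∃ (α' : PosRoot b) (e : ℂ), ∀ β : PosRoot b,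
      genCoeff b α (bracket b (P.reflectionPerm γ β)) = e * if β = α' then 1 else 0 by
    obtain ⟨α', e, h⟩ := h
    refine ⟨α', e, fun x => ?_⟩
    induction x using word_induction with
    | h1 => simp [rightDer_one]
    | hadd x y hx hy => simp [hx, hy]
    | hsmul c x hx => simp only [map_smul, hx]; rw [smul_comm]
    | hmul β x hx =>
      rw [map_mul, ← bracket_pos b β, reflT_bracket, rightDer_bracket_mul, hx, bracket_pos,
        rightDer_ι_mul, map_add, map_mul, ← bracket_pos b β, reflT_bracket, map_smul,
        ← reflT_conj, h, smul_add, mul_smul, mul_smul_comm]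
  have hκ (δ : ι) : genCoeff b α (bracket b δ) =
      (if δ = α then 1 else 0) - (if P.reflectionPerm δ δ = α then 1 else 0) := by
    by_cases hδ : b.IsPos δ
    · have h1 := bracket_pos b ⟨δ, hδ⟩
      have h2 : P.reflectionPerm δ δ ≠ α := fun h =>
        (RootPairing.Base.IsPos.neg_iff_not b δ).1 (by change b.IsPos (P.reflectionPerm δ δ); rw [h]; exact α.2) hδ
      simp only at h1
      rw [h1, hι, if_neg h2, sub_zero]
      simp [Subtype.ext_iff]
    · have h2 : δ ≠ α := fun h => hδ (h ▸ α.2)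
      simp [bracket, hδ, hι, h2, Subtype.ext_iff]
  have hnn (δ : ι) : P.reflectionPerm (P.reflectionPerm δ δ) (P.reflectionPerm δ δ) = δ := by
    rw [← reflectionPerm_neg, RootPairing.reflectionPerm_self]
  have h1 (β : ι) : P.reflectionPerm γ β = α ↔ β = P.reflectionPerm γ α :=
    ⟨fun h => by rw [← h, RootPairing.reflectionPerm_self],
      fun h => by rw [h, RootPairing.reflectionPerm_self]⟩
  by_cases hpos : b.IsPos (P.reflectionPerm γ α)
  · refine ⟨⟨_, hpos⟩, 1, fun β => ?_⟩
    have h2 : P.reflectionPerm β.1 β.1 ≠ P.reflectionPerm γ α := fun h =>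
      (RootPairing.Base.IsPos.neg_iff_not b β.1).1
        (by change b.IsPos (P.reflectionPerm β.1 β.1); rw [h]; exact hpos) β.2
    rw [hκ, ← reflectionPerm_neg, h1, h1, if_neg h2, one_mul, sub_zero]
    simp [Subtype.ext_iff]
  · have hneg := (RootPairing.Base.IsPos.neg_iff_not b _).2 hpos
    refine ⟨⟨_, hneg⟩, -1, fun β => ?_⟩
    have h2 : β.1 ≠ P.reflectionPerm γ α := fun h => hpos (h ▸ β.2)
    have h3 : P.reflectionPerm β.1 β.1 = P.reflectionPerm γ α ↔
        β.1 = P.reflectionPerm (P.reflectionPerm γ α) (P.reflectionPerm γ α) :=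
      ⟨fun h => by rw [← h, hnn], fun h => by rw [h, hnn]⟩
    rw [hκ, ← reflectionPerm_neg, h1, h1, if_neg h2, h3, zero_sub, neg_one_mul]
    congr 1
    simp only [Subtype.ext_iff, RootPairing.indexNeg_neg]

theorem nicholsRel_rightDer (α : PosRoot b) {x y : TensorV b} (h : nicholsRel b x y) :
    nicholsRel b (rightDer b α x) (rightDer b α y) := fun ξ => by
  rw [← dualityPairing_ι_mul, ← dualityPairing_ι_mul, h]

theorem nicholsRel_reflT (γ : ι) {x y : TensorV b} (h : nicholsRel b x y) :
    nicholsRel b (reflT b γ x) (reflT b γ y) := by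
  have key : ∀ ξ : TensorV b, ∃ ξ' : TensorV b, ∀ z,
      dualityPairing b ξ (reflT b γ z) = dualityPairing b ξ' z := by
    intro ξ
    induction ξ using word_induction with
    | h1 => exact ⟨1, fun z => by rw [dualityPairing_one, dualityPairing_one, counit_reflT]⟩
    | hadd ξ η hξ hη =>
      obtain ⟨ξ', hξ⟩ := hξ
      obtain ⟨η', hη⟩ := hη
      exact ⟨ξ' + η', fun z => by simp [hξ, hη]⟩
    | hsmul c ξ hξ =>
      obtain ⟨ξ', hξ⟩ := hξ
      exact ⟨c • ξ', fun z => by simp [hξ]⟩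
    | hmul α ξ hξ =>
      obtain ⟨ξ', hξ⟩ := hξ
      obtain ⟨α', e, hα⟩ := exists_rightDer_reflT b γ α
      exact ⟨e • (FreeAlgebra.ι ℂ α' * ξ'), fun z => by
        rw [dualityPairing_ι_mul, hα, map_smul, hξ, map_smul, LinearMap.smul_apply,
          dualityPairing_ι_mul]⟩
  intro ξ
  obtain ⟨ξ', hξ⟩ := key ξ
  rw [hξ, hξ, h]

theorem toNichols_eq {x y : TensorV b} (h : nicholsRel b x y) : toNichols b x = toNichols b y :=
  RingQuot.mkAlgHom_rel ℂ h

/-! #### The twisted derivations -/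

/-- The action of the reflection `s_γ` on `B(V)`. -/
def reflB (γ : ι) : Nichols b →ₐ[ℂ] Nichols b :=
  RingQuot.liftAlgHom ℂ ⟨(toNichols b).comp (reflT b γ),
    fun _ _ h => toNichols_eq b (nicholsRel_reflT b γ h)⟩

open Classical in
/-- The algebra homomorphism `x ↦ !![s_α x, D_α x; 0, x]` from `T(V)` to matrices over `B(V)`,
where `D_α` is the twisted derivation; its multiplicativity is the twisted Leibniz rule. -/
def twistedDerT (α : PosRoot b) : TensorV b →ₐ[ℂ] Matrix (Fin 2) (Fin 2) (Nichols b) :=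
  FreeAlgebra.lift ℂ fun β : PosRoot b =>
    !![toNichols b (reflT b α (FreeAlgebra.ι ℂ β)), if α = β then 1 else 0;
      0, toNichols b (FreeAlgebra.ι ℂ β)]

theorem twistedDerT_apply (α : PosRoot b) (x : TensorV b) :
    twistedDerT b α x = !![toNichols b (reflT b α x), toNichols b (reflT b α (rightDer b α x));
      0, toNichols b x] := by
  classical
  induction x using word_induction with
  | h1 => simp [rightDer_one, Matrix.one_fin_two]
  | hadd x y hx hy => rw [map_add, hx, hy]; simp
  | hsmul c x hx => rw [map_smul, hx]; simp
  | hmul β x hx =>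
    have hβ : twistedDerT b α (FreeAlgebra.ι ℂ β) =
        !![toNichols b (reflT b α (FreeAlgebra.ι ℂ β)), if α = β then 1 else 0;
          0, toNichols b (FreeAlgebra.ι ℂ β)] := by
      simp [twistedDerT]
    rw [map_mul, hβ, hx, Matrix.mul_fin_two, rightDer_ι_mul]
    by_cases h : α = β
    · subst h
      simp [reflT_reflT]
    · simp [h, Ne.symm h]

/-- The homomorphism `x ↦ !![s_α x, D_α x; 0, x]` on `B(V)`. -/
def twistedDerB (α : PosRoot b) : Nichols b →ₐ[ℂ] Matrix (Fin 2) (Fin 2) (Nichols b) :=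
  RingQuot.liftAlgHom ℂ ⟨twistedDerT b α, fun x y h => by
    rw [twistedDerT_apply, twistedDerT_apply, toNichols_eq b h,
      toNichols_eq b (nicholsRel_reflT b α h),
      toNichols_eq b (nicholsRel_reflT b α (nicholsRel_rightDer b α h))]⟩

/-- The twisted derivation `D_α` of `B(V)`.  See `twistedDer_bracket` and `twistedDer_mul` for the
two rules that characterize it. -/
def twistedDer (α : PosRoot b) : Module.End ℂ (Nichols b) where
  toFun x := twistedDerB b α x 0 1
  map_add' x y := by simp
  map_smul' c x := by simp

theorem reflB_toNichols (γ : ι) (x : TensorV b) :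
    reflB b γ (toNichols b x) = toNichols b (reflT b γ x) := by
  simp [reflB, toNichols, RingQuot.liftAlgHom_mkAlgHom_apply]

theorem twistedDerB_apply (α : PosRoot b) (x : Nichols b) :
    twistedDerB b α x = !![reflB b α x, twistedDer b α x; 0, x] := by
  obtain ⟨x, rfl⟩ := RingQuot.mkAlgHom_surjective ℂ (nicholsRel b) x
  have h : twistedDerB b α (RingQuot.mkAlgHom ℂ (nicholsRel b) x) = twistedDerT b α x := by
    simp [twistedDerB, RingQuot.liftAlgHom_mkAlgHom_apply]
  have h' := reflB_toNichols b α x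
  rw [toNichols] at h'
  ext i j
  fin_cases i <;> fin_cases j <;> simp [twistedDer, h, h', twistedDerT_apply, toNichols]

open Classical in
/-- `D_α [β] = δ_{αβ}`. -/
theorem twistedDer_bracket (α β : PosRoot b) :
    twistedDer b α (toNichols b (bracket b β)) = if α = β then 1 else 0 := by
  rw [bracket_pos]
  simp [twistedDer, twistedDerB, toNichols, RingQuot.liftAlgHom_mkAlgHom_apply, twistedDerT]

/-- The twisted Leibniz rule `D_α (x y) = D_α(x) y + s_α(x) D_α(y)`. -/
theorem twistedDer_mul (α : PosRoot b) (x y : Nichols b) :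
    twistedDer b α (x * y) = twistedDer b α x * y + reflB b α x * twistedDer b α y := by
  have h := congrFun (congrFun (map_mul (twistedDerB b α) x y) 0) 1
  rw [twistedDerB_apply, twistedDerB_apply, twistedDerB_apply, Matrix.mul_fin_two] at h
  simpa [add_comm] using h

end Nichols

/-! ### Weyl group, coroot coefficients, Bernstein-Gelfand-Gelfand polynomials -/

section Weyl

variable {ι M N : Type*} [AddCommGroup M] [Module ℂ M] [AddCommGroup N] [Module ℂ N]
  {P : RootPairing ι ℂ M N} (b : P.Base)

/-- The reflections in the simple roots, as elements of the Weyl group. -/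
def simpleReflection (i : b.support) : P.weylGroup := RootPairing.weylGroup.ofIdx P i

/-- The integers `m_i` with `γ^∨ = ∑ i, m_i α_i^∨`, that is, `m_i = ⟨ω_i, γ^∨⟩` for the fundamental
weight `ω_i`. -/
def corootCoeff (γ : ι) (i : b.support) : ℤ := (b.flip.exists_root_eq_sum_int γ).choose i

theorem coroot_eq_sum_corootCoeff (γ : ι) :
    P.coroot γ = ∑ i, corootCoeff b γ i • P.coroot i := by
  have h := (b.flip.exists_root_eq_sum_int γ).choose_spec.2.2
  exact h.trans (Finset.sum_coe_sort b.support
    (fun i => (b.flip.exists_root_eq_sum_int γ).choose i • P.coroot i)).symm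

/-- The set of positive roots `γ` with `l(s_γ) = 2 ht(γ^∨) - 1`. -/
def IsSpecial (γ : ι) : Prop :=
  b.IsPos γ ∧ (wordLength (simpleReflection b) (RootPairing.weylGroup.ofIdx P γ) : ℤ) =
    2 * b.flip.height γ - 1

/-- The twisted derivation `D_w = D_{α₁} ⋯ D_{α_l}`, for a reduced decomposition
`w = s_{α₁} ⋯ s_{α_l}` into simple reflections. -/
def twistedDerW (w : P.weylGroup) : Module.End ℂ (Nichols b) :=
  ((reducedWord (simpleReflection b) w).map fun i : b.support =>
    twistedDer b ⟨i, b.isPos_of_mem_support i.2⟩).prod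

variable [P.IsCrystallographic] {K : Type*} [CommRing K] [IsDomain K]

/-- The root `γ = ∑ i, ⟨γ, α_i^∨⟩ ω_i` in `Sym(𝔥)`.  Here and below, `Sym(𝔥)` is the polynomial
ring in the fundamental weights `ω_i = X i`, which form a basis of the reflection representation. -/
def rootPoly (K : Type*) [CommRing K] (γ : ι) : MvPolynomial b.support K :=
  ∑ i : b.support, C (P.pairingIn ℤ γ i : K) * X i

/-- The Demazure operator `∂_γ f = (f - s_γ f) / γ`, with `s_γ ω_i = ω_i - ⟨ω_i, γ^∨⟩ γ`. -/
def demazure (K : Type*) [CommRing K] [IsDomain K] (γ : ι) :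
    Module.End K (MvPolynomial b.support K) :=
  divDiff (rootPoly b K γ) fun i => (corootCoeff b γ i : K)

/-- The operator `∂_w = ∂_{α₁} ⋯ ∂_{α_l}`, for a reduced decomposition
`w = s_{α₁} ⋯ s_{α_l}` into simple reflections. -/
def demazureW (K : Type*) [CommRing K] [IsDomain K] (w : P.weylGroup) :
    Module.End K (MvPolynomial b.support K) :=
  ((reducedWord (simpleReflection b) w).map fun i : b.support => demazure b K i).prod

open Classical in
/-- The Bernstein-Gelfand-Gelfand polynomial `X_w = ∂_{w⁻¹ w₀} (|W|⁻¹ ∏_{γ > 0} γ)`. -/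
def bggPoly [Fintype ι] (w : P.weylGroup) : MvPolynomial b.support ℂ :=
  demazureW b ℂ (w⁻¹ * longestElement (simpleReflection b))
    (C (Nat.card P.weylGroup : ℂ)⁻¹ * ∏ γ : PosRoot b, rootPoly b ℂ γ.1)

end Weyl

/-! ### Quantization -/

section Quantum

variable {ι M N : Type*} [Fintype ι] [AddCommGroup M] [Module ℂ M] [AddCommGroup N] [Module ℂ N]
  {P : RootPairing ι ℂ M N} (b : P.Base)

/-- The ring of quantum parameters `R = ℂ[q^{α^∨} | α simple]`. -/
abbrev QRing : Type _ := MvPolynomial b.support ℂ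

/-- `q^{γ^∨} = ∏ i, (q^{α_i^∨}) ^ m_i` for a positive root `γ` with `γ^∨ = ∑ i, m_i α_i^∨`. -/
def qCoroot (γ : ι) : QRing b := ∏ i : b.support, X i ^ (corootCoeff b γ i).toNat

/-- `Sym_R(𝔥_R)`, the polynomial ring over `R` in the fundamental weights. -/
abbrev SymR : Type _ := MvPolynomial b.support (QRing b)

/-- The scalar extension `B_R(V) = R ⊗ B(V)`. -/
abbrev NicholsR : Type _ := QRing b ⊗[ℂ] Nichols b

/-- The element `[γ]` of `B_R(V)`. -/
def bracketR (γ : ι) : NicholsR b := 1 ⊗ₜ[ℂ] toNichols b (bracket b γ)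

open Classical in
/-- The quantized element attached to a positive root `γ`, as an operator on `B_R(V)`: it is
`c_γ [γ] + d_γ q^{γ^∨} D_{s_γ}` if `l(s_γ) = 2 ht(γ^∨) - 1`, and `c_γ [γ]` otherwise.  Here `[γ]`
acts by left multiplication and `d_γ = (c_{α₁} ⋯ c_{α_l})⁻¹` for the reduced decomposition
`s_γ = s_{α₁} ⋯ s_{α_l}`. -/
def quantizedBracket (c : ι → ℂ) (γ : ι) : Module.End (QRing b) (NicholsR b) :=
  (C (c γ) : QRing b) • LinearMap.mulLeft (QRing b) (bracketR b γ) +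
    if IsSpecial b γ then
      (C ((reducedWord (simpleReflection b) (RootPairing.weylGroup.ofIdx P γ)).map
          fun i : b.support => c i).prod⁻¹ * qCoroot b γ : QRing b) •
        (twistedDerW b (RootPairing.weylGroup.ofIdx P γ)).baseChange (QRing b)
    else 0

open Classical in
/-- The classical element `μ(ω_i) = ∑_{γ > 0} c_γ ⟨ω_i, γ^∨⟩ [γ]`. -/
def classicalElement (c : ι → ℂ) (i : b.support) : NicholsR b :=
  ∑ γ : PosRoot b, (C (c γ * corootCoeff b γ i) : QRing b) • bracketR b γ

open Classical in
/-- The quantized element `∑_{γ > 0} ⟨ω_i, γ^∨⟩ [γ]~` corresponding to the fundamental weight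
`ω_i`. -/
def quantizedElement (c : ι → ℂ) (i : b.support) : Module.End (QRing b) (NicholsR b) :=
  ∑ γ : PosRoot b, (C (corootCoeff b γ i : ℂ) : QRing b) • quantizedBracket b c γ

variable [P.IsCrystallographic]

open Classical in
/-- The operator `Y_i = ω_i + ∑_γ ⟨ω_i, γ^∨⟩ q^{γ^∨} ∂_{s_γ}` on `Sym_R(𝔥_R)`, the sum being over
the positive roots `γ` with `l(s_γ) = 2 ht(γ^∨) - 1`. -/
def chevalleyOperator (i : b.support) : Module.End (QRing b) (SymR b) :=
  LinearMap.mulLeft (QRing b) (X i) +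
    ∑ γ : {γ : ι // IsSpecial b γ}, (C (corootCoeff b γ i : ℂ) * qCoroot b γ : QRing b) •
      demazureW b (QRing b) (RootPairing.weylGroup.ofIdx P γ.1)

/-- The inclusion `Sym(𝔥) → Sym_R(𝔥_R)`. -/
def toSymR : MvPolynomial b.support ℂ →ₐ[ℂ] SymR b := aeval X

/-- `F` is the quantization of `f`: substituting the (commuting) operators `Y_i` for the `ω_i` in
`F` and applying the result to `1` yields `f`. -/
def IsQuantization (f : MvPolynomial b.support ℂ) (F : SymR b) : Prop :=
  ∃ Φ : SymR b →ₐ[QRing b] Module.End (QRing b) (SymR b),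
    (∀ i, Φ (X i) = chevalleyOperator b i) ∧ Φ F 1 = toSymR b f

end Quantum

/-! ### Schubert polynomials and quantum Schubert polynomials -/

section TypeA

variable (n : ℕ)

/-- The simple transpositions of `S_{n+1}`. -/
def simpleTransposition (i : Fin n) : Equiv.Perm (Fin (n + 1)) := Equiv.swap i.castSucc i.succ

/-- The divided difference `∂_i f = (f - s_i f) / (x_i - x_{i+1})` on `ℂ[x_1, …, x_{n+1}]`. -/
def divDiffA (i : Fin n) : Module.End ℂ (MvPolynomial (Fin (n + 1)) ℂ) :=
  divDiff (X i.castSucc - X i.succ) (Pi.single i.castSucc 1 - Pi.single i.succ 1)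

/-- The Schubert polynomial `𝔖_w = ∂_{w⁻¹ w₀} (x_1^n x_2^{n-1} ⋯ x_n)`, for `w ∈ S_{n+1}`; here
`∂_u = ∂_{i₁} ⋯ ∂_{i_l}` for a reduced decomposition of `u`. -/
def schubertPoly (w : Equiv.Perm (Fin (n + 1))) : MvPolynomial (Fin (n + 1)) ℂ :=
  ((reducedWord (simpleTransposition n) (w⁻¹ * Fin.revPerm)).map (divDiffA n)).prod
    (∏ k : Fin (n + 1), X k ^ (n - (k : ℕ)))

/-- The coefficients of `det (1 + λ G_k)`, where `G_k` is the tridiagonal `k × k` matrix with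
diagonal `x_1, …, x_k`, superdiagonal `q_1, …, q_{k-1}` and subdiagonal `-1, …, -1`.  With `q = 0`
the coefficient of `λ^i` is the elementary symmetric polynomial `e_i(x_1, …, x_k)`, and in general
it is its quantum analogue. -/
def quantumElementary {A : Type*} [CommRing A] (x q : ℕ → A) (k i : ℕ) : A :=
  (1 + (Polynomial.X : Polynomial A) • Matrix.of fun r s : Fin k =>
    Polynomial.C (if r = s then x r else if (r : ℕ) + 1 = s then q r
      else if (s : ℕ) + 1 = r then -1 else 0)).det.coeff i

/-- The polynomial ring `ℂ[q_1, …, q_n]`. -/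
abbrev QA : Type := MvPolynomial (Fin n) ℂ

/-- The variables `x_1, …, x_{n+1}`, indexed from `0` and continued by `0`. -/
def xVar (k : ℕ) : MvPolynomial (Fin (n + 1)) (QA n) :=
  if h : k < n + 1 then X ⟨k, h⟩ else 0

/-- The variables `q_1, …, q_n`, indexed from `0` and continued by `0`. -/
def qVar (k : ℕ) : MvPolynomial (Fin (n + 1)) (QA n) :=
  if h : k < n then C (X ⟨k, h⟩) else 0

/-- `F` is the quantum Schubert polynomial of `w`: it arises from the expansion
`𝔖_w = ∑_a z_a e_{a_1}(x_1) e_{a_2}(x_1, x_2) ⋯ e_{a_n}(x_1, …, x_n)`, with `0 ≤ a_k ≤ k`, by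
replacing every elementary symmetric polynomial by its quantum analogue. -/
def IsQuantumSchubert (w : Equiv.Perm (Fin (n + 1))) (F : MvPolynomial (Fin (n + 1)) (QA n)) :
    Prop :=
  ∃ z : ((k : Fin n) → Fin ((k : ℕ) + 2)) → ℂ,
    map C (schubertPoly n w) =
      ∑ a, C (C (z a)) * ∏ k : Fin n, quantumElementary (xVar n) 0 ((k : ℕ) + 1) (a k) ∧
    F = ∑ a, C (C (z a)) *
      ∏ k : Fin n, quantumElementary (xVar n) (qVar n) ((k : ℕ) + 1) (a k)

variable {n}
variable {ι M N : Type*} [Fintype ι] [AddCommGroup M] [Module ℂ M] [AddCommGroup N] [Module ℂ N]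
  {P : RootPairing ι ℂ M N} (b : P.Base)

/-- For a root system of type `A_n` with simple roots numbered by `e`, the weight
`x_k = ω_k - ω_{k-1}` (`1 ≤ k ≤ n + 1`, with `ω_0 = ω_{n+1} = 0`); `k` is indexed from `0`. -/
def weightA (e : Fin n ≃ b.support) (k : Fin (n + 1)) : SymR b :=
  (if h : (k : ℕ) < n then X (e ⟨k, h⟩) else 0) -
    (if h : 0 < (k : ℕ) then X (e ⟨k - 1, by omega⟩) else 0)

/-- The homomorphism `ℂ[q_1, …, q_n][x_1, …, x_{n+1}] → Sym_R(𝔥_R)` with `q_i ↦ q^{α_i^∨}` and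
`x_k ↦ ω_k - ω_{k-1}`. -/
def polyToSymR (e : Fin n ≃ b.support) : MvPolynomial (Fin (n + 1)) (QA n) →+* SymR b :=
  eval₂Hom ((C : QRing b →+* SymR b).comp (rename e : QA n →ₐ[ℂ] QRing b).toRingHom) (weightA b e)

end TypeA

end NicholsSchubert

end

open NicholsSchubert

/-!
Both parts of the theorem follow from one commutation statement.  On `Sym_R(𝔥_R)` there are the
multiplications by weights and the Demazure operators `∂_i`; on `B_R(V)` there are the left
multiplications by `μ(m) = ∑_{γ > 0} c_γ ⟨m, γ^∨⟩ [γ]` and the scaled derivations `c_i⁻¹ D_i`.  Both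
pairs `(A, T)` obey the same rule

  `T_i A(m) = A(s_i m) T_i + ⟨m, α_i^∨⟩`,

and `μ` intertwines them (`map_linForm_mul`, `map_demazure`).  As the operators `Y_i` and `μ̃(ω_i)` are
given by one formula `A(m) + ∑_γ ⟨m, γ^∨⟩ q^{γ^∨} T_{s_γ}` in `A` and `T` (`quantumOp`), the
homomorphism `μ` carries `F(Y) 1` to `μ̃(F) 1` for every polynomial `F` (`map_apply_one`).  For
the quantization of a Bernstein-Gelfand-Gelfand polynomial, `F(Y) 1` is that polynomial by
definition.  For a quantum Schubert polynomial `F`, it remains to see that `F(Y) 1` is the Schubert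
polynomial (`IsQuantumSchubert.apply_one`).

Throughout, roots are represented by their indices; the index of `-γ` is `P.reflectionPerm γ γ`.  Sums
over positive roots are often written as sums over all roots, with terms invariant under `γ ↦ -γ`.

* The rule above implies the nil-Coxeter relations as soon as the module is generated from a vector
  killed by all `T_i` (`isNilCoxeter_of_cyclic`): commuting a product of the `T_i` past the generators
  gives a sum over inversions of shorter products, so that the relations follow by induction on the
  length.
* The elements `μ(m)` commute with each other, as all right derivatives of `μ(m) μ(n)` and
  `μ(n) μ(m)` agree (`nicholsRel_weightT_mul_comm`).
* The operators `A(m) + ∑_γ ⟨m, γ^∨⟩ q^{γ^∨} T_{s_γ}` commute (`commute_quantumOp`).  In the commutator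
  there remain the products `T_{s_γ} T_{s_δ}` of special reflections with lengths adding up, and the
  terms `T_{s_ε s_β}` in which `s_ε s_β` is covered by `s_ε`.  Commuting reflections cancel in pairs;
  for the others the formula `γ^∨ + δ^∨ = ε^∨` sets up a bijection between the two kinds of terms.
* Quantizations exist, because `Y_i` differs from the multiplication by `ω_i` in lower degree terms
  only (`exists_apply_one_eq`).
* In type `A`, divided differences preserve the span of the products `e_{a_1}(1) ⋯ e_{a_n}(n)` of
  elementary symmetric polynomials in initial sets of variables
  (`IsDividedDifference.elemProd_mem_elemSpan`), which gives the expansion of the Schubert polynomials.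
* Also in type `A`, the `k`-th quantum elementary polynomials in the operators `Y_i` act like ordinary
  elementary symmetric polynomials on polynomials which are symmetric in the first `k + 1` variables
  (`chevalleyHom_quantumElementary`).  In the recursion for `det (1 + λ G_k)` the operator `x_k` is
  applied to such a product, and of its correction terms all but the one for the simple root
  `x_{k-1} - x_k` vanish, since the reflections involved have other descents (`exists_descent`); the
  remaining term cancels the one with `q_{k-1}` in the recursion.
-/

set_option linter.unusedSectionVars false

namespace NicholsSchubert

/-! ### The action of the Weyl group on roots -/

section WeylAction

variable {ι M N : Type*} [AddCommGroup M] [Module ℂ M] [AddCommGroup N] [Module ℂ N]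
  {P : RootPairing ι ℂ M N}

theorem ofIdx_smul_idx (β γ : ι) : RootPairing.weylGroup.ofIdx P β • γ = P.reflectionPerm β γ :=
  rfl

theorem ofIdx_smul_vec (β : ι) (m : M) :
    RootPairing.weylGroup.ofIdx P β • m = P.reflection β m := rfl

theorem smul_root (w : P.weylGroup) (γ : ι) : w • P.root γ = P.root (w • γ) :=
  P.weylGroup_apply_root w γ

theorem weylGroup_induction {p : P.weylGroup → Prop} (one : p 1)
    (mul : ∀ u v, p u → p v → p (u * v)) (mem : ∀ i, p (RootPairing.weylGroup.ofIdx P i))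
    (w : P.weylGroup) : p w := by
  obtain ⟨w, hw⟩ := w
  induction hw using RootPairing.weylGroup.induction with
  | mem i => exact mem i
  | one => exact one
  | mul x y hx hy hx' hy' => exact mul ⟨x, hx⟩ ⟨y, hy⟩ hx' hy'

theorem weylGroup_ext {u v : P.weylGroup} (h : ∀ m : M, u • m = v • m) : u = v :=
  Subtype.ext (RootPairing.Equiv.weightHom_injective P (LinearEquiv.ext h))

theorem smul_reflectionPerm (w : P.weylGroup) (β γ : ι) :
    w • P.reflectionPerm β γ = P.reflectionPerm (w • β) (w • γ) := by
  induction w using weylGroup_induction generalizing β γ with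
  | one => simp
  | mul u v hu hv => simp only [mul_smul, hu, hv]
  | mem i => simpa only [ofIdx_smul_idx] using reflectionPerm_conj i β γ

theorem ofIdx_smul (w : P.weylGroup) (γ : ι) :
    RootPairing.weylGroup.ofIdx P (w • γ) = w * RootPairing.weylGroup.ofIdx P γ * w⁻¹ := by
  induction w using weylGroup_induction generalizing γ with
  | one => simp
  | mul u v hu hv => rw [mul_smul, hu, hv]; group
  | mem i =>
    rw [eq_mul_inv_iff_mul_eq]
    refine weylGroup_ext fun m => ?_
    simp only [mul_smul, ofIdx_smul_vec, ofIdx_smul_idx, RootPairing.reflection_reflectionPerm]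
    simp

theorem ofIdx_mul_self (γ : ι) :
    RootPairing.weylGroup.ofIdx P γ * RootPairing.weylGroup.ofIdx P γ = 1 :=
  weylGroup_ext fun m => by simp [mul_smul]

theorem ofIdx_inv (γ : ι) :
    (RootPairing.weylGroup.ofIdx P γ)⁻¹ = RootPairing.weylGroup.ofIdx P γ :=
  inv_eq_of_mul_eq_one_left (ofIdx_mul_self γ)

theorem ofIdx_neg (γ : ι) : RootPairing.weylGroup.ofIdx P (P.reflectionPerm γ γ) =
    RootPairing.weylGroup.ofIdx P γ := by
  rw [← ofIdx_smul_idx, ofIdx_smul, ofIdx_mul_self, one_mul, ofIdx_inv]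

theorem ofIdx_reflectionPerm (β γ : ι) :
    RootPairing.weylGroup.ofIdx P (P.reflectionPerm β γ) =
      RootPairing.weylGroup.ofIdx P β * RootPairing.weylGroup.ofIdx P γ *
        RootPairing.weylGroup.ofIdx P β := by
  rw [← ofIdx_smul_idx, ofIdx_smul, ofIdx_inv]

theorem neg_neg_idx (γ : ι) :
    P.reflectionPerm (P.reflectionPerm γ γ) (P.reflectionPerm γ γ) = γ := by
  rw [← reflectionPerm_neg, RootPairing.reflectionPerm_self]

theorem neg_eq_iff (β γ : ι) : P.reflectionPerm β β = γ ↔ β = P.reflectionPerm γ γ :=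
  ⟨fun h => by rw [← h, neg_neg_idx], fun h => by rw [h, neg_neg_idx]⟩

theorem neg_ne_idx (γ : ι) : P.reflectionPerm γ γ ≠ γ := fun h => P.ne_neg (i := γ) h.symm

theorem smul_neg_idx (w : P.weylGroup) (γ : ι) :
    w • P.reflectionPerm γ γ = P.reflectionPerm (w • γ) (w • γ) := smul_reflectionPerm w γ γ

theorem coroot'_smul (w : P.weylGroup) (γ : ι) (m : M) :
    P.coroot' (w • γ) (w • m) = P.coroot' γ m := by
  induction w using weylGroup_induction generalizing γ m with
  | one => simp
  | mul u v hu hv => simp only [mul_smul, hu, hv]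
  | mem i =>
    rw [ofIdx_smul_idx, ofIdx_smul_vec, RootPairing.coroot'_reflection,
      RootPairing.reflectionPerm_self]

theorem coroot'_neg (γ : ι) (m : M) :
    P.coroot' (P.reflectionPerm γ γ) m = -P.coroot' γ m := by
  rw [RootPairing.coroot', RootPairing.coroot', RootPairing.coroot_reflectionPerm]
  simp

variable [P.IsCrystallographic]

theorem coroot'_root (β γ : ι) : P.coroot' γ (P.root β) = (P.pairingIn ℤ β γ : ℂ) := by
  rw [RootPairing.root_coroot'_eq_pairing, ← P.algebraMap_pairingIn ℤ]
  rfl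

theorem pairingIn_smul (w : P.weylGroup) (β γ : ι) :
    P.pairingIn ℤ (w • β) (w • γ) = P.pairingIn ℤ β γ := by
  have h := coroot'_smul w γ (P.root β)
  rw [smul_root, coroot'_root, coroot'_root] at h
  exact_mod_cast h

end WeylAction

/-! ### Positive roots and inversions -/

section Inversions

variable {ι M N : Type*} [Fintype ι] [AddCommGroup M] [Module ℂ M] [AddCommGroup N] [Module ℂ N]
  {P : RootPairing ι ℂ M N} (b : P.Base)

open Classical in
/-- The sign of a root: `1` for positive roots and `-1` for negative roots. -/
noncomputable def rootSign (γ : ι) : ℤ := if b.IsPos γ then 1 else -1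

theorem rootSign_eq_one_iff (γ : ι) : rootSign b γ = 1 ↔ b.IsPos γ := by
  unfold rootSign; split_ifs with h <;> simp [h]

theorem rootSign_eq_neg_one_iff (γ : ι) : rootSign b γ = -1 ↔ ¬ b.IsPos γ := by
  unfold rootSign; split_ifs with h <;> simp [h]

theorem isPos_neg_iff (γ : ι) : b.IsPos (P.reflectionPerm γ γ) ↔ ¬ b.IsPos γ :=
  RootPairing.Base.IsPos.neg_iff_not b γ

theorem rootSign_eq_or (γ : ι) : rootSign b γ = 1 ∨ rootSign b γ = -1 := by
  unfold rootSign; split_ifs <;> simp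

theorem rootSign_neg (γ : ι) : rootSign b (P.reflectionPerm γ γ) = -rootSign b γ := by
  unfold rootSign
  have := isPos_neg_iff b γ
  by_cases h : b.IsPos γ
  · rw [if_pos h, if_neg (fun h' => this.1 h' h)]
  · rw [if_neg h, if_pos (this.2 h), neg_neg]

variable [P.IsCrystallographic] [P.IsReduced]

open Classical in
/-- A simple reflection changes the signs of its root and of the negative of this root only. -/
theorem rootSign_simpleReflection (i : b.support) (γ : ι) :
    rootSign b (simpleReflection b i • γ) = rootSign b γ - 2 * (if γ = i then 1 else 0) +
      2 * (if γ = P.reflectionPerm i i then 1 else 0) := by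
  rw [simpleReflection, ofIdx_smul_idx]
  have hi : b.IsPos i := b.isPos_of_mem_support i.2
  by_cases h1 : γ = i
  · subst h1
    rw [if_pos rfl, if_neg (neg_ne_idx _).symm, rootSign_neg, (rootSign_eq_one_iff b _).2 hi]
    norm_num
  by_cases h2 : γ = P.reflectionPerm i i
  · subst h2
    rw [if_pos rfl, if_neg (neg_ne_idx _), RootPairing.reflectionPerm_self, rootSign_neg,
      (rootSign_eq_one_iff b _).2 hi]
    norm_num
  rw [if_neg h1, if_neg h2]
  have key : ∀ δ : ι, b.IsPos δ → δ ≠ i → b.IsPos (P.reflectionPerm i δ) := fun δ hδ hne =>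
    RootPairing.Base.IsPos.reflectionPerm hδ i.2 hne
  by_cases h : b.IsPos γ
  · rw [(rootSign_eq_one_iff b _).2 h, (rootSign_eq_one_iff b _).2 (key γ h h1)]
    norm_num
  · have h' := key _ ((isPos_neg_iff b γ).2 h) (fun e => h2 ((neg_eq_iff _ _).1 e))
    rw [reflectionPerm_neg, isPos_neg_iff] at h'
    rw [(rootSign_eq_neg_one_iff b _).2 h, (rootSign_eq_neg_one_iff b _).2 h']
    norm_num

theorem simpleReflection_mul_self (i : b.support) :
    simpleReflection b i * simpleReflection b i = 1 := ofIdx_mul_self _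

/-- The Weyl group is generated by the simple reflections. -/
theorem exists_word (w : P.weylGroup) :
    ∃ l : List b.support, (l.map (simpleReflection b)).prod = w := by
  induction w using weylGroup_induction with
  | one => exact ⟨[], rfl⟩
  | mul u v hu hv =>
    obtain ⟨l, rfl⟩ := hu
    obtain ⟨l', rfl⟩ := hv
    exact ⟨l ++ l', by simp⟩
  | mem i =>
    induction i using b.induction_reflect with
    | h₀ i hi => rwa [ofIdx_neg]
    | h₁ i hi => exact ⟨[⟨i, hi⟩], by simp [simpleReflection]⟩
    | h₂ i j hi hj =>
      obtain ⟨l, hl⟩ := hi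
      refine ⟨⟨j, hj⟩ :: l ++ [⟨j, hj⟩], ?_⟩
      rw [ofIdx_reflectionPerm, List.cons_append, List.map_cons, List.prod_cons, List.map_append,
        List.prod_append, hl, mul_assoc]
      simp [simpleReflection]

theorem isReducedWord_reducedWord_weyl (w : P.weylGroup) :
    IsReducedWord (simpleReflection b) (reducedWord (simpleReflection b) w) w :=
  isReducedWord_reducedWord _ _ (exists_word b w)

theorem IsReducedWord.length_eq {l : List b.support} {w : P.weylGroup}
    (h : IsReducedWord (simpleReflection b) l w) :
    l.length = wordLength (simpleReflection b) w := by
  apply le_antisymm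
  · obtain ⟨l', h1, h2⟩ := Nat.sInf_mem
      (s := {k | ∃ l : List b.support, (l.map (simpleReflection b)).prod = w ∧ l.length = k})
      ⟨_, l, h.1, rfl⟩
    exact (h.2 l' h1).trans_eq h2
  · exact Nat.sInf_le ⟨l, h.1, rfl⟩

theorem wordLength_prod_le (l : List b.support) :
    wordLength (simpleReflection b) (l.map (simpleReflection b)).prod ≤ l.length :=
  Nat.sInf_le ⟨l, rfl, rfl⟩

theorem length_reducedWord (w : P.weylGroup) :
    (reducedWord (simpleReflection b) w).length = wordLength (simpleReflection b) w :=
  (isReducedWord_reducedWord_weyl b w).length_eq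

theorem prod_reducedWord (w : P.weylGroup) :
    ((reducedWord (simpleReflection b) w).map (simpleReflection b)).prod = w :=
  (isReducedWord_reducedWord_weyl b w).1

/-- The strong exchange property: the letter that turns the image of `γ` into a negative root can be
deleted. -/
theorem exists_word_mul_ofIdx (l : List b.support) (γ : ι) (hγ : b.IsPos γ)
    (h : ¬ b.IsPos ((l.map (simpleReflection b)).prod • γ)) :
    ∃ l' : List b.support, l'.length + 1 = l.length ∧ (l'.map (simpleReflection b)).prod =
      (l.map (simpleReflection b)).prod * RootPairing.weylGroup.ofIdx P γ := by
  classical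
  induction l with
  | nil => simp [hγ] at h
  | cons i l ih =>
    rw [List.map_cons, List.prod_cons] at h ⊢
    by_cases h' : b.IsPos ((l.map (simpleReflection b)).prod • γ)
    · refine ⟨l, rfl, ?_⟩
      have hi : (l.map (simpleReflection b)).prod • γ = i := by
        have := rootSign_simpleReflection b i ((l.map (simpleReflection b)).prod • γ)
        rw [← mul_smul, (rootSign_eq_neg_one_iff b _).2 h, (rootSign_eq_one_iff b _).2 h'] at this
        by_contra hne
        rw [if_neg hne] at this
        split_ifs at this <;> omega
      have := ofIdx_smul (l.map (simpleReflection b)).prod γ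
      rw [hi] at this
      change simpleReflection b i = _ at this
      have h2 : (l.map (simpleReflection b)).prod * RootPairing.weylGroup.ofIdx P γ =
          simpleReflection b i * (l.map (simpleReflection b)).prod := by rw [this]; group
      rw [mul_assoc, h2, ← mul_assoc, simpleReflection_mul_self, one_mul]
    · obtain ⟨l', h1, h2⟩ := ih h'
      exact ⟨i :: l', by simpa using h1, by simp [h2, mul_assoc]⟩

/-- Each root counted in this sum contributes `2`, and the inversions of `w` are counted together
with their negatives, so that the sum is four times the number of inversions. -/
theorem four_mul_wordLength (w : P.weylGroup) :
    4 * (wordLength (simpleReflection b) w : ℤ) =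
      ∑ γ, (1 - rootSign b γ * rootSign b (w • γ)) := by
  classical
  have key : ∀ l : List b.support,
      IsReducedWord (simpleReflection b) l (l.map (simpleReflection b)).prod →
      4 * (l.length : ℤ) =
        ∑ γ, (1 - rootSign b γ * rootSign b ((l.map (simpleReflection b)).prod • γ)) := by
    intro l
    induction l with
    | nil =>
      intro _
      refine (Finset.sum_eq_zero fun γ _ => ?_).symm
      rcases rootSign_eq_or b γ with h | h <;> simp [h]
    | cons i l ih =>
      intro hl
      have hl' : IsReducedWord (simpleReflection b) l (l.map (simpleReflection b)).prod := by
        refine ⟨rfl, fun l' h => ?_⟩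
        have := hl.2 (i :: l') (by simp [h])
        simpa using this
      set w := (l.map (simpleReflection b)).prod with hw
      have hpos : b.IsPos (w⁻¹ • (i : ι)) := by
        by_contra hneg
        have hneg' := (isPos_neg_iff b _).2 hneg
        obtain ⟨l', h1, h2⟩ := exists_word_mul_ofIdx b l _ hneg' (by
          rw [← hw, ← smul_neg_idx, smul_inv_smul, isPos_neg_iff, not_not]
          exact b.isPos_of_mem_support i.2)
        have := hl.2 l' (by
          rw [h2, ofIdx_neg, ofIdx_smul, ← hw, List.map_cons, List.prod_cons, ← hw,
            simpleReflection]
          group)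
        simp only [List.length_cons] at this
        omega
      simp only [List.map_cons, List.prod_cons, List.length_cons]
      rw [← hw]
      have hstep : ∀ γ, 1 - rootSign b γ * rootSign b ((simpleReflection b i * w) • γ) =
          (1 - rootSign b γ * rootSign b (w • γ)) +
          ((if γ = w⁻¹ • (i : ι) then 2 else 0) +
            (if γ = P.reflectionPerm (w⁻¹ • (i : ι)) (w⁻¹ • (i : ι)) then 2 else 0)) := by
        intro γ
        rw [mul_smul, rootSign_simpleReflection, ← eq_inv_smul_iff (g := w),
          ← eq_inv_smul_iff (g := w), smul_neg_idx]
        by_cases h1 : γ = w⁻¹ • (i : ι)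
        · rw [if_pos h1, if_neg (by rw [h1]; exact (neg_ne_idx _).symm), h1,
            (rootSign_eq_one_iff b _).2 hpos, if_pos rfl, if_neg (neg_ne_idx _).symm]
          ring
        · by_cases h2 : γ = P.reflectionPerm (w⁻¹ • (i : ι)) (w⁻¹ • (i : ι))
          · rw [if_neg h1, if_pos h2, if_neg h1, if_pos h2, h2, rootSign_neg,
              (rootSign_eq_one_iff b _).2 hpos]
            ring
          · rw [if_neg h1, if_neg h2, if_neg h1, if_neg h2]
            ring
      rw [Finset.sum_congr rfl fun γ _ => hstep γ, Finset.sum_add_distrib, ← ih hl',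
        Finset.sum_add_distrib]
      simp
      ring
  have h := isReducedWord_reducedWord_weyl b w
  have h2 := key (reducedWord (simpleReflection b) w) (by rw [h.1]; exact h)
  rwa [h.1, h.length_eq] at h2

theorem wordLength_mul_ofIdx_lt {w : P.weylGroup} {γ : ι} (hγ : b.IsPos γ)
    (h : ¬ b.IsPos (w • γ)) :
    wordLength (simpleReflection b) (w * RootPairing.weylGroup.ofIdx P γ) <
      wordLength (simpleReflection b) w := by
  obtain ⟨l, h1, h2⟩ := exists_word_mul_ofIdx b (reducedWord (simpleReflection b) w) γ hγ (by
    rwa [prod_reducedWord])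
  rw [prod_reducedWord, length_reducedWord] at *
  have := wordLength_prod_le b l
  rw [h2] at this
  omega

theorem lt_wordLength_mul_ofIdx {w : P.weylGroup} {γ : ι} (hγ : b.IsPos γ)
    (h : b.IsPos (w • γ)) : wordLength (simpleReflection b) w <
      wordLength (simpleReflection b) (w * RootPairing.weylGroup.ofIdx P γ) := by
  have := wordLength_mul_ofIdx_lt b (w := w * RootPairing.weylGroup.ofIdx P γ) hγ (by
    rwa [mul_smul, ofIdx_smul_idx, smul_neg_idx, isPos_neg_iff, not_not])
  rwa [mul_assoc, ofIdx_mul_self, mul_one] at this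

theorem wordLength_one : wordLength (simpleReflection b) (1 : P.weylGroup) = 0 :=
  Nat.le_zero.1 (wordLength_prod_le b [])

theorem wordLength_mul_le (u v : P.weylGroup) : wordLength (simpleReflection b) (u * v) ≤
    wordLength (simpleReflection b) u + wordLength (simpleReflection b) v := by
  have := wordLength_prod_le b
    (reducedWord (simpleReflection b) u ++ reducedWord (simpleReflection b) v)
  simpa [prod_reducedWord, length_reducedWord] using this

theorem wordLength_inv (w : P.weylGroup) :
    wordLength (simpleReflection b) w⁻¹ = wordLength (simpleReflection b) w := by
  have h := four_mul_wordLength b w⁻¹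
  rw [← Equiv.sum_comp (MulAction.toPerm w)] at h
  simp only [MulAction.toPerm_apply, inv_smul_smul] at h
  have h2 := four_mul_wordLength b w
  simp only [mul_comm (rootSign b (w • _))] at h
  omega

end Inversions

/-! ### Lengths of reflections and heights of coroots -/

section Heights

variable {ι M N : Type*} [Fintype ι] [AddCommGroup M] [Module ℂ M] [AddCommGroup N] [Module ℂ N]
  {P : RootPairing ι ℂ M N} (b : P.Base) [P.IsCrystallographic] [P.IsReduced]

theorem height_reflectionPerm (β γ : ι) : b.height (P.reflectionPerm β γ) =
    b.height γ - P.pairingIn ℤ γ β * b.height β := by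
  have h : P.root (P.reflectionPerm β γ) = P.root γ + (-P.pairingIn ℤ γ β) • P.root β := by
    rw [RootPairing.root_reflectionPerm, neg_smul, RootPairing.reflection_apply_root' ℤ,
      sub_eq_add_neg]
  rw [b.height_add_zsmul h, smul_eq_mul]
  ring

theorem pairingIn_reflectionPerm_left (β γ δ : ι) :
    P.pairingIn ℤ (P.reflectionPerm β γ) δ =
      P.pairingIn ℤ γ δ - P.pairingIn ℤ γ β * P.pairingIn ℤ β δ := by
  have h : P.root (P.reflectionPerm β γ) = (1 : ℤ) • P.root γ +
      (-P.pairingIn ℤ γ β) • P.root β := by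
    rw [RootPairing.root_reflectionPerm, neg_smul, RootPairing.reflection_apply_root' ℤ,
      sub_eq_add_neg, one_smul]
  rw [RootPairing.pairingIn_eq_add_of_root_eq_smul_add_smul h, smul_eq_mul, smul_eq_mul]
  ring

theorem coroot_reflectionPerm_pairingIn (β γ : ι) : P.coroot (P.reflectionPerm β γ) =
    P.coroot γ - P.pairingIn ℤ β γ • P.coroot β := by
  rw [RootPairing.coroot_reflectionPerm, RootPairing.coreflection_apply_coroot,
    ← P.algebraMap_pairingIn ℤ, algebraMap_int_eq, eq_intCast, Int.cast_smul_eq_zsmul]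

theorem height_pos_iff (γ : ι) : 0 < b.height γ ↔ b.IsPos γ := Iff.rfl

theorem height_neg_iff (γ : ι) : b.height γ < 0 ↔ ¬ b.IsPos γ := by
  rw [b.isPos_iff', not_le]

theorem isPos_flip_iff (γ : ι) : b.flip.IsPos γ ↔ b.IsPos γ := by
  induction γ using b.induction_reflect with
  | h₀ i hi =>
    exact (isPos_neg_iff b.flip i).trans ((not_congr hi).trans (isPos_neg_iff b i).symm)
  | h₁ i hi =>
    exact ⟨fun _ => b.isPos_of_mem_support hi, fun _ => b.flip.isPos_of_mem_support hi⟩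
  | h₂ i j hi hj =>
    have h1 := rootSign_simpleReflection b ⟨j, hj⟩ i
    have h2 := rootSign_simpleReflection b.flip ⟨j, hj⟩ i
    rw [simpleReflection, ofIdx_smul_idx] at h1 h2
    have h3 : rootSign b.flip i = rootSign b i := by
      simp only [rootSign]
      congr 1
      exact propext hi
    have h4 : rootSign b.flip (P.reflectionPerm j i) = rootSign b (P.reflectionPerm j i) := by
      rw [h1]
      refine Eq.trans h2 ?_
      rw [h3]
      rfl
    rw [← rootSign_eq_one_iff, ← rootSign_eq_one_iff, h4]

theorem flip_height_pos {γ : ι} (h : b.IsPos γ) : 0 < b.flip.height γ :=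
  (isPos_flip_iff b γ).2 h

theorem flip_height_eq_sum (γ : ι) : b.flip.height γ = ∑ i, corootCoeff b γ i :=
  (Finset.sum_coe_sort b.support (fun i => (b.flip.exists_root_eq_sum_int γ).choose i)).symm

theorem pairingIn_eq_sum (β γ : ι) :
    P.pairingIn ℤ β γ = ∑ i, corootCoeff b γ i * P.pairingIn ℤ β i := by
  have h := congrArg (P.root' β) (coroot_eq_sum_corootCoeff b γ)
  rw [map_sum] at h
  simp only [map_zsmul, RootPairing.root'_coroot_eq_pairing, ← P.algebraMap_pairingIn ℤ,
    algebraMap_int_eq, eq_intCast, zsmul_eq_mul] at h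
  exact_mod_cast h

theorem sum_rootSign_mul_pairingIn_simple (i : b.support) :
    ∑ β, rootSign b β * P.pairingIn ℤ β i = 4 := by
  classical
  have h : ∑ β, rootSign b β * P.pairingIn ℤ β i =
      ∑ β, (-(rootSign b β * P.pairingIn ℤ β i) + ((if β = i then 4 else 0) +
        (if β = P.reflectionPerm i i then 4 else 0))) := by
    conv_lhs => rw [← Equiv.sum_comp (MulAction.toPerm (simpleReflection b i))]
    refine Finset.sum_congr rfl fun β _ => ?_
    rw [MulAction.toPerm_apply, rootSign_simpleReflection, simpleReflection, ofIdx_smul_idx,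
      ← RootPairing.pairingIn_reflectionPerm, RootPairing.pairingIn_reflectionPerm_self_right]
    by_cases h1 : β = i
    · rw [if_pos h1, if_neg (by rw [h1]; exact (neg_ne_idx _).symm), if_pos h1,
        if_neg (by rw [h1]; exact (neg_ne_idx _).symm), h1, RootPairing.pairingIn_same]
      ring
    · by_cases h2 : β = P.reflectionPerm i i
      · rw [if_neg h1, if_pos h2, if_neg h1, if_pos h2, h2,
          RootPairing.pairingIn_reflectionPerm_self_left, RootPairing.pairingIn_same]
        ring
      · rw [if_neg h1, if_neg h2, if_neg h1, if_neg h2]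
        ring
  rw [Finset.sum_add_distrib, Finset.sum_add_distrib, Finset.sum_neg_distrib] at h
  simp only [Finset.sum_ite_eq', Finset.mem_univ, if_true] at h
  omega

theorem sum_rootSign_mul_pairingIn (γ : ι) :
    ∑ β, rootSign b β * P.pairingIn ℤ β γ = 4 * b.flip.height γ := by
  simp_rw [pairingIn_eq_sum b _ γ, Finset.mul_sum]
  rw [Finset.sum_comm, flip_height_eq_sum, Finset.mul_sum]
  refine Finset.sum_congr rfl fun i _ => ?_
  rw [← sum_rootSign_mul_pairingIn_simple b i, Finset.sum_mul]
  exact Finset.sum_congr rfl fun β _ => by ring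

/-- An inversion of `s_γ` pairs positively with `γ^∨`, as `s_γ` lowers its height. -/
theorem pairingIn_pos_of_isPos {β γ : ι} (hγ : b.IsPos γ) (hβ : b.IsPos β)
    (h : ¬ b.IsPos (P.reflectionPerm γ β)) : 1 ≤ P.pairingIn ℤ β γ := by
  rw [← height_neg_iff, height_reflectionPerm] at h
  rw [← height_pos_iff] at hγ hβ
  by_contra! h'
  nlinarith

/-- The length of `s_γ` falls short of its maximal possible value `2 ht(γ^∨) - 1` by the excess of
the numbers `⟨β, γ^∨⟩` over `1`, for the inversions `β` of `s_γ` other than `γ`.  In this sum every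
inversion is counted together with its negative. -/
theorem eight_mul_height_sub (γ : ι) :
    8 * b.flip.height γ - 4 *
      (wordLength (simpleReflection b) (RootPairing.weylGroup.ofIdx P γ) : ℤ) =
    ∑ β, (P.pairingIn ℤ β γ * (rootSign b β - rootSign b (P.reflectionPerm γ β)) -
      (1 - rootSign b β * rootSign b (P.reflectionPerm γ β))) := by
  have h : ∑ β, P.pairingIn ℤ β γ * rootSign b (P.reflectionPerm γ β) =
      -(4 * b.flip.height γ) := by
    rw [← Equiv.sum_comp (P.reflectionPerm γ), ← sum_rootSign_mul_pairingIn b γ,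
      ← Finset.sum_neg_distrib]
    refine Finset.sum_congr rfl fun β _ => ?_
    rw [RootPairing.reflectionPerm_self, ← RootPairing.pairingIn_reflectionPerm,
      RootPairing.pairingIn_reflectionPerm_self_right]
    ring
  rw [four_mul_wordLength, Finset.sum_sub_distrib]
  simp only [mul_sub, Finset.sum_sub_distrib, ofIdx_smul_idx, h]
  have h2 := sum_rootSign_mul_pairingIn b γ
  rw [Finset.sum_congr rfl fun β _ => mul_comm (rootSign b β) (P.pairingIn ℤ β γ)] at h2
  rw [h2]
  ring

/-- The terms of the sum in `eight_mul_height_sub` are non-negative, and zero unless `β` or `-β` is an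
inversion of `s_γ`. -/
theorem inversion_excess_nonneg {γ : ι} (hγ : b.IsPos γ) (β : ι) :
    0 ≤ P.pairingIn ℤ β γ * (rootSign b β - rootSign b (P.reflectionPerm γ β)) -
      (1 - rootSign b β * rootSign b (P.reflectionPerm γ β)) := by
  by_cases h1 : b.IsPos β <;> by_cases h2 : b.IsPos (P.reflectionPerm γ β)
  · rw [(rootSign_eq_one_iff b _).2 h1, (rootSign_eq_one_iff b _).2 h2]; norm_num
  · rw [(rootSign_eq_one_iff b _).2 h1, (rootSign_eq_neg_one_iff b _).2 h2]
    have := pairingIn_pos_of_isPos b hγ h1 h2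
    linarith
  · rw [(rootSign_eq_neg_one_iff b _).2 h1, (rootSign_eq_one_iff b _).2 h2]
    have := pairingIn_pos_of_isPos b hγ h2 (by rwa [RootPairing.reflectionPerm_self])
    rw [← RootPairing.pairingIn_reflectionPerm,
      RootPairing.pairingIn_reflectionPerm_self_right] at this
    linarith
  · rw [(rootSign_eq_neg_one_iff b _).2 h1, (rootSign_eq_neg_one_iff b _).2 h2]; norm_num

/-- The bound comes from the terms `β = ±γ` of the sum in `eight_mul_height_sub`. -/
theorem wordLength_ofIdx_le {γ : ι} (hγ : b.IsPos γ) :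
    (wordLength (simpleReflection b) (RootPairing.weylGroup.ofIdx P γ) : ℤ) ≤
      2 * b.flip.height γ - 1 := by
  classical
  have h := eight_mul_height_sub b γ
  have h2 := Finset.sum_le_sum_of_subset_of_nonneg
    (Finset.subset_univ {γ, P.reflectionPerm γ γ})
    (fun β _ _ => inversion_excess_nonneg b hγ β)
  rw [Finset.sum_pair (neg_ne_idx γ).symm, ← h, RootPairing.reflectionPerm_self, rootSign_neg,
    (rootSign_eq_one_iff b _).2 hγ, RootPairing.pairingIn_reflectionPerm_self_left,
    RootPairing.pairingIn_same] at h2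
  linarith

/-- For a special root `γ`, all terms of the sum in `eight_mul_height_sub` vanish except those with
`β = ±γ`. -/
theorem IsSpecial.pairingIn_eq_one {γ β : ι} (hγ : IsSpecial b γ) (hβ : b.IsPos β) (hne : β ≠ γ)
    (h : ¬ b.IsPos (P.reflectionPerm γ β)) : P.pairingIn ℤ β γ = 1 := by
  classical
  have hs := eight_mul_height_sub b γ
  rw [hγ.2] at hs
  have hne2 : β ≠ P.reflectionPerm γ γ := fun e =>
    (isPos_neg_iff b γ).1 (e ▸ hβ) hγ.1
  have h2 := Finset.sum_le_sum_of_subset_of_nonneg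
    (Finset.subset_univ {β, γ, P.reflectionPerm γ γ})
    (fun β _ _ => inversion_excess_nonneg b hγ.1 β)
  rw [Finset.sum_insert (by simp [hne, hne2]), Finset.sum_pair (neg_ne_idx γ).symm, ← hs,
    RootPairing.reflectionPerm_self, rootSign_neg,
    (rootSign_eq_one_iff b _).2 hγ.1, RootPairing.pairingIn_reflectionPerm_self_left,
    RootPairing.pairingIn_same, (rootSign_eq_one_iff b _).2 hβ,
    (rootSign_eq_neg_one_iff b _).2 h] at h2
  have := pairingIn_pos_of_isPos b hγ.1 hβ h
  linarith

/-- If `u s_β` has length `l(u) - 1`, then every pair `{τ, -s_β τ}` of distinct inversions of `s_β`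
contains only one inversion of `u`. -/
theorem not_isPos_of_wordLength_cover {u : P.weylGroup} {β τ : ι} (hβ : b.IsPos β)
    (hu : ¬ b.IsPos (u • β))
    (hl : wordLength (simpleReflection b) (u * RootPairing.weylGroup.ofIdx P β) + 1 =
      wordLength (simpleReflection b) u)
    (hne : τ ≠ β) (hτ : b.IsPos τ) (h1 : ¬ b.IsPos (P.reflectionPerm β τ))
    (h2 : ¬ b.IsPos (u • τ)) : ¬ b.IsPos (u • P.reflectionPerm β τ) := by
  classical
  intro h3
  have hpos : ∀ τ, 0 ≤ (rootSign b (P.reflectionPerm β τ) - rootSign b τ) *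
      (rootSign b (u • τ) - rootSign b (u • P.reflectionPerm β τ)) := by
    -- if `τ > 0 > s_β τ`, then `u τ - u s_β τ` is a positive multiple of the negative root `u β`
    have key : ∀ τ, b.IsPos τ → ¬ b.IsPos (P.reflectionPerm β τ) → b.IsPos (u • τ) →
        b.IsPos (u • P.reflectionPerm β τ) := by
      intro τ t1 t2 t3
      have t4 := pairingIn_pos_of_isPos b hβ t1 t2
      rw [smul_reflectionPerm, ← height_pos_iff, height_reflectionPerm, pairingIn_smul]
      rw [← height_neg_iff] at hu
      rw [← height_pos_iff] at t3
      nlinarith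
    intro τ
    rcases rootSign_eq_or b (u • τ) with e3 | e3 <;>
      rcases rootSign_eq_or b (u • P.reflectionPerm β τ) with e4 | e4
    · rw [e3, e4]; simp
    · rcases rootSign_eq_or b τ with e1 | e1 <;>
        rcases rootSign_eq_or b (P.reflectionPerm β τ) with e2 | e2
      all_goals rw [e1, e2, e3, e4]
      any_goals norm_num
      rw [rootSign_eq_one_iff] at e1 e3
      rw [rootSign_eq_neg_one_iff] at e2 e4
      exact e4 (key τ e1 e2 e3)
    · rcases rootSign_eq_or b τ with e1 | e1 <;>
        rcases rootSign_eq_or b (P.reflectionPerm β τ) with e2 | e2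
      all_goals rw [e1, e2, e3, e4]
      any_goals norm_num
      rw [rootSign_eq_one_iff] at e2 e4
      rw [rootSign_eq_neg_one_iff] at e1 e3
      exact e3 (by simpa using key (P.reflectionPerm β τ) e2 (by simpa using e1) e4)
    · rw [e3, e4]; simp
  -- expanding the product gives two sums for `l(u)` and two sums for `l(u s_β)`
  have hsum : ∑ τ, (rootSign b (P.reflectionPerm β τ) - rootSign b τ) *
      (rootSign b (u • τ) - rootSign b (u • P.reflectionPerm β τ)) = 8 := by
    have e1 := four_mul_wordLength b u
    have e2 := four_mul_wordLength b (u * RootPairing.weylGroup.ofIdx P β)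
    simp only [mul_smul, ofIdx_smul_idx] at e2
    have e3 := e1
    rw [← Equiv.sum_comp (P.reflectionPerm β)] at e3
    have e4 := e2
    rw [← Equiv.sum_comp (P.reflectionPerm β)] at e4
    simp only [RootPairing.reflectionPerm_self] at e4
    have e5 : ∑ τ, (rootSign b (P.reflectionPerm β τ) - rootSign b τ) *
        (rootSign b (u • τ) - rootSign b (u • P.reflectionPerm β τ)) =
      ∑ τ, (1 - rootSign b τ * rootSign b (u • τ)) +
      ∑ τ, (1 - rootSign b (P.reflectionPerm β τ) * rootSign b (u • P.reflectionPerm β τ)) -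
      ∑ τ, (1 - rootSign b τ * rootSign b (u • P.reflectionPerm β τ)) -
      ∑ τ, (1 - rootSign b (P.reflectionPerm β τ) * rootSign b (u • τ)) := by
      rw [← Finset.sum_add_distrib, ← Finset.sum_sub_distrib, ← Finset.sum_sub_distrib]
      exact Finset.sum_congr rfl fun τ _ => by ring
    rw [e5, ← e1, ← e2, ← e3, ← e4]
    omega
  have hne2 : τ ≠ P.reflectionPerm β β := fun e => (isPos_neg_iff b β).1 (e ▸ hτ) hβ
  have h4 := Finset.sum_le_sum_of_subset_of_nonneg
    (Finset.subset_univ {τ, β, P.reflectionPerm β β}) (fun τ _ _ => hpos τ)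
  rw [Finset.sum_insert (by simp [hne, hne2]), Finset.sum_pair (neg_ne_idx β).symm, hsum,
    RootPairing.reflectionPerm_self, smul_neg_idx, rootSign_neg, rootSign_neg,
    (rootSign_eq_one_iff b _).2 hβ, (rootSign_eq_neg_one_iff b _).2 hu,
    (rootSign_eq_one_iff b _).2 hτ, (rootSign_eq_neg_one_iff b _).2 h1,
    (rootSign_eq_neg_one_iff b _).2 h2, (rootSign_eq_one_iff b _).2 h3] at h4
  norm_num at h4

end Heights

/-! ### Pairs of reflections with the same product -/

section Pairs

variable {ι M N : Type*} [Fintype ι] [AddCommGroup M] [Module ℂ M] [AddCommGroup N] [Module ℂ N]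
  {P : RootPairing ι ℂ M N} (b : P.Base) [P.IsCrystallographic] [P.IsReduced]

local notation "s(" γ ")" => RootPairing.weylGroup.ofIdx P γ
local notation "len(" w ")" => wordLength (simpleReflection b) w

theorem reflectionPerm_reflectionPerm (β γ δ : ι) :
    P.reflectionPerm (P.reflectionPerm β γ) δ =
      P.reflectionPerm β (P.reflectionPerm γ (P.reflectionPerm β δ)) := by
  rw [← ofIdx_smul_idx, ofIdx_reflectionPerm, mul_smul, mul_smul]
  rfl

/-- A pair of special roots such that the length of the product of their reflections is the sum of
the lengths.  Such pairs index the products `T_{s_γ} T_{s_δ}` that do not vanish. -/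
def IsAdditivePair (γ δ : ι) : Prop :=
  IsSpecial b γ ∧ IsSpecial b δ ∧ len(s(γ) * s(δ)) = len(s(γ)) + len(s(δ))

/-- A special root `ε` and a positive root `β` such that `s_ε s_β` has length `l(s_ε) - 1`.  Such
pairs index the terms of lower order in the products `T_{s_ε} A(m)`. -/
def IsDropPair (ε β : ι) : Prop :=
  IsSpecial b ε ∧ b.IsPos β ∧ len(s(ε) * s(β)) + 1 = len(s(ε))

theorem not_isPos_of_wordLength_lt {w : P.weylGroup} {γ : ι} (hγ : b.IsPos γ)
    (h : len(w * s(γ)) < len(w)) : ¬ b.IsPos (w • γ) := fun h' =>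
  (lt_wordLength_mul_ofIdx b hγ h').not_gt h

/-- If the length of `u v` is the sum of the lengths, then `u` and `v⁻¹` have no common inversion:
otherwise both factors of `u v = (u s_β) (s_β v)` would be shorter. -/
theorem no_common_inversion {u v : P.weylGroup} (h : len(u * v) = len(u) + len(v)) {β : ι}
    (hβ : b.IsPos β) (h1 : ¬ b.IsPos (u • β)) : b.IsPos (v⁻¹ • β) := by
  by_contra h2
  have l1 := wordLength_mul_ofIdx_lt b hβ h1
  have l2 := wordLength_mul_ofIdx_lt b hβ h2
  have l3 := wordLength_mul_le b (u * s(β)) (v⁻¹ * s(β))⁻¹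
  rw [wordLength_inv, mul_inv_rev, ofIdx_inv, inv_inv] at l3
  rw [wordLength_inv] at l2
  have e : u * s(β) * (s(β) * v) = u * v := by
    rw [mul_assoc, ← mul_assoc s(β), ofIdx_mul_self, one_mul]
  rw [e] at l3
  omega

variable {b}

theorem IsAdditivePair.pairingIn_nonpos {γ δ : ι} (h : IsAdditivePair b γ δ) :
    P.pairingIn ℤ γ δ ≤ 0 := by
  obtain ⟨hγ, hδ, hl⟩ := h
  by_contra! h1
  have h2 : 0 < P.pairingIn ℤ δ γ := (P.zero_lt_pairingIn_iff' ℤ).1 h1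
  have p1 := no_common_inversion b hl hγ.1 (by
    rw [ofIdx_smul_idx, isPos_neg_iff, not_not]; exact hγ.1)
  have p2 : b.IsPos (P.reflectionPerm γ δ) := by
    by_contra p
    have := no_common_inversion b hl hδ.1 (by rwa [ofIdx_smul_idx])
    rw [ofIdx_inv, ofIdx_smul_idx, isPos_neg_iff] at this
    exact this hδ.1
  have q1 := hγ.1
  have q2 := hδ.1
  rw [ofIdx_inv, ofIdx_smul_idx] at p1
  rw [← height_pos_iff] at p1 p2 q1 q2
  rw [height_reflectionPerm] at p1 p2
  nlinarith

theorem IsAdditivePair.pairingIn_cases {γ δ : ι} (h : IsAdditivePair b γ δ)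
    (h0 : P.pairingIn ℤ γ δ ≠ 0) :
    P.pairingIn ℤ γ δ = -1 ∧ P.pairingIn ℤ δ γ ≤ -1 ∨
      P.pairingIn ℤ γ δ ≤ -2 ∧ P.pairingIn ℤ δ γ = -1 := by
  have h1 := h.pairingIn_nonpos
  have hne : P.root γ ≠ P.root δ := by
    intro e
    rw [P.root.injective e, RootPairing.pairingIn_same] at h1
    omega
  have hne' : P.root γ ≠ -P.root δ := by
    intro e
    rw [RootPairing.root_eq_neg_iff] at e
    exact (isPos_neg_iff b δ).1 (e ▸ h.1.1) h.2.1.1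
  have := P.pairingIn_pairingIn_mem_set_of_isCrystal_of_isRed' γ δ hne hne'
  simp only [Set.mem_insert_iff, Set.mem_singleton_iff, Prod.mk.injEq] at this
  omega

/-- Since `l(s_ε) ≤ 2 ht(ε^∨) - 1 = l(s_γ) + l(s_δ) + 1 = l(s_ε s_β) + 1`, and `s_β` lowers the length
of `s_ε`, equality holds. -/
theorem isDropPair_of_isAdditivePair {γ δ ε β : ι} (h : IsAdditivePair b γ δ) (hβ : b.IsPos β)
    (hs : s(ε) * s(β) = s(γ) * s(δ)) (hh : P.coroot ε = P.coroot γ + P.coroot δ)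
    (hneg : ¬ b.IsPos (P.reflectionPerm ε β)) : IsDropPair b ε β := by
  have hht : b.flip.height ε = b.flip.height γ + b.flip.height δ := b.flip.height_add hh
  have hε : b.IsPos ε := by
    rw [← isPos_flip_iff]
    have h1 := flip_height_pos b h.1.1
    have h2 := flip_height_pos b h.2.1.1
    change 0 < _
    omega
  have l1 := wordLength_ofIdx_le b hε
  have l2 := wordLength_mul_ofIdx_lt b (w := s(ε)) hβ (by rwa [ofIdx_smul_idx])
  obtain ⟨hγ, hδ, hl⟩ := h
  have h1 := hγ.2
  have h2 := hδ.2
  rw [hs] at l2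
  refine ⟨⟨hε, by omega⟩, hβ, ?_⟩
  rw [hs]
  omega

/-- Since `l(s_γ s_δ) = l(s_ε) - 1` equals `2 ht(γ^∨) - 1 + 2 ht(δ^∨) - 1`, the lengths of `s_γ`, `s_δ`
and `s_γ s_δ` are as large as they can be. -/
theorem isAdditivePair_of_isDropPair {γ δ ε β : ι} (h : IsDropPair b ε β) (hγ : b.IsPos γ)
    (hδ : b.IsPos δ) (hs : s(γ) * s(δ) = s(ε) * s(β))
    (hh : P.coroot ε = P.coroot γ + P.coroot δ) : IsAdditivePair b γ δ := by
  have hht : b.flip.height ε = b.flip.height γ + b.flip.height δ := b.flip.height_add hh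
  obtain ⟨hε, hβ, hl⟩ := h
  have h1 := hε.2
  have l1 := wordLength_ofIdx_le b hγ
  have l2 := wordLength_ofIdx_le b hδ
  have l3 := wordLength_mul_le b s(γ) s(δ)
  rw [← hs] at hl
  refine ⟨⟨hγ, ?_⟩, ⟨hδ, ?_⟩, ?_⟩ <;> omega

variable (b)

/-- The drop pair with the same product of reflections as a non-orthogonal additive pair
`(γ, δ)`; its first coroot is `γ^∨ + δ^∨`.  The latter is `s_γ δ^∨` if `⟨γ, δ^∨⟩ = -1` and `s_δ γ^∨`
otherwise. -/
noncomputable def toDropPair (p : ι × ι) : ι × ι :=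
  if P.pairingIn ℤ p.1 p.2 = -1 then (P.reflectionPerm p.1 p.2, p.1)
  else (P.reflectionPerm p.2 p.1, P.reflectionPerm p.2 (P.reflectionPerm p.1 p.2))

open Classical in
/-- The additive pair with the same product of reflections as a drop pair `(ε, β)`; its coroots
add up to `ε^∨`. -/
noncomputable def toAdditivePair (p : ι × ι) : ι × ι :=
  if b.IsPos (P.reflectionPerm p.2 p.1) then (p.2, P.reflectionPerm p.2 p.1)
  else (P.reflectionPerm p.1 (P.reflectionPerm p.2 (P.reflectionPerm p.1 p.1)),
    P.reflectionPerm p.1 (P.reflectionPerm p.2 p.2))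

variable {b}

theorem mul_toDropPair (p : ι × ι) :
    s((toDropPair (P := P) p).1) * s((toDropPair (P := P) p).2) = s(p.1) * s(p.2) := by
  unfold toDropPair
  split_ifs
  · dsimp only
    rw [ofIdx_reflectionPerm, mul_assoc, ofIdx_mul_self, mul_one]
  · dsimp only
    rw [ofIdx_reflectionPerm, ofIdx_reflectionPerm, ofIdx_reflectionPerm]
    have h1 := ofIdx_mul_self (P := P) p.1
    have h2 := ofIdx_mul_self (P := P) p.2
    simp only [mul_assoc]
    rw [← mul_assoc s(p.2) s(p.2), h2, one_mul, ← mul_assoc s(p.1) s(p.1), h1, one_mul,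
      ← mul_assoc s(p.2) s(p.2), h2, one_mul]

theorem mul_toAdditivePair (p : ι × ι) :
    s((toAdditivePair b p).1) * s((toAdditivePair b p).2) = s(p.1) * s(p.2) := by
  unfold toAdditivePair
  have h1 := ofIdx_mul_self (P := P) p.1
  have h2 := ofIdx_mul_self (P := P) p.2
  have h1' (x : P.weylGroup) : s(p.1) * (s(p.1) * x) = x := by rw [← mul_assoc, h1, one_mul]
  have h2' (x : P.weylGroup) : s(p.2) * (s(p.2) * x) = x := by rw [← mul_assoc, h2, one_mul]
  split_ifs
  · simp only [ofIdx_reflectionPerm, mul_assoc, h2']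
  · simp only [ofIdx_reflectionPerm, mul_assoc, h1', h2', h1, h2, mul_one, one_mul]

theorem coroot_toDropPair {γ δ : ι} (h : IsAdditivePair b γ δ) (h0 : P.pairingIn ℤ γ δ ≠ 0) :
    P.coroot (toDropPair (P := P) (γ, δ)).1 = P.coroot γ + P.coroot δ := by
  rcases h.pairingIn_cases h0 with h1 | h1
  · rw [toDropPair, if_pos h1.1, coroot_reflectionPerm_pairingIn, h1.1]
    simp [add_comm]
  · rw [toDropPair, if_neg (by dsimp only; omega), coroot_reflectionPerm_pairingIn, h1.2]
    simp

theorem exists_coroot_toDropPair {γ δ : ι} (h : IsAdditivePair b γ δ)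
    (h0 : P.pairingIn ℤ γ δ ≠ 0) : ∃ z : ℤ, P.coroot (toDropPair (P := P) (γ, δ)).2 =
      P.coroot γ + z • (P.coroot γ + P.coroot δ) := by
  rcases h.pairingIn_cases h0 with h1 | h1
  · exact ⟨0, by rw [toDropPair, if_pos h1.1]; simp⟩
  · refine ⟨-1 - P.pairingIn ℤ γ δ, ?_⟩
    rw [toDropPair, if_neg (by dsimp only; omega)]
    dsimp only
    rw [coroot_reflectionPerm_pairingIn, coroot_reflectionPerm_pairingIn,
      RootPairing.pairingIn_reflectionPerm, pairingIn_reflectionPerm_left, h1.2,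
      RootPairing.pairingIn_same]
    module

theorem isDropPair_toDropPair {γ δ : ι} (h : IsAdditivePair b γ δ)
    (h0 : P.pairingIn ℤ γ δ ≠ 0) :
    IsDropPair b (toDropPair (P := P) (γ, δ)).1 (toDropPair (P := P) (γ, δ)).2 := by
  have hγ := h.1.1
  have hδ := h.2.1.1
  rw [← height_pos_iff] at hγ hδ
  -- the height of `s_γ s_δ γ` is `(⟨γ, δ^∨⟩⟨δ, γ^∨⟩ - 1) ht(γ) - ⟨γ, δ^∨⟩ ht(δ)`
  have key : ∀ γ δ : ι, b.height (P.reflectionPerm γ (P.reflectionPerm δ γ)) =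
      (P.pairingIn ℤ γ δ * P.pairingIn ℤ δ γ - 1) * b.height γ -
        P.pairingIn ℤ γ δ * b.height δ := by
    intro γ δ
    rw [height_reflectionPerm, height_reflectionPerm, pairingIn_reflectionPerm_left,
      RootPairing.pairingIn_same]
    ring
  refine isDropPair_of_isAdditivePair h ?_ (mul_toDropPair (γ, δ)) (coroot_toDropPair h h0) ?_
  · rcases h.pairingIn_cases h0 with h1 | h1
    · rw [toDropPair, if_pos h1.1]
      exact h.1.1
    · rw [toDropPair, if_neg (by dsimp only; omega), ← height_pos_iff, key, h1.2]
      nlinarith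
  · rcases h.pairingIn_cases h0 with h1 | h1
    · rw [toDropPair, if_pos h1.1]
      dsimp only
      rw [reflectionPerm_reflectionPerm, reflectionPerm_neg δ γ,
        reflectionPerm_neg γ (P.reflectionPerm δ γ), isPos_neg_iff, not_not,
        ← height_pos_iff, key, h1.1]
      nlinarith
    · rw [toDropPair, if_neg (by dsimp only; omega)]
      dsimp only
      rw [reflectionPerm_reflectionPerm]
      simp only [RootPairing.reflectionPerm_self]
      rw [isPos_neg_iff, not_not]
      exact h.2.1.1

theorem isAdditivePair_toAdditivePair {ε β : ι} (h : IsDropPair b ε β) (hne : β ≠ ε) :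
    IsAdditivePair b (toAdditivePair b (ε, β)).1 (toAdditivePair b (ε, β)).2 ∧
      P.pairingIn ℤ (toAdditivePair b (ε, β)).1 (toAdditivePair b (ε, β)).2 ≠ 0 ∧
      toDropPair (P := P) (toAdditivePair b (ε, β)) = (ε, β) := by
  obtain ⟨hε, hβ, hl⟩ := h
  have hneg' := not_isPos_of_wordLength_lt b (w := s(ε)) hβ (by omega)
  have hneg := hneg'
  rw [ofIdx_smul_idx] at hneg
  have h1 := hε.pairingIn_eq_one b hβ hne hneg
  have hself : ¬ b.IsPos (s(ε) • ε) := by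
    rw [ofIdx_smul_idx, isPos_neg_iff, not_not]
    exact hε.1
  have hs := mul_toAdditivePair (b := b) (ε, β)
  have e3 : P.pairingIn ℤ ε (P.reflectionPerm ε (P.reflectionPerm β β)) = P.pairingIn ℤ ε β := by
    rw [RootPairing.pairingIn_reflectionPerm, RootPairing.pairingIn_reflectionPerm_self_left,
      RootPairing.pairingIn_reflectionPerm_self_right, neg_neg]
  have e4 : P.pairingIn ℤ (P.reflectionPerm ε (P.reflectionPerm β β)) ε = 1 := by
    rw [← RootPairing.pairingIn_reflectionPerm, RootPairing.pairingIn_reflectionPerm_self_right,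
      RootPairing.pairingIn_reflectionPerm_self_left, neg_neg, h1]
  have e5 : P.reflectionPerm ε (P.reflectionPerm β (P.reflectionPerm ε ε)) =
      P.reflectionPerm (P.reflectionPerm ε (P.reflectionPerm β β)) ε := by
    simp only [reflectionPerm_reflectionPerm, RootPairing.reflectionPerm_self]
  by_cases hpos : b.IsPos (P.reflectionPerm β ε)
  · have e1 : toAdditivePair b (ε, β) = (β, P.reflectionPerm β ε) := if_pos hpos
    have e2 : P.pairingIn ℤ β (P.reflectionPerm β ε) = -1 := by
      rw [RootPairing.pairingIn_reflectionPerm, RootPairing.pairingIn_reflectionPerm_self_left, h1]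
    rw [e1] at hs ⊢
    refine ⟨isAdditivePair_of_isDropPair ⟨hε, hβ, hl⟩ hβ hpos hs ?_, ?_, ?_⟩
    · rw [coroot_reflectionPerm_pairingIn, h1]
      simp
    · dsimp only
      omega
    · rw [toDropPair, if_pos e2]
      dsimp only
      rw [RootPairing.reflectionPerm_self]
  · have e1 : toAdditivePair b (ε, β) = (P.reflectionPerm ε (P.reflectionPerm β
      (P.reflectionPerm ε ε)), P.reflectionPerm ε (P.reflectionPerm β β)) := if_neg hpos
    have hδ : b.IsPos (P.reflectionPerm ε (P.reflectionPerm β β)) := by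
      rwa [reflectionPerm_neg, isPos_neg_iff]
    have hγ : b.IsPos (P.reflectionPerm ε (P.reflectionPerm β (P.reflectionPerm ε ε))) := by
      rw [reflectionPerm_neg β ε, reflectionPerm_neg ε (P.reflectionPerm β ε), isPos_neg_iff]
      have := not_isPos_of_wordLength_cover b hβ hneg' hl hne.symm hε.1 hpos hself
      rwa [ofIdx_smul_idx] at this
    have e2 : P.pairingIn ℤ (P.reflectionPerm ε (P.reflectionPerm β (P.reflectionPerm ε ε)))
        (P.reflectionPerm ε (P.reflectionPerm β β)) = -P.pairingIn ℤ ε β := by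
      rw [e5, ← RootPairing.pairingIn_reflectionPerm,
        RootPairing.pairingIn_reflectionPerm_self_right, e3]
    -- `s_ε β = β - ε` and `s_β ε` are both negative, so that `⟨ε, β^∨⟩` cannot be `1`
    have hk : P.pairingIn ℤ ε β ≠ 1 := by
      intro hk
      rw [← height_neg_iff, height_reflectionPerm] at hpos hneg
      rw [hk] at hpos
      rw [h1] at hneg
      linarith
    have hk0 : P.pairingIn ℤ ε β ≠ 0 := by
      have := P.zero_lt_pairingIn_iff' ℤ (i := β) (j := ε)
      omega
    rw [e1] at hs ⊢
    refine ⟨isAdditivePair_of_isDropPair ⟨hε, hβ, hl⟩ hγ hδ hs ?_, ?_, ?_⟩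
    · rw [e5, coroot_reflectionPerm_pairingIn, e4, one_smul]
      abel
    · dsimp only
      rw [e2]
      omega
    · rw [toDropPair, if_neg (by dsimp only; rw [e2]; omega)]
      simp only [reflectionPerm_reflectionPerm, RootPairing.reflectionPerm_self]

theorem toAdditivePair_toDropPair {γ δ : ι} (h : IsAdditivePair b γ δ)
    (h0 : P.pairingIn ℤ γ δ ≠ 0) :
    toAdditivePair b (toDropPair (P := P) (γ, δ)) = (γ, δ) := by
  have hγ := h.1.1
  have hδ := h.2.1.1
  rcases h.pairingIn_cases h0 with h1 | h1
  · rw [toDropPair, if_pos h1.1, toAdditivePair]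
    dsimp only
    rw [if_pos (by rwa [RootPairing.reflectionPerm_self]), RootPairing.reflectionPerm_self]
  · have hneg : ¬ b.IsPos (P.reflectionPerm (P.reflectionPerm δ (P.reflectionPerm γ δ))
        (P.reflectionPerm δ γ)) := by
      rw [← height_pos_iff] at hγ hδ
      have e : P.reflectionPerm (P.reflectionPerm δ (P.reflectionPerm γ δ))
          (P.reflectionPerm δ γ) = P.reflectionPerm δ (P.reflectionPerm γ (P.reflectionPerm δ
            (P.reflectionPerm γ γ))) := by
        simp only [reflectionPerm_reflectionPerm, RootPairing.reflectionPerm_self]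
      rw [e, ← height_neg_iff, height_reflectionPerm, height_reflectionPerm, height_reflectionPerm,
        height_reflectionPerm]
      simp only [pairingIn_reflectionPerm_left, RootPairing.pairingIn_same, h1.2]
      have q1 : 0 ≤ -P.pairingIn ℤ γ δ * (-(P.pairingIn ℤ γ δ + 2)) :=
        mul_nonneg (by omega) (by omega)
      have q2 : 0 < -(1 + P.pairingIn ℤ γ δ) * b.height γ := mul_pos (by omega) hγ
      have q3 := mul_nonneg q1 hδ.le
      linarith
    rw [toDropPair, if_neg (by dsimp only; omega), toAdditivePair]
    dsimp only
    rw [if_neg hneg]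
    simp only [reflectionPerm_reflectionPerm, RootPairing.reflectionPerm_self]

end Pairs

/-! ### Operators satisfying the nil-Coxeter relations -/

section NilCoxeter

variable {ι M N : Type*} [Fintype ι] [AddCommGroup M] [Module ℂ M] [AddCommGroup N] [Module ℂ N]
  {P : RootPairing ι ℂ M N} (b : P.Base) [P.IsCrystallographic] [P.IsReduced]
  {E : Type*} [Ring E] [Algebra ℂ E]

local notation "s(" γ ")" => RootPairing.weylGroup.ofIdx P γ
local notation "len(" w ")" => wordLength (simpleReflection b) w
local notation "π(" l ")" => List.prod (List.map (simpleReflection b) l)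

/-- The product of the operators `T i` along a reduced word of `w`. -/
noncomputable def wordOp (T : b.support → E) (w : P.weylGroup) : E :=
  ((reducedWord (simpleReflection b) w).map T).prod

open Classical in
/-- The product of the operators `T i` along some word of length `n` for `w`, and `0` if there is
no such word. -/
noncomputable def wordOpOfLength (T : b.support → E) (n : ℕ) (w : P.weylGroup) : E :=
  if h : ∃ l : List b.support, l.length = n ∧ π(l) = w then (h.choose.map T).prod else 0

/-- The products of the operators `T i` along words of length `n` depend only on the product of
the word in the Weyl group. -/
def WordIndependent (T : b.support → E) (n : ℕ) : Prop :=
  ∀ l l' : List b.support, l.length = n → l'.length = n → π(l) = π(l') →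
    (l.map T).prod = (l'.map T).prod

/-- The nil-Coxeter relations: products along reduced words of `w` depend only on `w`, and products
along non-reduced words vanish. -/
def IsNilCoxeter (T : b.support → E) : Prop :=
  ∀ l : List b.support, (l.map T).prod = if l.length = len(π(l)) then wordOp b T π(l) else 0

variable {b}

theorem WordIndependent.wordOpOfLength_eq {T : b.support → E} {n : ℕ}
    (h : WordIndependent b T n) {l : List b.support} (hl : l.length = n) :
    wordOpOfLength b T n π(l) = (l.map T).prod := by
  have h' : ∃ l' : List b.support, l'.length = n ∧ π(l') = π(l) := ⟨l, hl, rfl⟩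
  rw [wordOpOfLength, dif_pos h']
  exact h _ _ h'.choose_spec.1 hl h'.choose_spec.2

theorem IsNilCoxeter.wordIndependent {T : b.support → E} (h : IsNilCoxeter b T) (n : ℕ) :
    WordIndependent b T n := fun l l' hl hl' hll' => by
  rw [h l, h l', hll', hl, hl']

theorem exists_word_of_rootSign_ne {l : List b.support} {γ : ι}
    (h : rootSign b γ ≠ rootSign b (π(l) • γ)) :
    ∃ l' : List b.support, l'.length + 1 = l.length ∧ π(l') = π(l) * s(γ) := by
  by_cases hγ : b.IsPos γ
  · refine exists_word_mul_ofIdx b l γ hγ fun h' => h ?_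
    rw [(rootSign_eq_one_iff b _).2 hγ, (rootSign_eq_one_iff b _).2 h']
  · rw [← ofIdx_neg]
    refine exists_word_mul_ofIdx b l _ ((isPos_neg_iff b γ).2 hγ) fun h' => h ?_
    rw [smul_neg_idx, isPos_neg_iff] at h'
    rw [(rootSign_eq_neg_one_iff b _).2 hγ, (rootSign_eq_neg_one_iff b _).2 h']

theorem wordLength_lt_of_rootSign_ne {w : P.weylGroup} {γ : ι}
    (h : rootSign b γ ≠ rootSign b (w • γ)) : len(w * s(γ)) < len(w) := by
  rw [← prod_reducedWord b w] at h
  obtain ⟨l, h1, h2⟩ := exists_word_of_rootSign_ne h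
  have h3 := wordLength_prod_le b l
  rw [h2, prod_reducedWord] at h3
  rw [length_reducedWord] at h1
  omega

/-- The commutation rule of a product `T i₁ ⋯ T iₙ` with operators `L v` that satisfy
`T i * L v = L (s_i v) * T i + f_i(v)`.  The sum is over all roots; its terms are invariant under
`γ ↦ -γ`, and only the inversions of the word and their negatives contribute. -/
theorem word_mul_comm {V : Type*} [MulAction P.weylGroup V] {T : b.support → E} {L : V → E}
    {f : ι → V → ℂ} (hTL : ∀ i v, T i * L v = L (simpleReflection b i • v) * T i +
      algebraMap ℂ E (f i v))
    (hf : ∀ (w : P.weylGroup) γ v, f (w • γ) (w • v) = f γ v)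
    (hneg : ∀ γ v, f (P.reflectionPerm γ γ) v = -f γ v) (l : List b.support)
    (hC : ∀ k < l.length, WordIndependent b T k) (v : V) :
    (l.map T).prod * L v = L (π(l) • v) * (l.map T).prod +
      ∑ γ, ((rootSign b γ - rootSign b (π(l) • γ) : ℤ) / 4 * f γ v : ℂ) •
        wordOpOfLength b T (l.length - 1) (π(l) * s(γ)) := by
  classical
  induction l with
  | nil => simp
  | cons i l ih =>
    specialize ih fun k hk => hC k (hk.trans (Nat.lt_succ_self _))
    have hCl := hC l.length (Nat.lt_succ_self _)
    rw [List.map_cons, List.prod_cons, mul_assoc, ih, mul_add, ← mul_assoc, hTL]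
    simp only [List.map_cons, List.prod_cons, List.length_cons, Nat.add_sub_cancel]
    set w := π(l) with hw
    rw [add_mul, mul_assoc, add_assoc, mul_smul]
    congr 1
    rw [Finset.mul_sum]
    have h1 : ∀ γ, T i * (((rootSign b γ - rootSign b (w • γ) : ℤ) / 4 * f γ v : ℂ) •
        wordOpOfLength b T (l.length - 1) (w * s(γ))) =
        ((rootSign b γ - rootSign b (w • γ) : ℤ) / 4 * f γ v : ℂ) •
          wordOpOfLength b T l.length (simpleReflection b i * w * s(γ)) := by
      intro γ
      by_cases hγ : rootSign b γ = rootSign b (w • γ)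
      · simp [hγ]
      obtain ⟨l', e1, e2⟩ := exists_word_of_rootSign_ne hγ
      rw [mul_smul_comm, ← hw] at *
      congr 1
      have e3 : l'.length = l.length - 1 := by omega
      have e4 := (hC (l.length - 1) (by simp only [List.length_cons]; omega)).wordOpOfLength_eq e3
      have e5 := hCl.wordOpOfLength_eq (l := i :: l') (by simpa using e1)
      rw [e2] at e4
      rw [List.map_cons, List.map_cons, List.prod_cons, List.prod_cons, e2, ← mul_assoc] at e5
      rw [e4, e5]
    have h2 : algebraMap ℂ E (f i (w • v)) * (l.map T).prod =
        ∑ γ, ((rootSign b (w • γ) - rootSign b ((simpleReflection b i * w) • γ) : ℤ) / 4 *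
          f γ v : ℂ) • wordOpOfLength b T l.length (simpleReflection b i * w * s(γ)) := by
      have h3 : ∀ γ, ((rootSign b (w • γ) - rootSign b ((simpleReflection b i * w) • γ) : ℤ) / 4 *
          f γ v : ℂ) • wordOpOfLength b T l.length (simpleReflection b i * w * s(γ)) =
          (if γ = w⁻¹ • (i : ι) then (f i (w • v) / 2) • (l.map T).prod else 0) +
          (if γ = P.reflectionPerm (w⁻¹ • (i : ι)) (w⁻¹ • (i : ι)) then
            (f i (w • v) / 2) • (l.map T).prod else 0) := by
        intro γ
        have e1 : simpleReflection b i * w * s(w⁻¹ • (i : ι)) = w := by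
          rw [ofIdx_smul, simpleReflection, inv_inv, mul_assoc, ← mul_assoc w, ← mul_assoc w,
            mul_inv_cancel, one_mul, ← mul_assoc, ofIdx_mul_self, one_mul]
        have e2 : f (w⁻¹ • (i : ι)) v = f i (w • v) := by
          rw [← hf w, smul_inv_smul]
        have e3 : wordOpOfLength b T l.length w = (l.map T).prod := hCl.wordOpOfLength_eq rfl
        rw [mul_smul (simpleReflection b i) w γ, rootSign_simpleReflection, ← eq_inv_smul_iff (g := w),
          ← eq_inv_smul_iff (g := w), smul_neg_idx]
        by_cases c1 : γ = w⁻¹ • (i : ι)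
        · have c2 : γ ≠ P.reflectionPerm (w⁻¹ • (i : ι)) (w⁻¹ • (i : ι)) := by
            rw [c1]; exact (neg_ne_idx _).symm
          rw [if_pos c1, if_neg c2, if_pos c1, if_neg c2, c1, e1, e2, e3, add_zero]
          congr 1
          push_cast
          ring
        · by_cases c2 : γ = P.reflectionPerm (w⁻¹ • (i : ι)) (w⁻¹ • (i : ι))
          · rw [if_neg c1, if_pos c2, if_neg c1, if_pos c2, c2, ofIdx_neg, e1, hneg, e2, e3,
              zero_add]
            congr 1
            push_cast
            ring
          · rw [if_neg c1, if_neg c2, if_neg c1, if_neg c2]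
            simp
      rw [Finset.sum_congr rfl fun γ _ => h3 γ, Finset.sum_add_distrib]
      simp only [Finset.sum_ite_eq', Finset.mem_univ, if_true]
      rw [← add_smul, add_halves, Algebra.smul_def]
    rw [Finset.sum_congr rfl fun γ _ => h1 γ, h2, ← Finset.sum_add_distrib]
    refine Finset.sum_congr rfl fun γ _ => ?_
    rw [← add_smul]
    congr 1
    push_cast
    ring

/-- Operators on a module satisfy the nil-Coxeter relations if they obey a twisted Leibniz rule with
respect to operators `L v` which generate the module from a vector killed by all `T i`. -/
theorem isNilCoxeter_of_cyclic {S X : Type*} [CommRing S] [Algebra ℂ S] [AddCommGroup X]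
    [Module S X] [Module ℂ X] [IsScalarTower ℂ S X]
    {V : Type*} [MulAction P.weylGroup V] {T : b.support → Module.End S X}
    {L : V → Module.End S X} {f : ι → V → ℂ}
    (hTL : ∀ i v, T i * L v = L (simpleReflection b i • v) * T i +
      algebraMap ℂ (Module.End S X) (f i v))
    (hf : ∀ (w : P.weylGroup) γ v, f (w • γ) (w • v) = f γ v)
    (hneg : ∀ γ v, f (P.reflectionPerm γ γ) v = -f γ v)
    (x₀ : X) (hx₀ : ∀ i, T i x₀ = 0)
    (hcyc : ∀ g : Module.End S X, g x₀ = 0 → (∀ v x, g x = 0 → g (L v x) = 0) → g = 0) :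
    IsNilCoxeter b T := by
  have hzero : ∀ l : List b.support, l ≠ [] → (l.map T).prod x₀ = 0 := by
    intro l
    induction l with
    | nil => exact fun h => (h rfl).elim
    | cons i l ih =>
      intro _
      rw [List.map_cons, List.prod_cons, Module.End.mul_apply]
      by_cases hl : l = []
      · simp [hl, hx₀]
      · rw [ih hl, map_zero]
  have hC : ∀ n, WordIndependent b T n := by
    intro n
    induction n using Nat.strong_induction_on with
    | _ n ih =>
      intro l l' hl hl' hll'
      rcases Nat.eq_zero_or_pos n with rfl | hn
      · rw [List.length_eq_zero_iff.1 hl, List.length_eq_zero_iff.1 hl']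
      rw [← sub_eq_zero]
      refine hcyc _ ?_ fun v x hx => ?_
      · rw [LinearMap.sub_apply, hzero l (by rintro rfl; simp at hl; omega),
          hzero l' (by rintro rfl; simp at hl'; omega), sub_zero]
      · have h1 := word_mul_comm hTL hf hneg l (by rwa [hl]) v
        have h2 := word_mul_comm hTL hf hneg l' (by rwa [hl']) v
        rw [hl] at h1
        rw [hl', ← hll'] at h2
        have h3 : ((l.map T).prod - (l'.map T).prod) * L v =
            L (π(l) • v) * ((l.map T).prod - (l'.map T).prod) := by
          rw [sub_mul, h1, h2, mul_sub, add_sub_add_right_eq_sub]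
        rw [← Module.End.mul_apply, h3, Module.End.mul_apply, hx, map_zero]
  have hvanish : ∀ n, ∀ l : List b.support, l.length = n → n ≠ len(π(l)) → (l.map T).prod = 0 := by
    intro n
    induction n with
    | zero =>
      intro l hl h
      rw [List.length_eq_zero_iff.1 hl] at h
      exact (h (wordLength_one b).symm).elim
    | succ n ih =>
      intro l hl h
      refine hcyc _ (hzero l (by rintro rfl; simp at hl)) fun v x hx => ?_
      rw [← Module.End.mul_apply, word_mul_comm hTL hf hneg l (fun k _ => hC k) v, hl,
        Finset.sum_eq_zero, add_zero, Module.End.mul_apply, hx, map_zero]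
      intro γ _
      by_cases hγ : rootSign b γ = rootSign b (π(l) • γ)
      · simp [hγ]
      obtain ⟨l', e1, e2⟩ := exists_word_of_rootSign_ne hγ
      have e3 : l'.length = n := by omega
      have e4 := (hC n).wordOpOfLength_eq e3
      have e5 := wordLength_lt_of_rootSign_ne hγ
      have e6 := wordLength_prod_le b l
      rw [Nat.add_sub_cancel, ← e2, e4, ih l' e3 (by rw [e2]; omega), smul_zero]
  intro l
  split_ifs with h
  · exact hC l.length l _ rfl (by rw [length_reducedWord, h]) (prod_reducedWord b _).symm
  · exact hvanish _ l rfl h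

variable {T : b.support → E} (hT : IsNilCoxeter b T)
include hT

theorem IsNilCoxeter.wordOpOfLength_eq (n : ℕ) (w : P.weylGroup) (h : len(w) ≤ n)
    (h' : ∃ l : List b.support, l.length = n ∧ π(l) = w) :
    wordOpOfLength b T n w = if len(w) = n then wordOp b T w else 0 := by
  obtain ⟨l, rfl, rfl⟩ := h'
  rw [(hT.wordIndependent l.length).wordOpOfLength_eq rfl, hT l]
  simp only [eq_comm]

open Classical in
/-- The product of two basis elements of the nil-Coxeter algebra. -/
theorem IsNilCoxeter.wordOp_mul (u v : P.weylGroup) : wordOp b T u * wordOp b T v =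
    if len(u * v) = len(u) + len(v) then wordOp b T (u * v) else 0 := by
  have h := hT (reducedWord (simpleReflection b) u ++ reducedWord (simpleReflection b) v)
  simp only [List.map_append, List.prod_append, prod_reducedWord, List.length_append,
    length_reducedWord] at h
  rw [wordOp, wordOp, h]
  congr 1
  exact propext eq_comm

theorem IsNilCoxeter.wordOp_simple (i : b.support) : wordOp b T (simpleReflection b i) = T i := by
  have h := hT [i]
  have h1 : 0 < len(simpleReflection b i) := by
    have := wordLength_mul_ofIdx_lt b (w := simpleReflection b i) (γ := i)
      (b.isPos_of_mem_support i.2) (by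
        rw [simpleReflection, ofIdx_smul_idx, isPos_neg_iff, not_not]
        exact b.isPos_of_mem_support i.2)
    omega
  have h2 := wordLength_prod_le b [i]
  simp only [List.map_cons, List.map_nil, List.prod_cons, List.prod_nil, mul_one,
    List.length_cons, List.length_nil, zero_add] at h h2
  rw [if_pos (by omega)] at h
  exact h.symm

theorem IsNilCoxeter.wordOp_mul_simple {w : P.weylGroup} {i : b.support}
    (h : ¬ b.IsPos (w • (i : ι))) :
    wordOp b T w = wordOp b T (w * simpleReflection b i) * T i := by
  have h1 := wordLength_mul_ofIdx_lt b (b.isPos_of_mem_support i.2) h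
  have h2 := wordLength_mul_le b (w * simpleReflection b i) (simpleReflection b i)
  have h3 := wordLength_prod_le b [i]
  simp only [List.map_cons, List.map_nil, List.prod_cons, List.prod_nil, mul_one,
    List.length_cons, List.length_nil, zero_add] at h3
  change len(w * simpleReflection b i) < _ at h1
  have e : w * simpleReflection b i * simpleReflection b i = w := by
    rw [mul_assoc, simpleReflection_mul_self, mul_one]
  rw [e] at h2
  rw [← hT.wordOp_simple i, hT.wordOp_mul, e, if_pos (by omega)]

open Classical in
/-- The commutation rule between `T_w` and linear forms; the sum is over the positive roots `γ` such
that `w` covers `w s_γ`. -/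
theorem IsNilCoxeter.wordOp_mul_comm {A : M → E}
    (hTA : ∀ i m, T i * A m = A (simpleReflection b i • m) * T i +
      algebraMap ℂ E (P.coroot' i m)) (w : P.weylGroup) (m : M) :
    wordOp b T w * A m = A (w • m) * wordOp b T w +
      ∑ γ with b.IsPos γ ∧ len(w * s(γ)) + 1 = len(w),
        (P.coroot' γ m) • wordOp b T (w * s(γ)) := by
  have h := word_mul_comm (f := fun γ m => P.coroot' γ m) hTA coroot'_smul coroot'_neg
    (reducedWord (simpleReflection b) w) (fun k _ => hT.wordIndependent k) m
  rw [prod_reducedWord, length_reducedWord] at h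
  refine h.trans ?_
  congr 1
  set F : ι → E := fun γ => ((rootSign b γ - rootSign b (w • γ) : ℤ) / 4 * P.coroot' γ m : ℂ) •
    wordOpOfLength b T (len(w) - 1) (w * s(γ)) with hF
  have hneg : ∀ γ, F (P.reflectionPerm γ γ) = F γ := by
    intro γ
    simp only [hF]
    rw [smul_neg_idx, rootSign_neg, rootSign_neg, coroot'_neg, ofIdx_neg]
    congr 1
    push_cast
    ring
  have hsum : ∑ γ, F γ = ∑ γ with b.IsPos γ, (2 : ℂ) • F γ := by
    rw [← Finset.sum_filter_add_sum_filter_not Finset.univ (fun γ => b.IsPos γ)]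
    have : ∑ γ with ¬ b.IsPos γ, F γ = ∑ γ with b.IsPos γ, F γ := by
      refine Finset.sum_nbij' (fun γ => P.reflectionPerm γ γ) (fun γ => P.reflectionPerm γ γ)
        ?_ ?_ ?_ ?_ ?_
      · intro γ; simp [isPos_neg_iff]
      · intro γ; simp [isPos_neg_iff]
      · intro γ _; exact neg_neg_idx γ
      · intro γ _; exact neg_neg_idx γ
      · intro γ _; exact (hneg γ).symm
    rw [this, ← Finset.sum_add_distrib]
    exact Finset.sum_congr rfl fun γ _ => (two_smul ℂ _).symm
  rw [hsum, ← Finset.filter_filter, Finset.sum_filter (fun γ => len(w * s(γ)) + 1 = len(w))]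
  refine Finset.sum_congr rfl fun γ hγ => ?_
  have hγ' : b.IsPos γ := by simpa using hγ
  simp only [hF, (rootSign_eq_one_iff b _).2 hγ']
  by_cases hw : b.IsPos (w • γ)
  · have := lt_wordLength_mul_ofIdx b hγ' hw
    rw [if_neg (by omega), (rootSign_eq_one_iff b _).2 hw]
    simp
  · have hlt := wordLength_mul_ofIdx_lt b hγ' hw
    have hex := exists_word_mul_ofIdx b (reducedWord (simpleReflection b) w) γ hγ'
      (by rwa [prod_reducedWord])
    rw [prod_reducedWord, length_reducedWord] at hex
    obtain ⟨l, e1, e2⟩ := hex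
    rw [hT.wordOpOfLength_eq _ _ (by omega) ⟨l, by omega, e2⟩,
      (rootSign_eq_neg_one_iff b _).2 hw, smul_smul]
    by_cases hc : len(w * s(γ)) + 1 = len(w)
    · rw [if_pos hc, if_pos (by omega)]
      congr 1
      push_cast
      ring
    · rw [if_neg hc, if_neg (by omega), smul_zero]

end NilCoxeter

/-! ### Commutativity of the quantized operators -/

section Commutativity

variable {ι M N : Type*} [Fintype ι] [AddCommGroup M] [Module ℂ M] [AddCommGroup N] [Module ℂ N]
  {P : RootPairing ι ℂ M N} {b : P.Base} [P.IsCrystallographic] [P.IsReduced]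
  {E : Type*} [Ring E] [Algebra ℂ E]

local notation "s(" γ ")" => RootPairing.weylGroup.ofIdx P γ
local notation "len(" w ")" => wordLength (simpleReflection b) w

open Classical in
/-- The operator `A(m) + ∑_γ ⟨m, γ^∨⟩ Q_γ T_{s_γ}`, the sum being over the special roots `γ`. -/
noncomputable def quantumOp (b : P.Base) (T : b.support → E) (A : M →ₗ[ℂ] E) (Q : ι → E) (m : M) :
    E :=
  A m + ∑ γ with IsSpecial b γ, P.coroot' γ m • (Q γ * wordOp b T s(γ))

theorem coroot'_add_of_coroot {γ δ ε : ι} (h : P.coroot ε = P.coroot γ + P.coroot δ) (m : M) :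
    P.coroot' ε m = P.coroot' γ m + P.coroot' δ m := by
  simp only [RootPairing.coroot', h, map_add, LinearMap.add_apply]

theorem coroot'_of_coroot_eq {γ δ β : ι} {z : ℤ}
    (h : P.coroot β = P.coroot γ + z • (P.coroot γ + P.coroot δ)) (m : M) :
    P.coroot' β m = P.coroot' γ m + z * (P.coroot' γ m + P.coroot' δ m) := by
  simp only [RootPairing.coroot', h, map_add, map_zsmul, LinearMap.add_apply,
    LinearMap.smul_apply, zsmul_eq_mul]

theorem IsSpecial.wordLength_pos {γ : ι} (h : IsSpecial b γ) : 0 < len(s(γ)) := by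
  have h1 := flip_height_pos b h.1
  have h2 := h.2
  omega

theorem ofIdx_commute_of_pairingIn_eq_zero {γ δ : ι} (h : P.pairingIn ℤ γ δ = 0) :
    s(γ) * s(δ) = s(δ) * s(γ) := by
  have h1 : P.pairing γ δ = 0 := by rw [← P.algebraMap_pairingIn ℤ, h, map_zero]
  have h2 := ofIdx_reflectionPerm (P := P) δ γ
  rw [P.reflectionPerm_eq_of_pairing_eq_zero h1] at h2
  nth_rewrite 1 [h2]
  rw [mul_assoc, ofIdx_mul_self, mul_one]

theorem pairingIn_eq_zero_symm {γ δ : ι} (h : P.pairingIn ℤ γ δ = 0) :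
    P.pairingIn ℤ δ γ = 0 := by
  have h1 : P.pairing γ δ = 0 := by rw [← P.algebraMap_pairingIn ℤ, h, map_zero]
  have h2 := (P.pairing_eq_zero_iff').1 h1
  rw [← P.algebraMap_pairingIn ℤ, algebraMap_int_eq, eq_intCast] at h2
  exact_mod_cast h2

open Classical in
/-- The part of the commutator of two quantized operators which comes from products of two
reflections vanishes: an additive pair of orthogonal roots cancels against the pair with the roots
interchanged, and any other additive pair cancels against the drop pair `toDropPair`. -/
theorem sum_additive_add_sum_drop_eq_zero (F : P.weylGroup → E) {Q : ι → E}
    (hQ : ∀ γ x, Commute (Q γ) x)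
    (hQmul : ∀ γ δ ε, b.IsPos γ → b.IsPos δ → P.coroot ε = P.coroot γ + P.coroot δ →
      Q ε = Q γ * Q δ) (m n : M) :
    ∑ p : ι × ι with IsAdditivePair b p.1 p.2,
        (P.coroot' p.1 m * P.coroot' p.2 n - P.coroot' p.1 n * P.coroot' p.2 m) •
          (Q p.1 * Q p.2 * F (s(p.1) * s(p.2))) +
      ∑ p : ι × ι with IsDropPair b p.1 p.2,
        (P.coroot' p.1 m * P.coroot' p.2 n - P.coroot' p.1 n * P.coroot' p.2 m) •
          (Q p.1 * F (s(p.1) * s(p.2))) = 0 := by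
  have h1 : ∑ p : ι × ι with IsAdditivePair b p.1 p.2 ∧ P.pairingIn ℤ p.1 p.2 = 0,
      (P.coroot' p.1 m * P.coroot' p.2 n - P.coroot' p.1 n * P.coroot' p.2 m) •
          (Q p.1 * Q p.2 * F (s(p.1) * s(p.2))) = 0 := by
    refine Finset.sum_involution (fun p _ => p.swap) ?_ ?_ ?_ ?_
    · rintro ⟨γ, δ⟩ hp
      simp only [Finset.mem_filter, Finset.mem_univ, true_and] at hp
      simp only [Prod.fst_swap, Prod.snd_swap]
      rw [ofIdx_commute_of_pairingIn_eq_zero hp.2, (hQ δ (Q γ)).eq, ← add_smul]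
      rw [show P.coroot' γ m * P.coroot' δ n - P.coroot' γ n * P.coroot' δ m +
        (P.coroot' δ m * P.coroot' γ n - P.coroot' δ n * P.coroot' γ m) = 0 by ring, zero_smul]
    · rintro ⟨γ, δ⟩ hp hne heq
      simp only [Prod.swap_prod_mk, Prod.mk.injEq] at heq
      refine hne ?_
      simp only [heq.1]
      rw [show P.coroot' γ m * P.coroot' γ n - P.coroot' γ n * P.coroot' γ m = 0 by ring,
        zero_smul]
    · rintro ⟨γ, δ⟩ hp
      simp only [Finset.mem_filter, Finset.mem_univ, true_and, Prod.fst_swap,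
        Prod.snd_swap] at hp ⊢
      obtain ⟨⟨hγ, hδ, hl⟩, h0⟩ := hp
      exact ⟨⟨hδ, hγ, by rw [← ofIdx_commute_of_pairingIn_eq_zero h0, hl, add_comm]⟩,
        pairingIn_eq_zero_symm h0⟩
    · rintro ⟨γ, δ⟩ _
      rfl
  have h2 : ∑ p : ι × ι with IsDropPair b p.1 p.2 ∧ p.2 = p.1,
      (P.coroot' p.1 m * P.coroot' p.2 n - P.coroot' p.1 n * P.coroot' p.2 m) •
          (Q p.1 * F (s(p.1) * s(p.2))) = 0 := by
    refine Finset.sum_eq_zero fun p hp => ?_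
    simp only [Finset.mem_filter] at hp
    rw [hp.2.2, mul_comm (P.coroot' p.1 m), sub_self, zero_smul]
  have h3 : ∑ p : ι × ι with IsDropPair b p.1 p.2 ∧ ¬ p.2 = p.1,
      (P.coroot' p.1 m * P.coroot' p.2 n - P.coroot' p.1 n * P.coroot' p.2 m) •
          (Q p.1 * F (s(p.1) * s(p.2))) =
      ∑ p : ι × ι with IsAdditivePair b p.1 p.2 ∧ ¬ P.pairingIn ℤ p.1 p.2 = 0,
        -((P.coroot' p.1 m * P.coroot' p.2 n - P.coroot' p.1 n * P.coroot' p.2 m) •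
          (Q p.1 * Q p.2 * F (s(p.1) * s(p.2)))) := by
    refine (Finset.sum_nbij' (toDropPair (P := P)) (toAdditivePair b) ?_ ?_ ?_ ?_ ?_).symm
    · rintro ⟨γ, δ⟩ hp
      simp only [Finset.mem_filter, Finset.mem_univ, true_and] at hp ⊢
      have hd := isDropPair_toDropPair hp.1 hp.2
      refine ⟨hd, fun heq => ?_⟩
      have e1 := mul_toDropPair (P := P) (γ, δ)
      rw [heq, ofIdx_mul_self] at e1
      have e2 := hp.1.2.2
      rw [← e1, wordLength_one] at e2
      have := hp.1.1.wordLength_pos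
      omega
    · rintro ⟨ε, β⟩ hp
      simp only [Finset.mem_filter, Finset.mem_univ, true_and] at hp ⊢
      have := isAdditivePair_toAdditivePair hp.1 hp.2
      exact ⟨this.1, this.2.1⟩
    · rintro ⟨γ, δ⟩ hp
      simp only [Finset.mem_filter, Finset.mem_univ, true_and] at hp
      exact toAdditivePair_toDropPair hp.1 hp.2
    · rintro ⟨ε, β⟩ hp
      simp only [Finset.mem_filter, Finset.mem_univ, true_and] at hp
      exact (isAdditivePair_toAdditivePair hp.1 hp.2).2.2
    · rintro ⟨γ, δ⟩ hp
      simp only [Finset.mem_filter, Finset.mem_univ, true_and] at hp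
      obtain ⟨z, hz⟩ := exists_coroot_toDropPair hp.1 hp.2
      have he := coroot_toDropPair hp.1 hp.2
      rw [mul_toDropPair, coroot'_add_of_coroot he, coroot'_add_of_coroot he,
        coroot'_of_coroot_eq hz, coroot'_of_coroot_eq hz, hQmul _ _ _ hp.1.1.1 hp.1.2.1.1 he,
        ← neg_smul]
      congr 1
      ring
  rw [← Finset.sum_filter_add_sum_filter_not (Finset.univ.filter fun p : ι × ι =>
      IsAdditivePair b p.1 p.2) (fun p => P.pairingIn ℤ p.1 p.2 = 0),
    ← Finset.sum_filter_add_sum_filter_not (Finset.univ.filter fun p : ι × ι =>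
      IsDropPair b p.1 p.2) (fun p => p.2 = p.1)]
  simp only [Finset.filter_filter]
  rw [h1, h2, h3, zero_add, zero_add, Finset.sum_neg_distrib, add_neg_cancel]

/-- The operators `A(m) + ∑_γ ⟨m, γ^∨⟩ Q_γ T_{s_γ}` commute with each other. -/
theorem commute_quantumOp {T : b.support → E} (hT : IsNilCoxeter b T) {A : M →ₗ[ℂ] E}
    (hTA : ∀ i m, T i * A m = A (simpleReflection b i • m) * T i +
      algebraMap ℂ E (P.coroot' i m)) (hA : ∀ m n, Commute (A m) (A n)) {Q : ι → E}
    (hQ : ∀ γ x, Commute (Q γ) x)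
    (hQmul : ∀ γ δ ε, b.IsPos γ → b.IsPos δ → P.coroot ε = P.coroot γ + P.coroot δ →
      Q ε = Q γ * Q δ) (m n : M) :
    Commute (quantumOp b T A Q m) (quantumOp b T A Q n) := by
  classical
  -- `B` is the quantum part of the operators; `B m * A n` produces the shorter terms `D` and the
  -- symmetric terms `X` (from `s_γ n = n - ⟨n, γ^∨⟩ γ`), and `B m * B n` is `I`
  set B : M → E := fun m => ∑ γ with IsSpecial b γ, P.coroot' γ m • (Q γ * wordOp b T s(γ))
    with hB
  set D : M → M → E := fun m n => ∑ p : ι × ι with IsDropPair b p.1 p.2,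
    (P.coroot' p.1 m * P.coroot' p.2 n) • (Q p.1 * wordOp b T (s(p.1) * s(p.2))) with hD
  set X : M → M → E := fun m n => ∑ γ with IsSpecial b γ,
    (P.coroot' γ m * P.coroot' γ n) • (Q γ * (A (P.root γ) * wordOp b T s(γ))) with hX
  set I : M → M → E := fun m n => ∑ p : ι × ι with IsAdditivePair b p.1 p.2,
    (P.coroot' p.1 m * P.coroot' p.2 n) • (Q p.1 * Q p.2 * wordOp b T (s(p.1) * s(p.2))) with hI
  have hBA : ∀ m n, B m * A n = A n * B m - X m n + D m n := by
    intro m n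
    simp only [hB, hX, hD]
    rw [Finset.sum_mul, Finset.mul_sum, ← Finset.sum_sub_distrib]
    have hsplit : ∑ p : ι × ι with IsDropPair b p.1 p.2,
        (P.coroot' p.1 m * P.coroot' p.2 n) • (Q p.1 * wordOp b T (s(p.1) * s(p.2))) =
        ∑ γ with IsSpecial b γ, ∑ β with b.IsPos β ∧ len(s(γ) * s(β)) + 1 = len(s(γ)),
          (P.coroot' γ m * P.coroot' β n) • (Q γ * wordOp b T (s(γ) * s(β))) := by
      rw [Finset.sum_filter, Finset.sum_filter, Fintype.sum_prod_type]
      simp only [IsDropPair, Finset.sum_filter]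
      refine Finset.sum_congr rfl fun γ _ => ?_
      by_cases hγ : IsSpecial b γ <;> simp [hγ]
    rw [hsplit, ← Finset.sum_add_distrib]
    refine Finset.sum_congr rfl fun γ _ => ?_
    have e : A (s(γ) • n) = A n - P.coroot' γ n • A (P.root γ) := by
      rw [ofIdx_smul_vec, RootPairing.reflection_apply, map_sub, map_smul]
    rw [smul_mul_assoc, mul_assoc, hT.wordOp_mul_comm hTA, e, sub_mul, mul_add, mul_sub,
      smul_add, smul_sub, Finset.mul_sum, Finset.smul_sum]
    congr 1
    · congr 1
      · rw [← mul_assoc, (hQ γ (A n)).eq, mul_assoc, mul_smul_comm]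
      · rw [smul_mul_assoc, mul_smul_comm, smul_smul]
    · exact Finset.sum_congr rfl fun β _ => by rw [mul_smul_comm, smul_smul]
  have hBB : ∀ m n, B m * B n = I m n := by
    intro m n
    simp only [hB, hI, Finset.sum_mul_sum, Finset.sum_filter, Fintype.sum_prod_type]
    refine Finset.sum_congr rfl fun γ _ => ?_
    by_cases hγ : IsSpecial b γ
    · simp only [hγ, if_true, IsAdditivePair, true_and]
      refine Finset.sum_congr rfl fun δ _ => ?_
      by_cases hδ : IsSpecial b δ
      · simp only [hδ, if_true, true_and]
        rw [smul_mul_smul_comm, mul_assoc (Q γ), ← mul_assoc (wordOp b T s(γ)),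
          ← (hQ δ (wordOp b T s(γ))).eq, mul_assoc (Q δ), ← mul_assoc (Q γ), hT.wordOp_mul]
        split_ifs <;> simp
      · simp [hδ]
    · simp [hγ, IsAdditivePair]
  have hXsymm : X m n = X n m :=
    Finset.sum_congr rfl fun γ _ => by rw [mul_comm (P.coroot' γ m)]
  have hzero := sum_additive_add_sum_drop_eq_zero (b := b) (wordOp b T) hQ hQmul m n
  have hzero' : I m n - I n m + (D m n - D n m) = 0 := by
    rw [← hzero]
    simp only [hI, hD, ← Finset.sum_sub_distrib, ← sub_smul]
  change (A m + B m) * (A n + B n) = (A n + B n) * (A m + B m)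
  rw [← sub_eq_zero]
  have := (hA m n).eq
  rw [add_mul, add_mul, mul_add, mul_add, mul_add, mul_add, hBA m n, hBA n m, hBB, hBB, hXsymm,
    this, ← hzero']
  abel

end Commutativity

/-! ### Fundamental weights -/

section FundamentalWeights

variable {ι M N : Type*} [Fintype ι] [AddCommGroup M] [Module ℂ M] [AddCommGroup N] [Module ℂ N]
  {P : RootPairing ι ℂ M N} (b : P.Base) [P.IsRootSystem]

/-- The fundamental weight `ω_i`, as an element of the weight space: the form dual to the coroot
`α_i^∨` in the basis of simple coroots. -/
noncomputable def fundWeight (i : b.support) : M := P.toPerfPair.symm (b.toCoweightBasis.coord i)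

theorem coroot'_fundWeight (γ : ι) (i : b.support) :
    P.coroot' γ (fundWeight b i) = corootCoeff b γ i := by
  classical
  have h : P.coroot' γ (fundWeight b i) = b.toCoweightBasis.coord i (P.coroot γ) := by
    change P.toPerfPair (P.toPerfPair.symm (b.toCoweightBasis.coord i)) (P.coroot γ) = _
    rw [LinearEquiv.apply_symm_apply]
  rw [h, coroot_eq_sum_corootCoeff b γ, map_sum]
  simp only [map_zsmul]
  have h2 : ∀ j : b.support, b.toCoweightBasis.coord i (P.coroot j) = if j = i then 1 else 0 := by
    intro j
    rw [Module.Basis.coord_apply, RootPairing.Base.toCoweightBasis_repr_coroot,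
      Finsupp.single_apply]
  simp [h2]

theorem corootCoeff_simple (j i : b.support) [Decidable (j = i)] :
    corootCoeff b j i = if j = i then 1 else 0 := by
  classical
  have h := coroot'_fundWeight b j i
  have h2 : P.coroot' j (fundWeight b i) = b.toCoweightBasis.coord i (P.coroot j) := by
    change P.toPerfPair (P.toPerfPair.symm (b.toCoweightBasis.coord i)) (P.coroot j) = _
    rw [LinearEquiv.apply_symm_apply]
  rw [h2, Module.Basis.coord_apply, RootPairing.Base.toCoweightBasis_repr_coroot,
      Finsupp.single_apply] at h
  split_ifs at h ⊢ <;> exact_mod_cast h.symm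

theorem corootCoeff_add {γ δ ε : ι} (h : P.coroot ε = P.coroot γ + P.coroot δ) (i : b.support) :
    corootCoeff b ε i = corootCoeff b γ i + corootCoeff b δ i := by
  have h1 : P.coroot' ε (fundWeight b i) =
      P.coroot' γ (fundWeight b i) + P.coroot' δ (fundWeight b i) := by
    simp only [RootPairing.coroot', h, map_add, LinearMap.add_apply]
  rw [coroot'_fundWeight, coroot'_fundWeight, coroot'_fundWeight] at h1
  exact_mod_cast h1

variable [P.IsCrystallographic] [P.IsReduced]

theorem corootCoeff_nonneg {γ : ι} (h : b.IsPos γ) (i : b.support) : 0 ≤ corootCoeff b γ i := by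
  have h1 := (b.flip.exists_root_eq_sum_int γ).choose_spec.2.1
  rcases h1 with h1 | h1
  · exact h1.le i
  · have h2 := flip_height_pos b h
    rw [flip_height_eq_sum] at h2
    have : ∑ i, corootCoeff b γ i ≤ 0 := Finset.sum_nonpos fun i _ => h1.le i
    omega

theorem qCoroot_add {γ δ ε : ι} (hγ : b.IsPos γ) (hδ : b.IsPos δ)
    (h : P.coroot ε = P.coroot γ + P.coroot δ) : qCoroot b ε = qCoroot b γ * qCoroot b δ := by
  rw [qCoroot, qCoroot, qCoroot, ← Finset.prod_mul_distrib]
  refine Finset.prod_congr rfl fun i _ => ?_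
  rw [corootCoeff_add b h, Int.toNat_add (corootCoeff_nonneg b hγ i) (corootCoeff_nonneg b hδ i),
    pow_add]

end FundamentalWeights

/-! ### The Demazure operators on the symmetric algebra -/

section Symmetric

/-- Commuting elements of an algebra are the images of the variables under a homomorphism. -/
theorem exists_algHom_of_commute {σ R A : Type*} [CommRing R] [Ring A] [Algebra R A] (x : σ → A)
    (h : ∀ i j, Commute (x i) (x j)) : ∃ φ : MvPolynomial σ R →ₐ[R] A, ∀ i, φ (X i) = x i := by
  let _ : CommRing (Algebra.adjoin R (Set.range x)) :=
    { (inferInstance : Ring (Algebra.adjoin R (Set.range x))) with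
      mul_comm := (Algebra.isMulCommutative_adjoin R (by
        rintro _ ⟨i, rfl⟩ _ ⟨j, rfl⟩
        exact h i j)).is_comm.comm }
  refine ⟨(Algebra.adjoin R (Set.range x)).val.comp
    (aeval fun i => ⟨x i, Algebra.subset_adjoin ⟨i, rfl⟩⟩), fun i => ?_⟩
  simp

variable {ι M N : Type*} [Fintype ι] [AddCommGroup M] [Module ℂ M] [AddCommGroup N] [Module ℂ N]
  {P : RootPairing ι ℂ M N} (b : P.Base)

/-- A weight as a linear polynomial in the fundamental weights. -/
noncomputable def linForm : M →ₗ[ℂ] SymR b where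
  toFun m := ∑ i : b.support, C (C (P.coroot' i m)) * X i
  map_add' m n := by
    rw [← Finset.sum_add_distrib]
    exact Finset.sum_congr rfl fun i _ => by rw [map_add, map_add, map_add, add_mul]
  map_smul' c m := by
    rw [Finset.smul_sum]
    refine Finset.sum_congr rfl fun i _ => ?_
    rw [map_smul, smul_eq_mul, map_mul, map_mul, mul_assoc, RingHom.id_apply, Algebra.smul_def]
    rfl

theorem linForm_apply (m : M) : linForm b m = ∑ i : b.support, C (C (P.coroot' i m)) * X i := rfl

/-- Multiplication by a weight, as an operator on the symmetric algebra. -/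
noncomputable def mulWeight : M →ₗ[ℂ] Module.End (QRing b) (SymR b) :=
  (LinearMap.mul (QRing b) (SymR b)).restrictScalars ℂ ∘ₗ linForm b

theorem mulWeight_apply (m : M) (f : SymR b) : mulWeight b m f = linForm b m * f := rfl

theorem linForm_fundWeight [P.IsRootSystem] (i : b.support) : linForm b (fundWeight b i) = X i := by
  classical
  rw [linForm_apply, Finset.sum_eq_single i]
  · rw [coroot'_fundWeight, corootCoeff_simple, if_pos rfl]
    simp
  · intro j _ hj
    rw [coroot'_fundWeight, corootCoeff_simple, if_neg hj]
    simp
  · simp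

variable [P.IsCrystallographic]

theorem linForm_root (γ : ι) : linForm b (P.root γ) = rootPoly b (QRing b) γ := by
  rw [linForm_apply, rootPoly]
  refine Finset.sum_congr rfl fun i _ => ?_
  rw [coroot'_root]
  simp

theorem coroot'_eq_sum (γ : ι) (m : M) :
    P.coroot' γ m = ∑ i : b.support, corootCoeff b γ i * P.coroot' i m := by
  have h := congrArg (P.toLinearMap m) (coroot_eq_sum_corootCoeff b γ)
  rw [map_sum] at h
  refine h.trans (Finset.sum_congr rfl fun i _ => ?_)
  rw [map_zsmul, zsmul_eq_mul]
  rfl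

theorem polyReflection_linForm (γ : ι) (m : M) :
    polyReflection (rootPoly b (QRing b) γ) (fun i => (corootCoeff b γ i : QRing b))
      (linForm b m) = linForm b (P.reflection γ m) := by
  rw [RootPairing.reflection_apply, map_sub, map_smul, linForm_root, linForm_apply, map_sum,
    coroot'_eq_sum b γ m, Finset.sum_smul, ← Finset.sum_sub_distrib]
  refine Finset.sum_congr rfl fun i _ => ?_
  rw [map_mul, polyReflection, aeval_X, ← algebraMap_eq, AlgHom.commutes, Algebra.smul_def]
  simp only [map_mul, map_intCast, algebraMap_eq, MvPolynomial.algebraMap_apply]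
  ring

theorem rootPoly_simple_ne_zero (i : b.support) : rootPoly b (QRing b) i ≠ 0 := by
  classical
  intro h
  have h1 := congrArg (coeff (Finsupp.single i 1)) h
  rw [rootPoly, coeff_sum, Finset.sum_eq_single i] at h1
  · simp [coeff_C_mul] at h1
  · intro j _ hj
    rw [coeff_C_mul, coeff_X, if_neg (by simpa [Finsupp.single_left_inj] using hj), mul_zero]
  · simp

theorem demazure_linForm_mul (i : b.support) (m : M) (f : SymR b) :
    demazure b (QRing b) i (linForm b m * f) = linForm b (simpleReflection b i • m) *
      demazure b (QRing b) i f + C (C (P.coroot' i m)) * f := by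
  have h0 := rootPoly_simple_ne_zero b i
  have h1 := mul_divDiff _ h0 (fun j => (corootCoeff b i j : QRing b)) (linForm b m * f)
  have h2 := mul_divDiff _ h0 (fun j => (corootCoeff b i j : QRing b)) f
  rw [map_mul (polyReflection _ _), polyReflection_linForm] at h1
  refine mul_left_cancel₀ h0 ?_
  rw [demazure, h1, simpleReflection, ofIdx_smul_vec]
  have h3 : linForm b m = linForm b (P.reflection i m) +
      C (C (P.coroot' i m)) * rootPoly b (QRing b) i := by
    rw [RootPairing.reflection_apply, map_sub, map_smul, linForm_root, Algebra.smul_def]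
    exact (sub_add_cancel _ _).symm
  rw [mul_add, mul_left_comm, h2, h3]
  ring

theorem demazure_C (i : b.support) (a : QRing b) : demazure b (QRing b) i (C a) = 0 := by
  have h0 := rootPoly_simple_ne_zero b i
  refine mul_left_cancel₀ h0 ?_
  rw [demazure, mul_divDiff _ h0, polyReflection, ← algebraMap_eq, AlgHom.commutes, sub_self,
    mul_zero]

theorem demazure_mul_mulWeight (i : b.support) (m : M) :
    (demazure b (QRing b) i : Module.End (QRing b) (SymR b)) * mulWeight b m =
      mulWeight b (simpleReflection b i • m) * demazure b (QRing b) i +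
        algebraMap ℂ (Module.End (QRing b) (SymR b)) (P.coroot' i m) := by
  refine LinearMap.ext fun f => ?_
  rw [Module.End.mul_apply, mulWeight_apply, demazure_linForm_mul, LinearMap.add_apply,
    Module.End.mul_apply, mulWeight_apply, Module.algebraMap_end_apply, Algebra.smul_def]
  rfl

variable [P.IsRootSystem] [P.IsReduced]

theorem isNilCoxeter_demazure :
    IsNilCoxeter b (fun i : b.support => demazure b (QRing b) i) := by
  refine isNilCoxeter_of_cyclic (L := mulWeight b) (f := fun γ m => P.coroot' γ m)
    (demazure_mul_mulWeight b) coroot'_smul coroot'_neg 1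
    (fun i => by rw [← map_one C]; exact demazure_C b i 1) fun g h1 h2 => ?_
  refine LinearMap.ext fun f => ?_
  rw [LinearMap.zero_apply]
  induction f using MvPolynomial.induction_on with
  | C a => rw [← mul_one (C a), ← smul_eq_C_mul, map_smul, h1, smul_zero]
  | add p q hp hq => rw [map_add, hp, hq, add_zero]
  | mul_X p i hp =>
    rw [mul_comm, ← linForm_fundWeight, ← mulWeight_apply]
    exact h2 _ _ hp

theorem chevalleyOperator_eq (i : b.support) : chevalleyOperator b i =
    quantumOp b (fun i : b.support => demazure b (QRing b) i) (mulWeight b)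
      (fun γ => algebraMap (QRing b) (Module.End (QRing b) (SymR b)) (qCoroot b γ))
      (fundWeight b i) := by
  classical
  have h : (mulWeight b (fundWeight b i)) = LinearMap.mulLeft (QRing b) (X i) :=
    LinearMap.ext fun f => by
      rw [mulWeight_apply, linForm_fundWeight, LinearMap.mulLeft_apply]
  rw [chevalleyOperator, quantumOp, h]
  congr 1
  rw [← Finset.sum_subtype (Finset.univ.filter (IsSpecial b)) (fun γ => by simp) fun γ : ι =>
    (C (corootCoeff b γ i : ℂ) * qCoroot b γ : QRing b) •
      demazureW b (QRing b) (RootPairing.weylGroup.ofIdx P γ)]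
  refine Finset.sum_congr rfl fun γ _ => ?_
  rw [coroot'_fundWeight, mul_smul, ← algebraMap_eq, algebraMap_smul, Algebra.smul_def (qCoroot b γ)]
  rfl

theorem commute_chevalleyOperator (i j : b.support) :
    Commute (chevalleyOperator b i) (chevalleyOperator b j) := by
  rw [chevalleyOperator_eq, chevalleyOperator_eq]
  refine commute_quantumOp (isNilCoxeter_demazure b) (demazure_mul_mulWeight b) (fun m n => ?_)
    (fun γ x => Algebra.commutes _ _) (fun γ δ ε hγ hδ h => ?_) _ _
  · exact LinearMap.ext fun f => mul_left_comm _ _ _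
  · rw [qCoroot_add b hγ hδ h, map_mul]

/-- A homomorphism that sends the fundamental weights to the Chevalley operators. -/
theorem exists_chevalleyHom : ∃ Φ : SymR b →ₐ[QRing b] Module.End (QRing b) (SymR b),
    ∀ i, Φ (X i) = chevalleyOperator b i :=
  exists_algHom_of_commute (σ := b.support) (R := QRing b)
    (A := Module.End (QRing b) (SymR b)) _ (commute_chevalleyOperator b)

end Symmetric

/-! ### Existence of quantizations -/

section Quantization

variable {ι M N : Type*} [Fintype ι] [AddCommGroup M] [Module ℂ M] [AddCommGroup N] [Module ℂ N]
  {P : RootPairing ι ℂ M N} (b : P.Base)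

/-- The polynomials of degree at most one.  The powers of this submodule are the steps of the degree
filtration. -/
noncomputable def linPolys : Submodule (QRing b) (SymR b) :=
  Submodule.span (QRing b) (insert 1 (Set.range X))

theorem one_le_linPolys : 1 ≤ linPolys b := by
  rw [Submodule.one_le]
  exact Submodule.subset_span (Set.mem_insert _ _)

theorem X_mem_linPolys (i : b.support) : X i ∈ linPolys b :=
  Submodule.subset_span (Set.mem_insert_of_mem _ ⟨i, rfl⟩)

theorem linForm_mem_linPolys (m : M) : linForm b m ∈ linPolys b := by
  rw [linForm_apply]
  refine Submodule.sum_mem _ fun i _ => ?_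
  rw [← smul_eq_C_mul]
  exact Submodule.smul_mem _ _ (X_mem_linPolys b i)

theorem linPolys_pow_le_succ (n : ℕ) : linPolys b ^ n ≤ linPolys b ^ (n + 1) :=
  pow_le_pow_right' (one_le_linPolys b) n.le_succ

theorem exists_mem_linPolys_pow (f : SymR b) : ∃ n, f ∈ linPolys b ^ n := by
  induction f using MvPolynomial.induction_on with
  | C a => exact ⟨0, by rw [pow_zero]; exact Submodule.mem_one.2 ⟨a, rfl⟩⟩
  | add p q hp hq =>
    obtain ⟨m, hm⟩ := hp
    obtain ⟨n, hn⟩ := hq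
    exact ⟨max m n, Submodule.add_mem _
      (pow_le_pow_right' (one_le_linPolys b) (le_max_left m n) hm)
      (pow_le_pow_right' (one_le_linPolys b) (le_max_right m n) hn)⟩
  | mul_X p i hp =>
    obtain ⟨m, hm⟩ := hp
    exact ⟨m + 1, by rw [pow_succ]; exact Submodule.mul_mem_mul hm (X_mem_linPolys b i)⟩

/-- Induction along the degree filtration. -/
theorem linPolys_pow_induction {p : SymR b → Prop} {n : ℕ} (hn : ∀ y ∈ linPolys b ^ n, p y)
    (hX : ∀ i, ∀ y ∈ linPolys b ^ n, p (X i * y)) (hadd : ∀ x y, p x → p y → p (x + y))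
    {f : SymR b} (hf : f ∈ linPolys b ^ (n + 1)) : p f := by
  rw [pow_succ'] at hf
  refine Submodule.mul_induction_on hf (fun x hx y hy => ?_) hadd
  have h0 : p 0 := hn 0 (Submodule.zero_mem _)
  induction hx using Submodule.span_induction generalizing y with
  | mem x hx =>
    rcases hx with rfl | ⟨i, rfl⟩
    · rw [one_mul]; exact hn y hy
    · exact hX i y hy
  | zero => rw [zero_mul]; exact h0
  | add x z _ _ hx hz => rw [add_mul]; exact hadd _ _ (hx y hy) (hz y hy)
  | smul a x _ hx =>
    rw [smul_mul_assoc, ← mul_smul_comm]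
    exact hx _ (Submodule.smul_mem _ _ hy)

variable [P.IsRootSystem] [P.IsCrystallographic] [P.IsReduced]

theorem demazure_mem_linPolys_pow (i : b.support) (n : ℕ) :
    ∀ f ∈ linPolys b ^ n, demazure b (QRing b) i f ∈ linPolys b ^ n := by
  induction n with
  | zero =>
    intro f hf
    rw [pow_zero] at hf
    obtain ⟨a, rfl⟩ := Submodule.mem_one.1 hf
    rw [algebraMap_eq, demazure_C]
    exact Submodule.zero_mem _
  | succ n ih =>
    intro f hf
    refine linPolys_pow_induction b (fun y hy => linPolys_pow_le_succ b n (ih y hy))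
      (fun j y hy => ?_) (fun x y hx hy => by rw [map_add]; exact Submodule.add_mem _ hx hy) hf
    rw [← linForm_fundWeight, demazure_linForm_mul]
    refine Submodule.add_mem _ ?_ ?_
    · rw [pow_succ']
      exact Submodule.mul_mem_mul (linForm_mem_linPolys b _) (ih y hy)
    · rw [← smul_eq_C_mul]
      exact Submodule.smul_mem _ _ (linPolys_pow_le_succ b n hy)

theorem demazureW_mem_linPolys_pow (w : P.weylGroup) {n : ℕ} {f : SymR b}
    (hf : f ∈ linPolys b ^ n) : demazureW b (QRing b) w f ∈ linPolys b ^ n := by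
  rw [demazureW]
  induction reducedWord (simpleReflection b) w with
  | nil => exact hf
  | cons i l ih =>
    rw [List.map_cons, List.prod_cons]
    exact demazure_mem_linPolys_pow b i n _ ih

/-- Evaluation at `1` is surjective on polynomials in the Chevalley operators, because these
operators differ from the multiplications by the fundamental weights in lower degree terms only. -/
theorem exists_apply_one_eq {Φ : SymR b →ₐ[QRing b] Module.End (QRing b) (SymR b)}
    (hΦ : ∀ i, Φ (X i) = chevalleyOperator b i) (f : SymR b) : ∃ F, Φ F 1 = f := by
  obtain ⟨n, hf⟩ := exists_mem_linPolys_pow b f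
  have hadd : ∀ x y : SymR b, (∃ F, Φ F 1 = x) → (∃ F, Φ F 1 = y) → ∃ F, Φ F 1 = x + y := by
    rintro _ _ ⟨F, rfl⟩ ⟨G, rfl⟩
    exact ⟨F + G, by rw [map_add, LinearMap.add_apply]⟩
  induction n generalizing f with
  | zero =>
    rw [pow_zero] at hf
    obtain ⟨a, rfl⟩ := Submodule.mem_one.1 hf
    exact ⟨C a, by rw [← algebraMap_eq, AlgHom.commutes, Module.algebraMap_end_apply,
      Algebra.smul_def, mul_one]⟩
  | succ n ih =>
    refine linPolys_pow_induction b ih (fun i y hy => ?_) hadd hf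
    obtain ⟨F, hF⟩ := ih y hy
    obtain ⟨G, hG⟩ := ih (-((chevalleyOperator b i - LinearMap.mulLeft (QRing b) (X i) :
      Module.End (QRing b) (SymR b)) y)) (by
      refine Submodule.neg_mem _ ?_
      rw [chevalleyOperator, LinearMap.sub_apply, LinearMap.add_apply, add_sub_cancel_left,
        LinearMap.sum_apply]
      exact Submodule.sum_mem _ fun γ _ =>
        Submodule.smul_mem _ _ (demazureW_mem_linPolys_pow b _ hy))
    refine ⟨X i * F + G, ?_⟩
    rw [map_add, map_mul, LinearMap.add_apply, Module.End.mul_apply, hF, hG, hΦ,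
      LinearMap.sub_apply, LinearMap.mulLeft_apply]
    ring

end Quantization

/-! ### Commuting elements and nil-Coxeter operators in the Nichols algebra -/

section NicholsElements

variable {ι M N : Type*} [Fintype ι] [AddCommGroup M] [Module ℂ M] [AddCommGroup N] [Module ℂ N]
  {P : RootPairing ι ℂ M N} (b : P.Base) (c : ι → ℂ)

open Classical in
/-- The element `∑_{γ > 0} c_γ ⟨m, γ^∨⟩ [γ]` of the tensor algebra. -/
noncomputable def weightT : M →ₗ[ℂ] TensorV b :=
  ∑ γ : PosRoot b, (c γ • P.coroot' γ).smulRight (bracket b γ)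

open Classical in
theorem weightT_apply (m : M) :
    weightT b c m = ∑ γ : PosRoot b, (c γ * P.coroot' γ m) • bracket b γ := by
  simp [weightT]

/-- The sum that defines `weightT`, written symmetrically over all roots. -/
theorem weightT_eq_sum (hneg : ∀ γ, c (P.reflectionPerm γ γ) = c γ) (m : M) :
    weightT b c m = ∑ γ, (c γ * P.coroot' γ m / 2) • bracket b γ := by
  classical
  rw [← Finset.sum_filter_add_sum_filter_not Finset.univ (fun γ => b.IsPos γ)]
  have h : ∑ γ with ¬ b.IsPos γ, (c γ * P.coroot' γ m / 2) • bracket b γ =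
      ∑ γ with b.IsPos γ, (c γ * P.coroot' γ m / 2) • bracket b γ := by
    refine Finset.sum_nbij' (fun γ => P.reflectionPerm γ γ) (fun γ => P.reflectionPerm γ γ)
      ?_ ?_ ?_ ?_ ?_
    · intro γ; simp [isPos_neg_iff]
    · intro γ; simp [isPos_neg_iff]
    · intro γ _; exact neg_neg_idx γ
    · intro γ _; exact neg_neg_idx γ
    · intro γ _
      rw [hneg, coroot'_neg, bracket_neg, smul_neg, ← neg_smul]
      congr 1
      ring
  rw [h, ← Finset.sum_add_distrib, weightT_apply,
    ← Finset.sum_subtype (Finset.univ.filter fun γ => b.IsPos γ) (fun γ => by simp)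
      fun γ : ι => (c γ * P.coroot' γ m) • bracket b γ]
  refine Finset.sum_congr rfl fun γ _ => ?_
  rw [← add_smul, add_halves]

variable {c} (hcW : ∀ (w : P.weylGroup) (γ : ι), c (w • γ) = c γ)
include hcW

theorem reflT_weightT (β : ι) (m : M) :
    reflT b β (weightT b c m) = weightT b c (P.reflection β m) := by
  have hneg : ∀ γ, c (P.reflectionPerm γ γ) = c γ := fun γ => by rw [← ofIdx_smul_idx, hcW]
  rw [weightT_eq_sum b c hneg, weightT_eq_sum b c hneg, map_sum,
    ← Equiv.sum_comp (P.reflectionPerm β) fun γ : ι =>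
      (c γ * P.coroot' γ (P.reflection β m) / 2) • bracket b γ]
  refine Finset.sum_congr rfl fun γ _ => ?_
  rw [map_smul, reflT_bracket]
  rw [← ofIdx_smul_idx, hcW, ← ofIdx_smul_vec, coroot'_smul]

omit hcW in
theorem rightDer_weightT_mul (α : PosRoot b) (m : M) (x : TensorV b) :
    rightDer b α (weightT b c m * x) =
      weightT b c m * rightDer b α x + (c α * P.coroot' α m) • reflT b α x := by
  classical
  rw [weightT_apply, Finset.sum_mul, map_sum, Finset.sum_mul]
  have h : ∀ γ : PosRoot b, rightDer b α ((c γ * P.coroot' γ m) • bracket b γ * x) =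
      (c γ * P.coroot' γ m) • bracket b γ * rightDer b α x +
        if γ = α then (c γ * P.coroot' γ m) • reflT b γ x else 0 := by
    intro γ
    rw [bracket_pos, smul_mul_assoc, map_smul, rightDer_ι_mul, smul_add, smul_mul_assoc]
    split_ifs <;> simp
  rw [Finset.sum_congr rfl fun γ _ => h γ, Finset.sum_add_distrib, Finset.sum_ite_eq' Finset.univ α,
    if_pos (Finset.mem_univ _)]

/-- All right derivatives of the two products agree. -/
theorem nicholsRel_weightT_mul_comm (m n : M) :
    nicholsRel b (weightT b c m * weightT b c n) (weightT b c n * weightT b c m) := by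
  have h1 : ∀ (α : PosRoot b) (m : M),
      rightDer b α (weightT b c m) = (c α * P.coroot' α m) • 1 := by
    intro α m
    have := rightDer_weightT_mul b (c := c) α m 1
    rwa [mul_one, rightDer_one, mul_zero, zero_add, map_one] at this
  have h2 : ∀ (α : PosRoot b), rightDer b α (weightT b c m * weightT b c n) =
      rightDer b α (weightT b c n * weightT b c m) := by
    intro α
    rw [rightDer_weightT_mul, rightDer_weightT_mul, h1, h1, reflT_weightT b hcW,
      reflT_weightT b hcW, RootPairing.reflection_apply, RootPairing.reflection_apply, map_sub,
      map_sub, map_smul, map_smul, mul_smul_one, mul_smul_one]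
    module
  intro ξ
  induction ξ using word_induction with
  | h1 =>
    rw [dualityPairing_one, dualityPairing_one]
    simp only [counit, AlgHom.toLinearMap_apply, map_mul, mul_comm]
  | hadd x y hx hy => rw [map_add, LinearMap.add_apply, LinearMap.add_apply, hx, hy]
  | hsmul a x hx => rw [map_smul, LinearMap.smul_apply, LinearMap.smul_apply, hx]
  | hmul α ξ _ => rw [dualityPairing_ι_mul, dualityPairing_ι_mul, h2]

omit hcW

/-- The values of `D_α` on `[δ]` for all roots `δ`, where `[-δ] = -[δ]`. -/
theorem twistedDer_toNichols_bracket (α : PosRoot b) (δ : ι) [Decidable (δ = α)]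
    [Decidable (δ = P.reflectionPerm α α)] : twistedDer b α (toNichols b (bracket b δ)) =
      algebraMap ℂ _ ((if δ = α then 1 else 0) - if δ = P.reflectionPerm α α then 1 else 0) := by
  classical
  have h3 : ¬ b.IsPos (P.reflectionPerm α.1 α.1) := fun h => (isPos_neg_iff b α.1).1 h α.2
  by_cases hδ : b.IsPos δ
  · have h1 := twistedDer_bracket b α ⟨δ, hδ⟩
    have h2 : δ ≠ P.reflectionPerm α α := fun h => h3 (h ▸ hδ)
    simp only at h1
    rw [h1, if_neg h2, sub_zero]
    simp only [Subtype.ext_iff, eq_comm]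
    split_ifs <;> simp
  · have h1 := twistedDer_bracket b α ⟨P.reflectionPerm δ δ, (isPos_neg_iff b δ).2 hδ⟩
    have h2 : δ ≠ α := fun h => hδ (h ▸ α.2)
    simp only [bracket_neg, map_neg, Subtype.ext_iff] at h1
    rw [eq_comm (a := α.1), neg_eq_iff] at h1
    rw [if_neg h2, zero_sub, map_neg, ← neg_eq_iff_eq_neg, h1]
    split_ifs <;> simp

theorem twistedDer_one (α : PosRoot b) : twistedDer b α 1 = 0 := by
  have h := twistedDer_mul b α 1 1
  rw [mul_one, mul_one, map_one (reflB b α.1), one_mul] at h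
  exact left_eq_add.1 h

/-- The operator `c_i⁻¹ D_i` on the Nichols algebra, for a simple root `α_i`. -/
noncomputable def scaledDer (c : ι → ℂ) (i : b.support) : Module.End ℂ (Nichols b) :=
  (c i)⁻¹ • twistedDer b ⟨i, b.isPos_of_mem_support i.2⟩

/-- Left multiplication by `∑_{γ > 0} c_γ ⟨m, γ^∨⟩ [γ]` on the Nichols algebra. -/
noncomputable def weightB (c : ι → ℂ) : M →ₗ[ℂ] Module.End ℂ (Nichols b) :=
  LinearMap.mul ℂ (Nichols b) ∘ₗ (toNichols b).toLinearMap ∘ₗ weightT b c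

theorem weightB_apply (m : M) (x : Nichols b) :
    weightB b c m x = toNichols b (weightT b c m) * x := rfl

theorem prod_map_scaledDer (l : List b.support) : (l.map (scaledDer b c)).prod =
    ((l.map fun i : b.support => c i).prod)⁻¹ •
      (l.map fun i : b.support => twistedDer b ⟨i, b.isPos_of_mem_support i.2⟩).prod := by
  induction l with
  | nil => simp
  | cons i l ih =>
    simp only [List.map_cons, List.prod_cons, ih, scaledDer, smul_mul_smul_comm, mul_inv]

theorem wordOp_scaledDer (w : P.weylGroup) : wordOp b (scaledDer b c) w =
    (((reducedWord (simpleReflection b) w).map fun i : b.support => c i).prod)⁻¹ •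
      twistedDerW b w := prod_map_scaledDer b _

variable (hc : ∀ γ, c γ ≠ 0)
include hcW

theorem commute_weightB (m n : M) : Commute (weightB b c m) (weightB b c n) :=
  LinearMap.ext fun x => by
    rw [Module.End.mul_apply, Module.End.mul_apply, weightB_apply, weightB_apply, weightB_apply,
      weightB_apply, ← mul_assoc, ← mul_assoc, ← map_mul (toNichols b),
      ← map_mul (toNichols b),
      toNichols_eq b (nicholsRel_weightT_mul_comm b hcW m n)]

include hc

theorem scaledDer_mul_weightB (i : b.support) (m : M) :
    scaledDer b c i * weightB b c m = weightB b c (simpleReflection b i • m) * scaledDer b c i +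
      algebraMap ℂ (Module.End ℂ (Nichols b)) (P.coroot' i m) := by
  classical
  refine LinearMap.ext fun x => ?_
  have h1 : twistedDer b ⟨i, b.isPos_of_mem_support i.2⟩ (toNichols b (weightT b c m)) =
      algebraMap ℂ _ (c i * P.coroot' i m) := by
    rw [weightT_apply, map_sum, map_sum]
    simp only [map_smul, twistedDer_bracket]
    rw [Finset.sum_eq_single ⟨i, b.isPos_of_mem_support i.2⟩]
    · rw [if_pos rfl, Algebra.algebraMap_eq_smul_one]
    · intro γ _ hγ
      rw [if_neg hγ.symm, smul_zero]
    · simp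
  simp only [Module.End.mul_apply, LinearMap.add_apply, scaledDer, LinearMap.smul_apply,
    weightB_apply, twistedDer_mul, h1, Module.algebraMap_end_apply, reflB_toNichols]
  rw [reflT_weightT b hcW, smul_add, simpleReflection, ofIdx_smul_vec, mul_smul_comm, add_comm,
    ← Algebra.smul_def, smul_smul, inv_mul_cancel_left₀ (hc i)]

theorem isNilCoxeter_scaledDer [P.IsCrystallographic] [P.IsReduced] :
    IsNilCoxeter b (scaledDer b c) := by
  classical
  have hneg : ∀ γ, c (P.reflectionPerm γ γ) = c γ := fun γ => by rw [← ofIdx_smul_idx, hcW]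
  refine isNilCoxeter_of_cyclic (V := ι)
    (L := fun γ => LinearMap.mulLeft ℂ (toNichols b (bracket b γ)))
    (f := fun γ δ => (c γ)⁻¹ * ((if δ = γ then 1 else 0) -
      if δ = P.reflectionPerm γ γ then 1 else 0)) (fun i δ => LinearMap.ext fun x => ?_)
    (fun w γ δ => ?_) (fun γ δ => ?_) 1 (fun i => ?_) fun g h1 h2 => ?_
  · simp only [Module.End.mul_apply, LinearMap.add_apply, scaledDer, LinearMap.smul_apply,
      LinearMap.mulLeft_apply, twistedDer_mul, Module.algebraMap_end_apply, reflB_toNichols,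
      twistedDer_toNichols_bracket, reflT_bracket]
    rw [smul_add, ← Algebra.smul_def, smul_smul, add_comm, mul_smul_comm]
    rfl
  · rw [hcW, ← smul_neg_idx]
    simp only [smul_left_cancel_iff]
  · rw [hneg, neg_neg_idx]
    ring
  · rw [scaledDer, LinearMap.smul_apply, twistedDer_one, smul_zero]
  · refine LinearMap.ext fun x => ?_
    obtain ⟨x, rfl⟩ := RingQuot.mkAlgHom_surjective ℂ (nicholsRel b) x
    change g (toNichols b x) = 0
    induction x using word_induction with
    | h1 => rw [map_one]; exact h1
    | hadd x y hx hy => rw [map_add, map_add, hx, hy, add_zero]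
    | hsmul a x hx => rw [map_smul, map_smul, hx, smul_zero]
    | hmul β x hx =>
      rw [← bracket_pos, map_mul]
      exact h2 β _ hx

end NicholsElements

/-! ### Extension of scalars and the comparison of the two sides -/

section Comparison

variable {ι M N : Type*} [Fintype ι] [AddCommGroup M] [Module ℂ M] [AddCommGroup N] [Module ℂ N]
  {P : RootPairing ι ℂ M N} (b : P.Base)

theorem wordOp_map {E E' : Type*} [Ring E] [Algebra ℂ E] [Ring E'] [Algebra ℂ E']
    (φ : E →ₐ[ℂ] E') (T : b.support → E) (w : P.weylGroup) :
    wordOp b (fun i => φ (T i)) w = φ (wordOp b T w) := by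
  rw [wordOp, wordOp, map_list_prod, List.map_map]
  rfl

theorem IsNilCoxeter.map {E E' : Type*} [Ring E] [Algebra ℂ E] [Ring E'] [Algebra ℂ E']
    (φ : E →ₐ[ℂ] E') {T : b.support → E} (hT : IsNilCoxeter b T) :
    IsNilCoxeter b fun i => φ (T i) := fun l => by
  have h := congrArg φ (hT l)
  rw [map_list_prod, List.map_map] at h
  rw [wordOp_map, ← map_zero φ, ← apply_ite φ]
  exact h

/-- Extension of scalars from `ℂ` to `R`, on operators. -/
noncomputable def extendScalars :
    Module.End ℂ (Nichols b) →ₐ[ℂ] Module.End (QRing b) (NicholsR b) :=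
  Module.End.baseChangeHom ℂ (QRing b) (Nichols b)

theorem extendScalars_apply (f : Module.End ℂ (Nichols b)) :
    extendScalars b f = f.baseChange (QRing b) := rfl

theorem extendScalars_mulLeft (x : Nichols b) :
    extendScalars b (LinearMap.mulLeft ℂ x) =
      LinearMap.mulLeft (QRing b) ((1 : QRing b) ⊗ₜ[ℂ] x) := by
  refine LinearMap.ext fun y => ?_
  induction y using TensorProduct.induction_on with
  | zero => simp
  | add y z hy hz => rw [map_add, map_add, hy, hz]
  | tmul a y => simp [extendScalars_apply]

variable (c : ι → ℂ)

/-- The operator `c_i⁻¹ D_i` on `B_R(V)`. -/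
noncomputable def scaledDerR (i : b.support) : Module.End (QRing b) (NicholsR b) :=
  extendScalars b (scaledDer b c i)

/-- Left multiplication by `∑_{γ > 0} c_γ ⟨m, γ^∨⟩ [γ]` on `B_R(V)`. -/
noncomputable def weightR : M →ₗ[ℂ] Module.End (QRing b) (NicholsR b) :=
  (extendScalars b).toLinearMap ∘ₗ weightB b c

theorem weightR_eq_mulLeft (m : M) : weightR b c m =
    LinearMap.mulLeft (QRing b) ((1 : QRing b) ⊗ₜ[ℂ] toNichols b (weightT b c m)) :=
  extendScalars_mulLeft b _

theorem weightR_fundWeight [P.IsRootSystem] (i : b.support) :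
    weightR b c (fundWeight b i) = LinearMap.mulLeft (QRing b) (classicalElement b c i) := by
  classical
  rw [weightR_eq_mulLeft]
  congr 1
  rw [weightT_apply, map_sum, TensorProduct.tmul_sum, classicalElement]
  refine Finset.sum_congr rfl fun γ _ => ?_
  rw [map_smul, TensorProduct.tmul_smul, coroot'_fundWeight, ← algebraMap_eq, algebraMap_smul]
  rfl

theorem quantizedElement_eq [P.IsRootSystem] (i : b.support) : quantizedElement b c i =
    quantumOp b (scaledDerR b c) (weightR b c)
      (fun γ => algebraMap (QRing b) (Module.End (QRing b) (NicholsR b)) (qCoroot b γ))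
      (fundWeight b i) := by
  classical
  rw [quantumOp, weightR_fundWeight, quantizedElement]
  simp only [quantizedBracket, smul_add, Finset.sum_add_distrib]
  congr 1
  · refine LinearMap.ext fun x => ?_
    rw [LinearMap.sum_apply, LinearMap.mulLeft_apply, classicalElement, Finset.sum_mul]
    refine Finset.sum_congr rfl fun γ _ => ?_
    rw [LinearMap.smul_apply, LinearMap.smul_apply, LinearMap.mulLeft_apply, smul_mul_assoc,
      smul_smul, ← C_mul, mul_comm]
  · rw [← Finset.sum_subtype (Finset.univ.filter fun γ => b.IsPos γ) (fun γ => by simp)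
      fun γ : ι => (C (corootCoeff b γ i : ℂ) : QRing b) • if IsSpecial b γ then
      (C ((reducedWord (simpleReflection b) (RootPairing.weylGroup.ofIdx P γ)).map
          fun i : b.support => c i).prod⁻¹ * qCoroot b γ : QRing b) •
        (twistedDerW b (RootPairing.weylGroup.ofIdx P γ)).baseChange (QRing b)
      else 0]
    simp only [smul_ite, smul_zero]
    rw [← Finset.sum_filter, Finset.filter_filter]
    refine Finset.sum_congr (Finset.filter_congr fun γ _ => ⟨fun h => h.2, fun h => ⟨h.1, h⟩⟩)
      fun γ _ => ?_
    have h : wordOp b (scaledDerR b c) (RootPairing.weylGroup.ofIdx P γ) =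
        (((reducedWord (simpleReflection b) (RootPairing.weylGroup.ofIdx P γ)).map
          fun i : b.support => c i).prod)⁻¹ •
        (twistedDerW b (RootPairing.weylGroup.ofIdx P γ)).baseChange (QRing b) := by
      rw [← extendScalars_apply, ← map_smul, ← wordOp_scaledDer]
      exact wordOp_map b (E := Module.End ℂ (Nichols b))
        (E' := Module.End (QRing b) (NicholsR b)) (extendScalars b) _ _
    rw [h, coroot'_fundWeight, ← algebraMap_eq, algebraMap_smul, mul_comm (algebraMap _ _ _),
      mul_smul, algebraMap_smul, Algebra.smul_def (qCoroot b γ)]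

variable {c} (hcW : ∀ (w : P.weylGroup) (γ : ι), c (w • γ) = c γ) (hc : ∀ γ, c γ ≠ 0)
include hcW

theorem commute_weightR (m n : M) : Commute (weightR b c m) (weightR b c n) :=
  (commute_weightB b hcW m n).map (extendScalars b)

theorem commute_classicalElement [P.IsRootSystem] (i j : b.support) :
    Commute (classicalElement b c i) (classicalElement b c j) := by
  rw [commute_iff_eq]
  have h := commute_weightR b hcW (fundWeight b i) (fundWeight b j)
  rw [weightR_fundWeight, weightR_fundWeight] at h
  have h1 := LinearMap.congr_fun h.eq 1
  simpa using h1

include hc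

theorem scaledDerR_mul_weightR (i : b.support) (m : M) :
    scaledDerR b c i * weightR b c m = weightR b c (simpleReflection b i • m) * scaledDerR b c i +
      algebraMap ℂ (Module.End (QRing b) (NicholsR b)) (P.coroot' i m) := by
  have h := congrArg (extendScalars b) (scaledDer_mul_weightB b hcW hc i m)
  rwa [map_mul, map_add, map_mul, AlgHom.commutes] at h

variable [P.IsCrystallographic] [P.IsReduced] [P.IsRootSystem]

theorem isNilCoxeter_scaledDerR : IsNilCoxeter b (scaledDerR b c) :=
  IsNilCoxeter.map b (E := Module.End ℂ (Nichols b)) (E' := Module.End (QRing b) (NicholsR b))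
    (extendScalars b) (isNilCoxeter_scaledDer b hcW hc)

theorem commute_quantizedElement (i j : b.support) :
    Commute (quantizedElement b c i) (quantizedElement b c j) := by
  rw [quantizedElement_eq, quantizedElement_eq]
  refine commute_quantumOp (isNilCoxeter_scaledDerR b hcW hc) (scaledDerR_mul_weightR b hcW hc)
    (commute_weightR b hcW) (fun γ x => Algebra.commutes _ _) (fun γ δ ε hγ hδ h => ?_) _ _
  rw [qCoroot_add b hγ hδ h, map_mul]

variable {μ : SymR b →ₐ[QRing b] NicholsR b} (hμ : ∀ i, μ (X i) = classicalElement b c i)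
include hμ

omit hcW hc in
theorem map_linForm_mul (m : M) (f : SymR b) : μ (linForm b m * f) = weightR b c m (μ f) := by
  classical
  have h : weightT b c m = ∑ i : b.support, P.coroot' i m • weightT b c (fundWeight b i) := by
    simp only [weightT_apply, Finset.smul_sum]
    rw [Finset.sum_comm]
    refine Finset.sum_congr rfl fun γ _ => ?_
    rw [coroot'_eq_sum b γ m, Finset.mul_sum, Finset.sum_smul]
    refine Finset.sum_congr rfl fun i _ => ?_
    rw [coroot'_fundWeight, smul_smul]
    congr 1
    ring
  have h1 : weightR b c m = ∑ i : b.support, P.coroot' i m • weightR b c (fundWeight b i) := by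
    change (extendScalars b) (LinearMap.mul ℂ (Nichols b) (toNichols b (weightT b c m))) = _
    rw [h]
    simp only [map_sum, map_smul]
    rfl
  rw [h1, LinearMap.sum_apply, linForm_apply, Finset.sum_mul, map_sum]
  refine Finset.sum_congr rfl fun i _ => ?_
  rw [map_mul μ, map_mul μ, hμ, LinearMap.smul_apply, weightR_fundWeight, LinearMap.mulLeft_apply,
    show μ (C (C (P.coroot' i m))) = algebraMap (QRing b) _ (C (P.coroot' i m)) from μ.commutes _,
    mul_assoc, ← Algebra.smul_def, ← algebraMap_eq, algebraMap_smul]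

/-- The classical homomorphism intertwines Demazure operators and twisted derivations. -/
theorem map_demazure (i : b.support) (f : SymR b) :
    μ (demazure b (QRing b) i f) = scaledDerR b c i (μ f) := by
  induction f using MvPolynomial.induction_on with
  | C a =>
    have h : scaledDerR b c i 1 = 0 := by
      rw [scaledDerR, extendScalars_apply, Algebra.TensorProduct.one_def,
        LinearMap.baseChange_tmul, scaledDer, LinearMap.smul_apply, twistedDer_one, smul_zero,
        TensorProduct.tmul_zero]
    rw [demazure_C, map_zero, ← algebraMap_eq, AlgHom.commutes, Algebra.algebraMap_eq_smul_one,
      map_smul, h, smul_zero]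
  | add p q hp hq => rw [map_add, map_add, map_add, map_add, hp, hq]
  | mul_X p j hp =>
    have h := LinearMap.congr_fun (scaledDerR_mul_weightR b hcW hc i (fundWeight b j)) (μ p)
    rw [Module.End.mul_apply, LinearMap.add_apply, Module.End.mul_apply,
      Module.algebraMap_end_apply] at h
    rw [mul_comm, ← linForm_fundWeight, map_linForm_mul b hμ, h, demazure_linForm_mul, map_add μ,
      map_linForm_mul b hμ, hp, ← smul_eq_C_mul, map_smul μ, ← algebraMap_eq, algebraMap_smul]

theorem map_demazureW (w : P.weylGroup) (f : SymR b) :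
    μ (demazureW b (QRing b) w f) = wordOp b (scaledDerR b c) w (μ f) := by
  rw [demazureW, wordOp]
  induction reducedWord (simpleReflection b) w with
  | nil => rfl
  | cons i l ih =>
    rw [List.map_cons, List.prod_cons, List.map_cons, List.prod_cons, Module.End.mul_apply,
      Module.End.mul_apply, map_demazure b hcW hc hμ, ih]

theorem map_chevalleyOperator (i : b.support) (f : SymR b) :
    μ (chevalleyOperator b i f) = quantizedElement b c i (μ f) := by
  classical
  rw [chevalleyOperator_eq, quantizedElement_eq, quantumOp, quantumOp, LinearMap.add_apply,
    LinearMap.add_apply, map_add, mulWeight_apply, map_linForm_mul b hμ, LinearMap.sum_apply,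
    LinearMap.sum_apply, map_sum]
  congr 1
  refine Finset.sum_congr rfl fun γ _ => ?_
  have h := map_demazureW b hcW hc hμ (RootPairing.weylGroup.ofIdx P γ) f
  rw [LinearMap.smul_apply, LinearMap.smul_apply, Module.End.mul_apply, Module.End.mul_apply,
    Module.algebraMap_end_apply, Module.algebraMap_end_apply, ← h,
    ← algebraMap_smul (QRing b) (P.coroot' γ _) (_ : SymR b),
    ← algebraMap_smul (QRing b) (P.coroot' γ _) (_ : NicholsR b), map_smul μ, map_smul μ]
  rfl

/-- The classical homomorphism turns polynomials in the Chevalley operators into the same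
polynomials in the quantized elements. -/
theorem map_apply_one {μq : SymR b →ₐ[QRing b] Module.End (QRing b) (NicholsR b)}
    (hμq : ∀ i, μq (X i) = quantizedElement b c i)
    {Φ : SymR b →ₐ[QRing b] Module.End (QRing b) (SymR b)}
    (hΦ : ∀ i, Φ (X i) = chevalleyOperator b i) (F : SymR b) : μq F 1 = μ (Φ F 1) := by
  suffices h : ∀ f, μ (Φ F f) = μq F (μ f) by rw [h, map_one μ]
  induction F using MvPolynomial.induction_on with
  | C a =>
    intro f
    rw [← algebraMap_eq, AlgHom.commutes, AlgHom.commutes, Module.algebraMap_end_apply,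
      Module.algebraMap_end_apply, map_smul]
  | add p q hp hq =>
    intro f
    rw [map_add, map_add, LinearMap.add_apply, LinearMap.add_apply, map_add, hp, hq]
  | mul_X p i hp =>
    intro f
    rw [map_mul, map_mul, Module.End.mul_apply, Module.End.mul_apply, hp, hΦ, hμq,
      map_chevalleyOperator b hcW hc hμ]

end Comparison

/-! ### Elementary symmetric polynomials and their quantum analogues -/

section Elementary

/-- The tridiagonal matrix with diagonal `d`, superdiagonal `u` and subdiagonal `l`. -/
def tridiagonal {R : Type*} [Zero R] (d u l : ℕ → R) (k : ℕ) : Matrix (Fin k) (Fin k) R :=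
  Matrix.of fun r s => if r = s then d r else if (r : ℕ) + 1 = s then u r
    else if (s : ℕ) + 1 = r then l s else 0

theorem det_tridiagonal_succ_succ {R : Type*} [CommRing R] (d u l : ℕ → R) (k : ℕ) :
    (tridiagonal d u l (k + 2)).det = d (k + 1) * (tridiagonal d u l (k + 1)).det -
      u k * l k * (tridiagonal d u l k).det := by
  have h1 : (tridiagonal d u l (k + 2)).submatrix Fin.castSucc Fin.castSucc =
      tridiagonal d u l (k + 1) := by
    ext i j
    simp [tridiagonal]
  have h2 : ((tridiagonal d u l (k + 2)).submatrix Fin.castSucc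
      (Fin.last k).castSucc.succAbove).det = u k * (tridiagonal d u l k).det := by
    rw [Matrix.det_succ_column _ (Fin.last k), Fin.sum_univ_castSucc, Finset.sum_eq_zero, zero_add]
    · have h3 : (((tridiagonal d u l (k + 2)).submatrix Fin.castSucc
          (Fin.last k).castSucc.succAbove).submatrix (Fin.last k).succAbove
          (Fin.last k).succAbove) = tridiagonal d u l k := by
        ext i j
        simp [tridiagonal, Fin.succAbove, Fin.ext_iff]
      rw [h3]
      simp [tridiagonal, Fin.succAbove, Fin.ext_iff]
    · intro i _
      have := i.2
      have h4 : (tridiagonal d u l (k + 2)).submatrix Fin.castSucc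
          (Fin.last k).castSucc.succAbove i.castSucc (Fin.last k) = 0 := by
        simp only [tridiagonal, Matrix.submatrix_apply, Matrix.of_apply, Fin.succAbove,
          Fin.ext_iff, Fin.val_castSucc, Fin.val_last, lt_irrefl, if_false,
          Fin.val_succ]
        rw [if_neg (by omega), if_neg (by omega), if_neg (by omega)]
      rw [h4, mul_zero, zero_mul]
  rw [Matrix.det_succ_row _ (Fin.last (k + 1)), Fin.sum_univ_castSucc, Fin.sum_univ_castSucc,
    Finset.sum_eq_zero, zero_add]
  · simp only [Fin.succAbove_last]
    rw [h1, h2]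
    simp only [tridiagonal, Matrix.of_apply, Fin.ext_iff, Fin.val_castSucc, Fin.val_last]
    rw [if_neg (by omega), if_neg (by omega)]
    simp only [if_true]
    rw [show k + 1 + k = 2 * k + 1 by ring, show k + 1 + (k + 1) = 2 * (k + 1) by ring, pow_succ,
      pow_mul, pow_mul]
    simp
    ring
  · intro i _
    have := i.2
    have h4 : tridiagonal d u l (k + 2) (Fin.last (k + 1)) i.castSucc.castSucc = 0 := by
      simp only [tridiagonal, Matrix.of_apply, Fin.ext_iff, Fin.val_castSucc, Fin.val_last]
      rw [if_neg (by omega), if_neg (by omega), if_neg (by omega)]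
    rw [h4, mul_zero, zero_mul]

variable {A : Type*} [CommRing A] (x q : ℕ → A)

/-- The generating polynomial `det (1 + λ G_k)` of the quantum elementary polynomials. -/
noncomputable def quantumDet (k : ℕ) : Polynomial A :=
  (tridiagonal (fun r => 1 + Polynomial.X * Polynomial.C (x r))
    (fun r => Polynomial.X * Polynomial.C (q r)) (fun _ => -Polynomial.X) k).det

theorem quantumElementary_eq_coeff (k i : ℕ) :
    quantumElementary x q k i = (quantumDet x q k).coeff i := by
  rw [quantumElementary, quantumDet]
  congr 2
  ext1 r s
  simp only [tridiagonal, Matrix.add_apply, Matrix.smul_apply, Matrix.of_apply, Matrix.one_apply,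
    smul_eq_mul]
  split_ifs <;> simp

theorem quantumDet_zero : quantumDet x q 0 = 1 := by simp [quantumDet]

theorem quantumDet_one : quantumDet x q 1 = 1 + Polynomial.X * Polynomial.C (x 0) := by
  simp [quantumDet, tridiagonal]

theorem quantumDet_succ_succ (k : ℕ) : quantumDet x q (k + 2) =
    (1 + Polynomial.X * Polynomial.C (x (k + 1))) * quantumDet x q (k + 1) +
      Polynomial.X * (Polynomial.X * (Polynomial.C (q k) * quantumDet x q k)) := by
  rw [quantumDet, det_tridiagonal_succ_succ]
  simp only [quantumDet]
  ring

theorem quantumDet_map {B : Type*} [CommRing B] (φ : A →+* B) (k : ℕ) :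
    (quantumDet x q k).map φ = quantumDet (fun j => φ (x j)) (fun j => φ (q j)) k := by
  induction k using Nat.twoStepInduction with
  | zero => simp [quantumDet_zero]
  | one => simp [quantumDet_one]
  | more k h1 h2 => simp [quantumDet_succ_succ, h1, h2]

theorem map_quantumElementary {B : Type*} [CommRing B] (φ : A →+* B) (k i : ℕ) :
    φ (quantumElementary x q k i) =
      quantumElementary (fun j => φ (x j)) (fun j => φ (q j)) k i := by
  rw [quantumElementary_eq_coeff, quantumElementary_eq_coeff, ← quantumDet_map,
    Polynomial.coeff_map]

theorem quantumElementary_zero (k : ℕ) : quantumElementary x q k 0 = 1 := by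
  rw [quantumElementary_eq_coeff]
  induction k using Nat.twoStepInduction with
  | zero => simp [quantumDet_zero]
  | one => simp [quantumDet_one]
  | more k h1 h2 => simp [quantumDet_succ_succ, add_mul, mul_assoc, h2]

theorem quantumElementary_zero_succ (i : ℕ) : quantumElementary x q 0 (i + 1) = 0 := by
  simp [quantumElementary_eq_coeff, quantumDet_zero, Polynomial.coeff_one]

theorem quantumElementary_one_one : quantumElementary x q 1 1 = x 0 := by
  simp [quantumElementary_eq_coeff, quantumDet_one, Polynomial.coeff_one]

theorem quantumElementary_one_succ_succ (i : ℕ) : quantumElementary x q 1 (i + 2) = 0 := by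
  simp [quantumElementary_eq_coeff, quantumDet_one, Polynomial.coeff_one]

theorem quantumElementary_succ_succ_one (k : ℕ) : quantumElementary x q (k + 2) 1 =
    quantumElementary x q (k + 1) 1 + x (k + 1) := by
  have h := quantumElementary_zero x q (k + 1)
  rw [quantumElementary_eq_coeff] at h
  simp [quantumElementary_eq_coeff, quantumDet_succ_succ, add_mul, mul_assoc, h]

theorem quantumElementary_succ_succ_succ_succ (k i : ℕ) : quantumElementary x q (k + 2) (i + 2) =
    quantumElementary x q (k + 1) (i + 2) + x (k + 1) * quantumElementary x q (k + 1) (i + 1) +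
      q k * quantumElementary x q k i := by
  simp [quantumElementary_eq_coeff, quantumDet_succ_succ, add_mul, mul_assoc]

/-- The elementary symmetric polynomial `e_i(x_0, …, x_{k-1})`. -/
noncomputable def elem (k i : ℕ) : A := quantumElementary x 0 k i

theorem elem_zero (k : ℕ) : elem x k 0 = 1 := quantumElementary_zero x 0 k

theorem elem_zero_succ (i : ℕ) : elem x 0 (i + 1) = 0 := quantumElementary_zero_succ x 0 i

theorem elem_succ_succ (k i : ℕ) :
    elem x (k + 1) (i + 1) = elem x k (i + 1) + x k * elem x k i := by
  rcases k with _ | k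
  · rw [elem_zero_succ]
    rcases i with _ | i
    · rw [elem_zero, mul_one]; exact (quantumElementary_one_one x 0).trans (zero_add _).symm
    · rw [elem_zero_succ, mul_zero, add_zero]; exact quantumElementary_one_succ_succ x 0 i
  · rcases i with _ | i
    · rw [elem_zero, mul_one]; exact quantumElementary_succ_succ_one x 0 k
    · refine (quantumElementary_succ_succ_succ_succ x 0 k i).trans ?_
      rw [Pi.zero_apply, zero_mul, add_zero]
      rfl

theorem map_elem {B : Type*} [CommRing B] (φ : A →+* B) (k i : ℕ) :
    φ (elem x k i) = elem (fun j => φ (x j)) k i := by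
  rw [elem, elem, map_quantumElementary]
  congr 1
  exact funext fun _ => map_zero φ

theorem elem_eq_zero {k i : ℕ} (h : k < i) : elem x k i = 0 := by
  induction k generalizing i with
  | zero => obtain ⟨i, rfl⟩ := Nat.exists_eq_succ_of_ne_zero h.ne'; exact elem_zero_succ x i
  | succ k ih =>
    obtain ⟨i, rfl⟩ := Nat.exists_eq_succ_of_ne_zero (Nat.ne_zero_of_lt h)
    rw [Nat.succ_eq_add_one, elem_succ_succ, ih (by omega), ih (by omega), mul_zero, add_zero]

theorem elem_self (k : ℕ) : elem x k k = ∏ j ∈ Finset.range k, x j := by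
  induction k with
  | zero => exact elem_zero x 0
  | succ k ih =>
    rw [elem_succ_succ, elem_eq_zero x k.lt_succ_self, zero_add, ih, Finset.prod_range_succ,
      mul_comm]

/-- The rules for an operator that commutes with the variables like the divided difference in
`x_m` and `x_{m+1}`. -/
structure IsDividedDifference (m : ℕ) (T : A →+ A) : Prop where
  left : ∀ u, T (x m * u) = x (m + 1) * T u + u
  right : ∀ u, T (x (m + 1) * u) = x m * T u - u
  other : ∀ j u, j ≠ m → j ≠ m + 1 → T (x j * u) = x j * T u

variable {x} {m : ℕ} {T : A →+ A} (hT : IsDividedDifference x m T)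
include hT

theorem IsDividedDifference.elem_mul_of_le {k : ℕ} (hk : k ≤ m) (i : ℕ) (u : A) :
    T (elem x k i * u) = elem x k i * T u := by
  induction k generalizing i with
  | zero =>
    rcases i with _ | i
    · rw [elem_zero, one_mul, one_mul]
    · rw [elem_zero_succ, zero_mul, zero_mul, map_zero]
  | succ k ih =>
    rcases i with _ | i
    · rw [elem_zero, one_mul, one_mul]
    · rw [elem_succ_succ, add_mul, add_mul, map_add, mul_assoc, hT.other _ _ (by omega) (by omega),
        ih (by omega), ih (by omega), mul_assoc]

/-- `e_{i+1}(x_0, …, x_m)` is the only type of elementary symmetric polynomial on which the divided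
difference acts non-trivially. -/
theorem IsDividedDifference.elem_mul_self (i : ℕ) (u : A) (hu : T u = 0) :
    T (elem x (m + 1) (i + 1) * u) = elem x m i * u := by
  rw [elem_succ_succ, add_mul, map_add, mul_assoc, hT.left, hT.elem_mul_of_le le_rfl,
    hT.elem_mul_of_le le_rfl, hu, mul_zero, mul_zero, mul_zero, zero_add, zero_add]

theorem IsDividedDifference.elem_mul {k : ℕ} (hk : k ≠ m + 1) (i : ℕ) (u : A) :
    T (elem x k i * u) = elem x k i * T u := by
  rcases Nat.lt_or_ge k (m + 1) with h | h
  · exact hT.elem_mul_of_le (by omega) i u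
  replace h : m + 2 ≤ k := by omega
  clear hk
  induction k, h using Nat.le_induction generalizing i with
  | base =>
    rcases i with _ | _ | i
    · rw [elem_zero, one_mul, one_mul]
    · rw [elem_succ_succ, elem_succ_succ, elem_zero, elem_zero, mul_one, mul_one, add_mul, add_mul,
        map_add, map_add, hT.left, hT.right, hT.elem_mul_of_le le_rfl]
      ring
    · rw [elem_succ_succ, elem_succ_succ, elem_succ_succ]
      have e : (elem x m (i + 1 + 1) + x m * elem x m (i + 1) +
          x (m + 1) * (elem x m (i + 1) + x m * elem x m i)) * u = elem x m (i + 1 + 1) * u +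
          x m * (elem x m (i + 1) * u) + x (m + 1) * (elem x m (i + 1) * u) +
          x (m + 1) * (x m * (elem x m i * u)) := by ring
      rw [e, map_add, map_add, map_add, hT.left, hT.right, hT.right, hT.left,
        hT.elem_mul_of_le le_rfl, hT.elem_mul_of_le le_rfl, hT.elem_mul_of_le le_rfl]
      ring
  | succ k hk ih =>
    rcases i with _ | i
    · rw [elem_zero, one_mul, one_mul]
    · rw [elem_succ_succ, add_mul, add_mul, map_add, mul_assoc, hT.other _ _ (by omega) (by omega),
        ih, ih, mul_assoc]

end Elementary

/-! ### Expansion of Schubert polynomials in products of elementary symmetric polynomials -/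

section Expansion

variable {A : Type*} [CommRing A] [Algebra ℂ A] (x : ℕ → A) (n : ℕ)

/-- The product `e_{a_0}(x_0) e_{a_1}(x_0, x_1) ⋯ e_{a_{n-1}}(x_0, …, x_{n-1})`. -/
noncomputable def elemProd (a : ℕ → ℕ) : A := ∏ k ∈ Finset.range n, elem x (k + 1) (a k)

/-- The span of the products of elementary symmetric polynomials in initial sets of variables, one
for each initial set. -/
noncomputable def elemSpan : Submodule ℂ A := Submodule.span ℂ (Set.range (elemProd x n))

/-- Two elementary symmetric polynomials in `k` variables can be replaced by one in `k` and one in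
`k + 1` variables, by induction from
`e_b(k) e_{c+1}(k+1) - e_{b+1}(k+1) e_c(k) = e_b(k) e_{c+1}(k) - e_{b+1}(k) e_c(k)`. -/
theorem elem_mul_elem_mem {S : Submodule ℂ A} {k : ℕ} {z : A}
    (h : ∀ i j, elem x k i * elem x (k + 1) j * z ∈ S) (i j : ℕ) :
    elem x k i * elem x k j * z ∈ S := by
  induction j generalizing i with
  | zero => simpa only [elem_zero] using h i 0
  | succ j ih =>
    have e : elem x k i * elem x k (j + 1) * z = elem x k (i + 1) * elem x k j * z +
        (elem x k i * elem x (k + 1) (j + 1) * z - elem x k j * elem x (k + 1) (i + 1) * z) := by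
      rw [elem_succ_succ, elem_succ_succ]
      ring
    rw [e]
    exact S.add_mem (ih (i + 1)) (S.sub_mem (h _ _) (h _ _))

variable {x n}

theorem elemProd_mem (a : ℕ → ℕ) : elemProd x n a ∈ elemSpan x n :=
  Submodule.subset_span ⟨a, rfl⟩

theorem elemProd_eq_mul {m : ℕ} (hm : m < n) (a : ℕ → ℕ) : elemProd x n a =
    elem x (m + 1) (a m) * ∏ k ∈ (Finset.range n).erase m, elem x (k + 1) (a k) :=
  (Finset.mul_prod_erase _ _ (Finset.mem_range.2 hm)).symm

/-- A divided difference lowers `e_i(x_0, …, x_m)` to `e_{i-1}(x_0, …, x_{m-1})`, which leaves two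
factors in `m` variables. -/
theorem IsDividedDifference.elemProd_mem_elemSpan {m : ℕ} {T : A →+ A}
    (hT : IsDividedDifference x m T) (hT1 : T 1 = 0) (hm : m < n) (a : ℕ → ℕ) :
    T (elemProd x n a) ∈ elemSpan x n := by
  classical
  have hrest : ∀ s : Finset ℕ, m ∉ s → T (∏ k ∈ s, elem x (k + 1) (a k)) = 0 := by
    intro s
    induction s using Finset.induction_on with
    | empty => intro _; rwa [Finset.prod_empty]
    | insert k s hk ih =>
      intro h
      rw [Finset.mem_insert, not_or] at h
      rw [Finset.prod_insert hk, hT.elem_mul (by omega), ih h.2, mul_zero]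
  rw [elemProd_eq_mul hm]
  have h0 := hrest ((Finset.range n).erase m) (Finset.notMem_erase _ _)
  rcases a m with _ | i
  · rw [elem_zero, one_mul, h0]
    exact Submodule.zero_mem _
  rw [hT.elem_mul_self _ _ h0]
  rcases m with _ | m
  · rcases i with _ | i
    · have h := elemProd_mem (x := x) (n := n) (Function.update a 0 0)
      rw [elemProd_eq_mul hm, Function.update_self, elem_zero] at h
      rw [elem_zero]
      convert h using 2
      refine Finset.prod_congr rfl fun k hk => ?_
      rw [Function.update_of_ne (Finset.ne_of_mem_erase hk)]
    · rw [elem_zero_succ, zero_mul]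
      exact Submodule.zero_mem _
  · have hm' : m ∈ (Finset.range n).erase (m + 1) := by simp; omega
    rw [← Finset.mul_prod_erase _ _ hm', ← mul_assoc]
    refine elem_mul_elem_mem x (fun i j => ?_) _ _
    have h := elemProd_mem (x := x) (n := n) (Function.update (Function.update a m i) (m + 1) j)
    rw [elemProd_eq_mul hm, Function.update_self, ← Finset.mul_prod_erase _ _ hm',
      Function.update_of_ne (by omega), Function.update_self, ← mul_assoc,
      mul_comm (elem x (m + 1 + 1) j)] at h
    convert h using 2
    refine Finset.prod_congr rfl fun k hk => ?_
    have h1 := Finset.ne_of_mem_erase hk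
    have h2 := Finset.ne_of_mem_erase (Finset.mem_of_mem_erase hk)
    rw [Function.update_of_ne h2, Function.update_of_ne h1]

variable (x n) in
theorem prod_pow_eq_elemProd :
    ∏ k ∈ Finset.range (n + 1), x k ^ (n - k) = elemProd x n fun k => k + 1 := by
  simp only [elemProd, elem_self]
  induction n with
  | zero => simp
  | succ n ih =>
    rw [Finset.prod_range_succ (fun k => ∏ j ∈ Finset.range (k + 1), x j), ← ih,
      Finset.prod_range_succ _ (n + 1), Nat.sub_self, pow_zero, mul_one, ← Finset.prod_mul_distrib]
    refine Finset.prod_congr rfl fun k hk => ?_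
    rw [Finset.mem_range] at hk
    rw [← pow_succ]
    congr 1
    omega

/-- Elements of the span, as combinations of products with the index bounds `a_k ≤ k + 1`. -/
theorem exists_eq_sum_of_mem_elemSpan {f : A} (hf : f ∈ elemSpan x n) :
    ∃ z : ((k : Fin n) → Fin ((k : ℕ) + 2)) → ℂ,
      f = ∑ a, z a • ∏ k : Fin n, elem x ((k : ℕ) + 1) (a k) := by
  have h : elemSpan x n ≤ Submodule.span ℂ (Set.range
      fun a : (k : Fin n) → Fin ((k : ℕ) + 2) => ∏ k : Fin n, elem x ((k : ℕ) + 1) (a k)) := by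
    refine Submodule.span_le.2 ?_
    rintro _ ⟨a, rfl⟩
    by_cases ha : ∀ k < n, a k < k + 2
    · refine Submodule.subset_span ⟨fun k => ⟨a k, ha k k.2⟩, ?_⟩
      rw [elemProd, Finset.prod_range]
    · push Not at ha
      obtain ⟨k, hk, ha⟩ := ha
      rw [elemProd, Finset.prod_eq_zero (f := fun k => elem x (k + 1) (a k))
        (Finset.mem_range.2 hk) (elem_eq_zero x (by omega))]
      exact Submodule.zero_mem _
  obtain ⟨z, hz⟩ := (Submodule.mem_span_range_iff_exists_fun ℂ).1 (h hf)
  exact ⟨z, hz.symm⟩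

end Expansion

section Schubert

variable (n : ℕ)

/-- The variables of the polynomial ring, indexed from `0` and continued by `0`. -/
noncomputable def polyVar (k : ℕ) : MvPolynomial (Fin (n + 1)) ℂ :=
  if h : k < n + 1 then X ⟨k, h⟩ else 0

theorem isDividedDifference_divDiffA (i : Fin n) :
    IsDividedDifference (polyVar n) i (divDiffA n i).toAddMonoidHom := by
  have hne : (X i.castSucc - X i.succ : MvPolynomial (Fin (n + 1)) ℂ) ≠ 0 := by
    rw [sub_ne_zero]
    exact fun h => Fin.castSucc_lt_succ.ne (X_injective h)
  have hX : ∀ (j : Fin (n + 1)) (u : MvPolynomial (Fin (n + 1)) ℂ), divDiffA n i (X j * u) =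
      (X j - C ((Pi.single i.castSucc 1 - Pi.single i.succ 1 : Fin (n + 1) → ℂ) j) *
        (X i.castSucc - X i.succ)) * divDiffA n i u +
      C ((Pi.single i.castSucc 1 - Pi.single i.succ 1 : Fin (n + 1) → ℂ) j) * u := by
    intro j u
    refine mul_left_cancel₀ hne ?_
    have h1 := mul_divDiff _ hne (Pi.single i.castSucc 1 - Pi.single i.succ 1) (X j * u)
    have h2 := mul_divDiff _ hne (Pi.single i.castSucc 1 - Pi.single i.succ 1) u
    rw [map_mul (polyReflection _ _), polyReflection, aeval_X, ← polyReflection] at h1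
    rw [divDiffA, h1, mul_add, mul_left_comm, h2]
    ring
  have hl : polyVar n i = X i.castSucc := dif_pos (by omega)
  have hr : polyVar n (i + 1) = X i.succ := dif_pos (by omega)
  have hn := (Fin.castSucc_lt_succ (i := i)).ne
  refine ⟨fun u => ?_, fun u => ?_, fun j u h1 h2 => ?_⟩
  · change divDiffA n i _ = _ * divDiffA n i u + u
    rw [hl, hr, hX]
    simp [hn]
  · change divDiffA n i _ = _ * divDiffA n i u - u
    rw [hl, hr, hX]
    simp [hn.symm]
    ring
  · change divDiffA n i _ = _ * divDiffA n i u
    by_cases hj : j < n + 1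
    · rw [polyVar, dif_pos hj, hX]
      have e1 : (⟨j, hj⟩ : Fin (n + 1)) ≠ i.castSucc := fun h => h1 (congrArg Fin.val h)
      have e2 : (⟨j, hj⟩ : Fin (n + 1)) ≠ i.succ := fun h => h2 (congrArg Fin.val h)
      simp [e1, e2]
    · rw [polyVar, dif_neg hj, zero_mul, zero_mul, map_zero]

theorem divDiffA_one (i : Fin n) : divDiffA n i 1 = 0 := by
  have hne : (X i.castSucc - X i.succ : MvPolynomial (Fin (n + 1)) ℂ) ≠ 0 := by
    rw [sub_ne_zero]
    exact fun h => Fin.castSucc_lt_succ.ne (X_injective h)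
  refine mul_left_cancel₀ hne ?_
  rw [divDiffA, mul_divDiff _ hne, map_one (polyReflection _ _), sub_self, mul_zero]

theorem schubertPoly_mem_elemSpan (w : Equiv.Perm (Fin (n + 1))) :
    schubertPoly n w ∈ elemSpan (polyVar n) n := by
  rw [schubertPoly]
  induction reducedWord (simpleTransposition n) (w⁻¹ * Fin.revPerm) with
  | nil =>
    have h := elemProd_mem (x := polyVar n) (n := n) fun k => k + 1
    rw [← prod_pow_eq_elemProd, Finset.prod_range] at h
    have e : ∀ k : Fin (n + 1), polyVar n k = X k := fun k => dif_pos k.2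
    simp only [e] at h
    exact h
  | cons i l ih =>
    rw [List.map_cons, List.prod_cons, Module.End.mul_apply]
    have h : elemSpan (polyVar n) n ≤ (elemSpan (polyVar n) n).comap (divDiffA n i) := by
      refine Submodule.span_le.2 ?_
      rintro _ ⟨a, rfl⟩
      exact (isDividedDifference_divDiffA n i).elemProd_mem_elemSpan (divDiffA_one n i) i.2 a
    exact h ih

theorem exists_isQuantumSchubert (w : Equiv.Perm (Fin (n + 1))) :
    ∃ F, IsQuantumSchubert n w F := by
  obtain ⟨z, hz⟩ := exists_eq_sum_of_mem_elemSpan (schubertPoly_mem_elemSpan n w)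
  refine ⟨_, z, ?_, rfl⟩
  have hx : (fun j => map (C : ℂ →+* QA n) (polyVar n j)) = xVar n := by
    funext j
    rw [polyVar, xVar]
    split_ifs
    · exact map_X _ _
    · exact map_zero _
  rw [hz, map_sum]
  refine Finset.sum_congr rfl fun a _ => ?_
  rw [smul_eq_C_mul, map_mul, map_C, map_prod]
  congr 1
  refine Finset.prod_congr rfl fun k _ => ?_
  rw [map_elem, hx, elem]

end Schubert

/-! ### Weights and roots in type `A` -/

section TypeA

variable {ι M N : Type*} [Fintype ι] [AddCommGroup M] [Module ℂ M] [AddCommGroup N] [Module ℂ N]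
  {P : RootPairing ι ℂ M N} (b : P.Base) [P.IsRootSystem]

theorem eq_of_coroot'_eq {m m' : M} (h : ∀ i : b.support, P.coroot' i m = P.coroot' i m') :
    m = m' := by
  refine P.toPerfPair.injective (b.toCoweightBasis.ext fun i => ?_)
  rw [RootPairing.Base.toCoweightBasis_apply]
  exact h i

variable {n : ℕ} (e : Fin n ≃ b.support)

/-- The fundamental weights in type `A`, numbered from `1` and continued by `0`. -/
noncomputable def omegaA (k : ℕ) : M :=
  if h : 0 < k ∧ k ≤ n then fundWeight b (e ⟨k - 1, by omega⟩) else 0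

/-- The weights `x_0, …, x_n` of the standard representation in type `A`. -/
noncomputable def stdWeight (k : ℕ) : M := omegaA b e (k + 1) - omegaA b e k

theorem omegaA_succ {k : ℕ} (h : k < n) : omegaA b e (k + 1) = fundWeight b (e ⟨k, h⟩) :=
  dif_pos ⟨k.succ_pos, h⟩

theorem omegaA_zero : omegaA b e 0 = 0 := dif_neg (by omega)

theorem stdWeight_eq_zero {k : ℕ} (h : n < k) : stdWeight b e k = 0 := by
  rw [stdWeight, omegaA, omegaA, dif_neg (by omega), dif_neg (by omega), sub_zero]

theorem coroot'_simple_omegaA (j : Fin n) (k : ℕ) :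
    P.coroot' (e j) (omegaA b e k) = if k = j + 1 then 1 else 0 := by
  classical
  by_cases h : 0 < k ∧ k ≤ n
  · rw [omegaA, dif_pos h, coroot'_fundWeight, corootCoeff_simple]
    simp only [EmbeddingLike.apply_eq_iff_eq, Fin.ext_iff]
    have : (j : ℕ) = k - 1 ↔ k = j + 1 := by omega
    simp only [this]
    split_ifs <;> simp
  · have := j.2
    rw [omegaA, dif_neg h, map_zero, if_neg (by omega)]

theorem coroot'_simple_stdWeight (j : Fin n) (k : ℕ) :
    P.coroot' (e j) (stdWeight b e k) =
      (if k = j then 1 else 0) - if k = j + 1 then 1 else 0 := by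
  rw [stdWeight, map_sub, coroot'_simple_omegaA, coroot'_simple_omegaA]
  simp only [Nat.add_right_cancel_iff]

theorem coroot'_omegaA_eq_sum (γ : ι) (k : ℕ) :
    P.coroot' γ (omegaA b e k) = ∑ j ∈ Finset.range k, P.coroot' γ (stdWeight b e j) := by
  rw [← map_sum]
  simp only [stdWeight]
  rw [Finset.sum_range_sub, omegaA_zero, sub_zero]

theorem eq_of_coroot'_stdWeight_eq {γ δ : ι}
    (h : ∀ k, P.coroot' γ (stdWeight b e k) = P.coroot' δ (stdWeight b e k)) : γ = δ := by
  refine P.coroot.injective ?_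
  rw [coroot_eq_sum_corootCoeff b γ, coroot_eq_sum_corootCoeff b δ]
  refine Finset.sum_congr rfl fun i _ => ?_
  obtain ⟨k, rfl⟩ := e.surjective i
  have h1 : P.coroot' γ (omegaA b e (k + 1)) = P.coroot' δ (omegaA b e (k + 1)) := by
    rw [coroot'_omegaA_eq_sum, coroot'_omegaA_eq_sum]
    exact Finset.sum_congr rfl fun j _ => h j
  rw [omegaA_succ b e k.2, coroot'_fundWeight, coroot'_fundWeight] at h1
  rw [Int.cast_injective h1]

variable [P.IsCrystallographic] [P.IsReduced] {e}
  (he : ∀ i j, b.cartanMatrix (e i) (e j) = CartanMatrix.A n i j)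
include he

theorem root_eq_stdWeight_sub (i : Fin n) :
    P.root (e i) = stdWeight b e i - stdWeight b e (i + 1) := by
  refine eq_of_coroot'_eq b fun j => ?_
  obtain ⟨j, rfl⟩ := e.surjective j
  have h : P.pairingIn ℤ (e i) (e j) = CartanMatrix.A n i j := he i j
  rw [coroot'_root, h, map_sub, coroot'_simple_stdWeight, coroot'_simple_stdWeight]
  simp only [CartanMatrix.A, Matrix.of_apply, Fin.ext_iff]
  split_ifs <;> first | omega | norm_num

theorem reflection_stdWeight (i : Fin n) (k : ℕ) :
    P.reflection (e i) (stdWeight b e k) = stdWeight b e (Equiv.swap (i : ℕ) (i + 1) k) := by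
  rw [RootPairing.reflection_apply, coroot'_simple_stdWeight b e, root_eq_stdWeight_sub b he]
  by_cases h1 : k = i
  · rw [h1, Equiv.swap_apply_left, if_pos rfl, if_neg (by omega), sub_zero, one_smul]
    abel
  · by_cases h2 : k = i + 1
    · rw [h2, Equiv.swap_apply_right, if_pos rfl, if_neg (by omega), zero_sub, neg_smul, one_smul]
      abel
    · rw [Equiv.swap_apply_of_ne_of_ne h1 h2, if_neg h1, if_neg h2, sub_zero, zero_smul, sub_zero]

/-- The roots in type `A` are the differences of two weights of the standard representation. -/
theorem exists_coroot'_stdWeight (γ : ι) : ∃ i j : ℕ, i ≠ j ∧ ∀ k,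
    P.coroot' γ (stdWeight b e k) = (if k = i then 1 else 0) - if k = j then 1 else 0 := by
  induction γ using b.induction_reflect with
  | h₀ γ hγ =>
    obtain ⟨i, j, hij, h⟩ := hγ
    exact ⟨j, i, hij.symm, fun k => by rw [coroot'_neg, h, neg_sub]⟩
  | h₁ γ hγ =>
    obtain ⟨i, hi⟩ := e.surjective ⟨γ, hγ⟩
    refine ⟨i, i + 1, by omega, fun k => ?_⟩
    rw [← coroot'_simple_stdWeight b e i k, hi]
  | h₂ γ β hγ hβ =>
    obtain ⟨i, j, hij, h⟩ := hγ
    obtain ⟨m, hm⟩ := e.surjective ⟨β, hβ⟩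
    refine ⟨Equiv.swap (m : ℕ) (m + 1) i, Equiv.swap (m : ℕ) (m + 1) j,
      fun h' => hij ((Equiv.swap _ _).injective h'), fun k => ?_⟩
    have hβ' : β = e m := by rw [hm]
    rw [hβ', ← RootPairing.coroot'_reflection, reflection_stdWeight b he, h]
    simp only [Equiv.swap_apply_eq_iff]

theorem exists_coroot'_stdWeight_of_isPos {γ : ι} (hγ : b.IsPos γ) : ∃ i j : ℕ, i < j ∧ j ≤ n ∧
    ∀ k, P.coroot' γ (stdWeight b e k) = (if k = i then 1 else 0) - if k = j then 1 else 0 := by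
  obtain ⟨i, j, hij, h⟩ := exists_coroot'_stdWeight b he γ
  have hle : ∀ k, n < k → P.coroot' γ (stdWeight b e k) = 0 := fun k hk => by
    rw [stdWeight_eq_zero b e hk, map_zero]
  have hi : i ≤ n := by
    by_contra! hi
    have h1 := hle i hi
    rw [h, if_pos rfl, if_neg hij, sub_zero] at h1
    exact one_ne_zero h1
  have hj : j ≤ n := by
    by_contra! hj
    have h1 := hle j hj
    rw [h, if_pos rfl, if_neg hij.symm, zero_sub, neg_eq_zero] at h1
    exact one_ne_zero h1
  refine ⟨i, j, ?_, hj, h⟩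
  by_contra! hji
  have hlt : j < n := by omega
  have h1 := coroot'_omegaA_eq_sum b e γ (j + 1)
  simp only [h, Finset.sum_sub_distrib, Finset.sum_ite_eq', Finset.mem_range] at h1
  rw [if_neg (by omega), if_pos (by omega), omegaA_succ b e hlt, coroot'_fundWeight] at h1
  have h2 := corootCoeff_nonneg b hγ (e ⟨j, hlt⟩)
  have h3 : corootCoeff b γ (e ⟨j, hlt⟩) = -1 := by
    exact_mod_cast h1.trans (zero_sub _)
  omega

omit [P.IsRootSystem] he in
/-- The image of the simple root has height `1 - ⟨α_i, γ^∨⟩ ht(γ) ≤ 0`. -/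
theorem not_isPos_of_pairingIn_pos {γ : ι} (hγ : b.IsPos γ) (i : b.support)
    (h : 0 < P.pairingIn ℤ i γ) : ¬ b.IsPos (RootPairing.weylGroup.ofIdx P γ • (i : ι)) := by
  rw [ofIdx_smul_idx, ← height_pos_iff, height_reflectionPerm, b.height_one_of_mem_support i.2,
    not_lt, sub_nonpos]
  rw [← height_pos_iff] at hγ
  exact Int.add_one_le_of_lt (mul_pos h hγ)

/-- If `x_k` pairs non-trivially with a positive root other than `x_{k-1} - x_k`, then the
corresponding reflection has a descent among the simple roots with number at most `k` and different
from `k - 1`. -/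
theorem exists_descent {γ : ι} (hγ : b.IsPos γ) {k : ℕ}
    (h0 : P.coroot' γ (stdWeight b e k) ≠ 0)
    (hne : ∀ i : Fin n, (i : ℕ) + 1 = k → γ ≠ e i) :
    ∃ m : Fin n, (m : ℕ) ≤ k ∧ (m : ℕ) + 1 ≠ k ∧
      ¬ b.IsPos (RootPairing.weylGroup.ofIdx P γ • (e m : ι)) := by
  obtain ⟨i, j, hij, hj, h⟩ := exists_coroot'_stdWeight_of_isPos b he hγ
  have hi : i < n := by omega
  refine ⟨⟨i, hi⟩, ?_, fun hik => ?_, not_isPos_of_pairingIn_pos b hγ _ ?_⟩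
  · simp only
    by_contra! hki
    rw [h, if_neg (by omega), if_neg (by omega), sub_zero] at h0
    exact h0 rfl
  · simp only at hik
    refine hne ⟨i, hi⟩ hik (eq_of_coroot'_stdWeight_eq b e fun l => ?_)
    have hkj : j = i + 1 := by
      by_contra! hkj
      rw [h, if_neg (by omega), if_neg (by omega), sub_zero] at h0
      exact h0 rfl
    rw [h, coroot'_simple_stdWeight, hkj]
  · have h1 : P.coroot' γ (P.root (e ⟨i, hi⟩)) = 1 + if i + 1 = j then 1 else 0 := by
      rw [root_eq_stdWeight_sub b he, map_sub, h, h]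
      simp [hij.ne]
    rw [coroot'_root] at h1
    have h2 : P.pairingIn ℤ (e ⟨i, hi⟩) γ = 1 + if i + 1 = j then 1 else 0 := by
      exact_mod_cast h1
    rw [h2]
    split_ifs <;> norm_num

theorem isDividedDifference_demazure (i : Fin n) :
    IsDividedDifference (fun k => linForm b (stdWeight b e k)) i
      (demazure b (QRing b) (e i)).toAddMonoidHom := by
  have hX : ∀ (k : ℕ) (u : SymR b), demazure b (QRing b) (e i) (linForm b (stdWeight b e k) * u) =
      linForm b (stdWeight b e (Equiv.swap (i : ℕ) (i + 1) k)) * demazure b (QRing b) (e i) u +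
        C (C ((if k = i then 1 else 0) - if k = i + 1 then 1 else 0)) * u := by
    intro k u
    rw [demazure_linForm_mul, simpleReflection, ofIdx_smul_vec, reflection_stdWeight b he,
      coroot'_simple_stdWeight]
  refine ⟨fun u => ?_, fun u => ?_, fun j u h1 h2 => ?_⟩
  · refine (hX _ _).trans ?_
    simp
  · refine (hX _ _).trans ?_
    simp [sub_eq_add_neg]
    exact neg_one_mul u
  · refine (hX _ _).trans ?_
    simp [h1, h2, Equiv.swap_apply_of_ne_of_ne]

end TypeA

/-! ### Quantum elementary polynomials as operators -/

section Operators

variable {ι M N : Type*} [Fintype ι] [AddCommGroup M] [Module ℂ M] [AddCommGroup N] [Module ℂ N]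
  {P : RootPairing ι ℂ M N} (b : P.Base) [P.IsCrystallographic] [P.IsReduced]

theorem isSpecial_simple (i : b.support) : IsSpecial b i := by
  have hi := b.isPos_of_mem_support i.2
  refine ⟨hi, ?_⟩
  have h1 : b.flip.height i = 1 := b.flip.height_one_of_mem_support i.2
  have h2 := wordLength_ofIdx_le b hi
  have h3 := wordLength_mul_ofIdx_lt b (w := RootPairing.weylGroup.ofIdx P i) hi (by
    rw [ofIdx_smul_idx, isPos_neg_iff, not_not]
    exact hi)
  omega

variable [P.IsRootSystem]

theorem qCoroot_simple (i : b.support) : qCoroot b i = X i := by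
  classical
  rw [qCoroot, Finset.prod_eq_single i]
  · rw [corootCoeff_simple, if_pos rfl]
    simp
  · intro j _ hj
    rw [corootCoeff_simple, if_neg hj.symm]
    simp
  · simp


omit [P.IsReduced] in
theorem eq_sum_coroot'_smul_fundWeight (m : M) :
    m = ∑ i : b.support, P.coroot' i m • fundWeight b i := by
  classical
  refine eq_of_coroot'_eq b fun j => ?_
  rw [map_sum]
  simp only [map_smul, coroot'_fundWeight, corootCoeff_simple]
  simp

omit [P.IsRootSystem] [P.IsReduced] [P.IsCrystallographic] in
theorem quantumOp_sum_smul {E κ : Type*} [Ring E] [Algebra ℂ E] (T : b.support → E)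
    (A : M →ₗ[ℂ] E) (Q : ι → E) (s : Finset κ) (a : κ → ℂ) (v : κ → M) :
    quantumOp b T A Q (∑ i ∈ s, a i • v i) = ∑ i ∈ s, a i • quantumOp b T A Q (v i) := by
  simp only [quantumOp, map_sum, map_smul, smul_add, Finset.sum_add_distrib, Finset.smul_sum,
    Finset.sum_smul, smul_eq_mul, smul_smul]
  rw [Finset.sum_comm]

variable {Φ : SymR b →ₐ[QRing b] Module.End (QRing b) (SymR b)}
    (hΦ : ∀ i, Φ (X i) = chevalleyOperator b i)
include hΦ

theorem chevalleyHom_linForm (m : M) : Φ (linForm b m) =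
    quantumOp b (fun i : b.support => demazure b (QRing b) i) (mulWeight b)
      (fun γ => algebraMap (QRing b) (Module.End (QRing b) (SymR b)) (qCoroot b γ)) m := by
  conv_rhs => rw [eq_sum_coroot'_smul_fundWeight b m, quantumOp_sum_smul]
  rw [linForm_apply, map_sum]
  refine Finset.sum_congr rfl fun i _ => ?_
  rw [← chevalleyOperator_eq, ← hΦ, ← smul_eq_C_mul, map_smul Φ, ← algebraMap_eq, algebraMap_smul]

variable {n : ℕ} {e : Fin n ≃ b.support}
  (he : ∀ i j, b.cartanMatrix (e i) (e j) = CartanMatrix.A n i j)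
include he

omit hΦ in
/-- The term of the root `γ` in the operator `x_k` vanishes on `g`, because `s_γ` has a descent whose
Demazure operator kills `g`. -/
theorem smul_wordOp_apply_eq_zero {k : ℕ} {g : SymR b}
    (hg : ∀ i : Fin n, (i : ℕ) ≤ k → (i : ℕ) + 1 ≠ k → demazure b (QRing b) (e i) g = 0)
    {γ : ι} (hγ : b.IsPos γ) (hne : ∀ i : Fin n, (i : ℕ) + 1 = k → γ ≠ e i)
    (Q : Module.End (QRing b) (SymR b)) :
    (P.coroot' γ (stdWeight b e k) • (Q * wordOp b (fun i : b.support => demazure b (QRing b) i)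
      (RootPairing.weylGroup.ofIdx P γ))) g = 0 := by
  by_cases h0 : P.coroot' γ (stdWeight b e k) = 0
  · rw [h0, zero_smul, LinearMap.zero_apply]
  · obtain ⟨i, h1, h2, h3⟩ := exists_descent b he hγ h0 hne
    rw [(isNilCoxeter_demazure b).wordOp_mul_simple h3, LinearMap.smul_apply,
      Module.End.mul_apply, Module.End.mul_apply, hg i h1 h2, map_zero, map_zero, smul_zero]

theorem chevalleyHom_stdWeight_zero {g : SymR b}
    (hg : ∀ i : Fin n, (i : ℕ) = 0 → demazure b (QRing b) (e i) g = 0) :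
    Φ (linForm b (stdWeight b e 0)) g = linForm b (stdWeight b e 0) * g := by
  classical
  rw [chevalleyHom_linForm b hΦ, quantumOp, LinearMap.add_apply, mulWeight_apply,
    LinearMap.sum_apply, Finset.sum_eq_zero, add_zero]
  intro γ hγ
  rw [Finset.mem_filter] at hγ
  exact smul_wordOp_apply_eq_zero b he (fun i h1 _ => hg i (by omega)) hγ.2.1
    (fun i hi => by omega) _

/-- On polynomials killed by the other Demazure operators up to `∂_{k+1}`, the operator `x_{k+1}`
differs from multiplication by the term of the simple root `x_k - x_{k+1}` only. -/
theorem chevalleyHom_stdWeight_succ (k : Fin n) {g : SymR b}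
    (hg : ∀ i : Fin n, (i : ℕ) ≤ k + 1 → i ≠ k → demazure b (QRing b) (e i) g = 0) :
    Φ (linForm b (stdWeight b e (k + 1))) g = linForm b (stdWeight b e (k + 1)) * g -
      C (X (e k)) * demazure b (QRing b) (e k) g := by
  classical
  rw [chevalleyHom_linForm b hΦ, quantumOp, LinearMap.add_apply, mulWeight_apply,
    LinearMap.sum_apply, Finset.sum_eq_single (e k : ι), sub_eq_add_neg]
  · have h := (isNilCoxeter_demazure b).wordOp_simple (e k)
    rw [simpleReflection] at h
    rw [coroot'_simple_stdWeight, if_neg (by omega), if_pos rfl, zero_sub, h, qCoroot_simple,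
      LinearMap.smul_apply, Module.End.mul_apply, Module.algebraMap_end_apply, smul_eq_C_mul,
      neg_smul, one_smul]
  · intro γ hγ hne
    rw [Finset.mem_filter] at hγ
    refine smul_wordOp_apply_eq_zero b he (fun i h1 h2 => hg i h1 fun h => h2 (by rw [h]))
      hγ.2.1 (fun i hi h => hne ?_) _
    rw [h, show i = k from Fin.ext (by omega)]
  · intro h
    exact (h (Finset.mem_filter.2 ⟨Finset.mem_univ _, isSpecial_simple b (e k)⟩)).elim

omit hΦ he in
variable (e) in
/-- The quantum variables in type `A`, numbered from `0` and continued by `0`. -/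
noncomputable def qParam (k : ℕ) : SymR b := if h : k < n then C (X (e ⟨k, h⟩)) else 0

/-- Quantum elementary polynomials in the operators `x_0, …, x_{k-1}` act on polynomials that are
symmetric in `x_0, …, x_k` like elementary symmetric polynomials. -/
theorem chevalleyHom_quantumElementary {K : ℕ} (hK : K ≤ n) {f : SymR b}
    (hf : ∀ i : Fin n, (i : ℕ) < K → demazure b (QRing b) (e i) f = 0) (k : ℕ) (hk : k ≤ K)
    (a : ℕ) : Φ (quantumElementary (fun j => linForm b (stdWeight b e j)) (qParam b e) k a) f =
      elem (fun j => linForm b (stdWeight b e j)) k a * f := by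
  have hD := isDividedDifference_demazure b he
  induction k using Nat.strong_induction_on generalizing a with
  | _ k ih =>
  rcases a with _ | a
  · rw [quantumElementary_zero, elem_zero, map_one Φ, one_mul, Module.End.one_apply]
  have hkill : ∀ (k a : ℕ) (i : Fin n), (i : ℕ) < K → k ≠ i + 1 → demazure b (QRing b) (e i)
      (elem (fun j => linForm b (stdWeight b e j)) k a * f) = 0 := fun k a i h1 h2 => by
    have h := (hD i).elem_mul h2 a f
    refine h.trans ?_
    change _ * demazure b (QRing b) (e i) f = 0
    rw [hf i h1, mul_zero]
  rcases k with _ | _ | k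
  · rw [quantumElementary_zero_succ, elem_zero_succ, map_zero Φ, zero_mul, LinearMap.zero_apply]
  · rw [elem_succ_succ, elem_zero_succ]
    rcases a with _ | a
    · rw [elem_zero, mul_one, quantumElementary_one_one,
        chevalleyHom_stdWeight_zero b hΦ he fun i hi => hf i (by omega),
        zero_add (linForm b _)]
    · rw [elem_zero_succ, mul_zero, add_zero, zero_mul, quantumElementary_one_succ_succ, map_zero Φ,
        LinearMap.zero_apply]
  · have hkn : k < n := by omega
    have hx : ∀ a, Φ (linForm b (stdWeight b e (k + 1)))
        (elem (fun j => linForm b (stdWeight b e j)) (k + 1) a * f) =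
        linForm b (stdWeight b e (k + 1)) *
          (elem (fun j => linForm b (stdWeight b e j)) (k + 1) a * f) - C (X (e ⟨k, hkn⟩)) *
        demazure b (QRing b) (e ⟨k, hkn⟩)
          (elem (fun j => linForm b (stdWeight b e j)) (k + 1) a * f) := fun a =>
      chevalleyHom_stdWeight_succ b hΦ he ⟨k, hkn⟩ fun i h1 h2 => by
        simp only at h1
        exact hkill _ _ _ (by omega) fun h => h2 (Fin.ext (by simp only; omega))
    rcases a with _ | a
    · have h := hx 0
      rw [elem_zero, one_mul, hf ⟨k, hkn⟩ (by simp only; omega), mul_zero, sub_zero] at h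
      rw [quantumElementary_succ_succ_one, map_add Φ, LinearMap.add_apply, ih (k + 1) (by omega)
        (by omega), h, elem_succ_succ _ (k + 1) 0, elem_zero, mul_one, add_mul]
    · have h := hx (a + 1)
      have h1 : demazure b (QRing b) (e ⟨k, hkn⟩)
          (elem (fun j => linForm b (stdWeight b e j)) (k + 1) (a + 1) * f) =
          elem (fun j => linForm b (stdWeight b e j)) k a * f :=
        (hD ⟨k, hkn⟩).elem_mul_self a f (hf ⟨k, hkn⟩ (by simp only; omega))
      rw [quantumElementary_succ_succ_succ_succ, map_add Φ, map_add Φ, map_mul Φ, map_mul Φ,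
        LinearMap.add_apply, LinearMap.add_apply, Module.End.mul_apply, Module.End.mul_apply,
        ih (k + 1) (by omega) (by omega), ih (k + 1) (by omega) (by omega),
        ih k (by omega) (by omega), h, h1, elem_succ_succ _ (k + 1), qParam, dif_pos hkn,
        show Φ (C (X (e ⟨k, hkn⟩))) = algebraMap (QRing b) _ (X (e ⟨k, hkn⟩)) from Φ.commutes _,
        Module.algebraMap_end_apply, smul_eq_C_mul]
      ring

/-- The operators are applied in the order in which each of them acts on a polynomial with the
required symmetry. -/
theorem chevalleyHom_prod_quantumElementary (a : ℕ → ℕ) :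
    Φ (∏ k ∈ Finset.range n,
      quantumElementary (fun j => linForm b (stdWeight b e j)) (qParam b e) (k + 1) (a k)) 1 =
      elemProd (fun j => linForm b (stdWeight b e j)) n a := by
  have hD := isDividedDifference_demazure b he
  rw [elemProd, Finset.range_eq_Ico]
  have hkill : ∀ (i : Fin n) (s : Finset ℕ), (i : ℕ) ∉ s → demazure b (QRing b) (e i)
      (∏ k ∈ s, elem (fun j => linForm b (stdWeight b e j)) (k + 1) (a k)) = 0 := by
    intro i s
    induction s using Finset.induction_on with
    | empty =>
      intro _
      rw [Finset.prod_empty, ← map_one C]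
      exact demazure_C b (e i) 1
    | insert k s hk ih =>
      intro h
      rw [Finset.mem_insert, not_or] at h
      rw [Finset.prod_insert hk]
      refine ((hD i).elem_mul (by omega) _ _).trans ?_
      change _ * demazure b (QRing b) (e i) _ = 0
      rw [ih h.2, mul_zero]
  have key : ∀ d ≤ n, Φ (∏ k ∈ Finset.Ico (n - d) n,
      quantumElementary (fun j => linForm b (stdWeight b e j)) (qParam b e) (k + 1) (a k)) 1 =
      ∏ k ∈ Finset.Ico (n - d) n, elem (fun j => linForm b (stdWeight b e j)) (k + 1) (a k) := by
    intro d
    induction d with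
    | zero =>
      intro _
      rw [Nat.sub_zero, Finset.Ico_self, Finset.prod_empty, Finset.prod_empty, map_one Φ,
        Module.End.one_apply]
    | succ d ih =>
      intro hd
      have e1 : n - (d + 1) + 1 = n - d := by omega
      have e2 : n - (d + 1) < n := by omega
      rw [Finset.prod_eq_prod_Ico_succ_bot e2, Finset.prod_eq_prod_Ico_succ_bot e2, map_mul Φ, Module.End.mul_apply, e1, ih (by omega)]
      exact chevalleyHom_quantumElementary b hΦ he (Nat.sub_le n d)
        (fun i hi => hkill i _ (by rw [Finset.mem_Ico]; omega)) _ le_rfl _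
  have h := key n le_rfl
  rwa [Nat.sub_self] at h

omit hΦ [P.IsReduced] [P.IsCrystallographic] he in
theorem polyToSymR_xVar (k : ℕ) : polyToSymR b e (xVar n k) = linForm b (stdWeight b e k) := by
  rw [xVar]
  split_ifs with h
  · rw [polyToSymR, coe_eval₂Hom, eval₂_X, weightA, stdWeight, map_sub]
    congr 1
    · split_ifs with h1
      · rw [omegaA_succ b e h1, linForm_fundWeight]
      · rw [omegaA, dif_neg (by simp only at h1; omega), map_zero]
    · rcases k with _ | k
      · rw [dif_neg (by simp), omegaA_zero, map_zero]
      · rw [dif_pos (by simp), omegaA_succ b e (by omega), linForm_fundWeight]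
        rfl
  · rw [map_zero, stdWeight_eq_zero b e (by omega), map_zero]

omit hΦ [P.IsReduced] [P.IsRootSystem] [P.IsCrystallographic] he in
theorem polyToSymR_qVar (k : ℕ) : polyToSymR b e (qVar n k) = qParam b e k := by
  rw [qVar, qParam]
  split_ifs with h
  · rw [polyToSymR, coe_eval₂Hom, eval₂_C]
    simp
  · exact map_zero _

omit hΦ [P.IsReduced] [P.IsRootSystem] [P.IsCrystallographic] he in
theorem polyToSymR_C_C (z : ℂ) : polyToSymR b e (C (C z)) = C (C z) := by
  rw [polyToSymR, coe_eval₂Hom, eval₂_C]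
  simp

/-- The quantum Schubert polynomial, as a polynomial in the Chevalley operators, yields the Schubert
polynomial when applied to `1`. -/
theorem IsQuantumSchubert.apply_one {w : Equiv.Perm (Fin (n + 1))}
    {F : MvPolynomial (Fin (n + 1)) (QA n)} (hF : IsQuantumSchubert n w F) :
    Φ (polyToSymR b e F) 1 = polyToSymR b e (map C (schubertPoly n w)) := by
  obtain ⟨z, h1, rfl⟩ := hF
  rw [h1, map_sum, map_sum, map_sum, LinearMap.sum_apply]
  refine Finset.sum_congr rfl fun a _ => ?_
  have h := chevalleyHom_prod_quantumElementary b hΦ he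
    fun k => if h : k < n then (a ⟨k, h⟩ : ℕ) else 0
  rw [elemProd, Finset.prod_range, Finset.prod_range] at h
  simp only [Fin.is_lt, dif_pos] at h
  rw [map_mul (polyToSymR b e), map_mul (polyToSymR b e), polyToSymR_C_C,
    map_prod (polyToSymR b e), map_prod (polyToSymR b e)]
  simp only [map_quantumElementary, polyToSymR_xVar, polyToSymR_qVar, Pi.zero_apply, map_zero]
  rw [← smul_eq_C_mul, ← smul_eq_C_mul, map_smul Φ, LinearMap.smul_apply, h]
  rfl

end Operators

end NicholsSchubert

theorem mainTheorem4 {ι M N : Type*} [Fintype ι] [AddCommGroup M] [Module ℂ M]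
    [AddCommGroup N] [Module ℂ N] (P : RootPairing ι ℂ M N) [P.IsRootSystem]
    [P.IsCrystallographic] [P.IsReduced] (b : P.Base)
    (c : ι → ℂ) (hc : ∀ γ, c γ ≠ 0)
    (hcW : ∀ (w : P.weylGroup) (γ : ι), c (P.weylGroupToPerm w γ) = c γ) :
    ∃ (μ : SymR b →ₐ[QRing b] NicholsR b)
      (μq : SymR b →ₐ[QRing b] Module.End (QRing b) (NicholsR b)),
      (∀ i, μ (X i) = classicalElement b c i) ∧
      (∀ i, μq (X i) = quantizedElement b c i) ∧
      (∀ (n : ℕ) (e : Fin n ≃ b.support),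
        (∀ i j, b.cartanMatrix (e i) (e j) = CartanMatrix.A n i j) →
        ∀ w : Equiv.Perm (Fin (n + 1)),
          (∃ F, IsQuantumSchubert n w F) ∧
          ∀ F, IsQuantumSchubert n w F →
            μq (polyToSymR b e F) 1 = μ (polyToSymR b e (map C (schubertPoly n w)))) ∧
      (∀ w : P.weylGroup,
        (∃ F, IsQuantization b (bggPoly b w) F) ∧
        ∀ F, IsQuantization b (bggPoly b w) F →
          μq F 1 = μ (toSymR b (bggPoly b w))) := by
  obtain ⟨μ, hμ⟩ := exists_algHom_of_commute (σ := b.support) (R := QRing b) (A := NicholsR b)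
    (classicalElement b c) (commute_classicalElement b hcW)
  obtain ⟨μq, hμq⟩ := exists_algHom_of_commute (σ := b.support) (R := QRing b)
    (A := Module.End (QRing b) (NicholsR b)) (quantizedElement b c)
    (commute_quantizedElement b hcW hc)
  obtain ⟨Φ, hΦ⟩ := exists_chevalleyHom b
  refine ⟨μ, μq, hμ, hμq, fun n e he w => ⟨exists_isQuantumSchubert n w, fun F hF => ?_⟩,
    fun w => ⟨?_, ?_⟩⟩
  · rw [map_apply_one b hcW hc hμ hμq hΦ, IsQuantumSchubert.apply_one b hΦ he hF]
  · obtain ⟨F, hF⟩ := exists_apply_one_eq b hΦ (toSymR b (bggPoly b w))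
    exact ⟨F, Φ, hΦ, hF⟩
  · rintro F ⟨Ψ, hΨ, hF⟩
    rw [map_apply_one b hcW hc hμ hμq hΨ, hF]
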